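/- Let $\mathcal C$ and $\mathcal D$ be abelian monoidal categories (tensor products additive in each variable) and let $F:\mathcal C\to\mathcal D$ be a functor with a (lax) monoidal structure: a morphism $\eta:\mathbf 1_{\mathcal D}\to F\mathbf 1_{\mathcal C}$ and a natural transformation $\mu^{X,Y}:FX\otimes FY\to F(X\otimes Y)$, subject to the usual unit and associativity axioms. Canonical associativity and unit isomorphisms are suppressed, and we write formulas with elements. *Hochschild complex.* For $k\ge 0$ let $C^k$ be the abelian group of natural transformations $c^{X_1,\dots,X_k}:FX_1\otimes\cdots\otimes FX_k\to F(X_1\otimes\cdots\otimes X_k)$ of functors of $k$ variables (so $C^0=\mathrm{Hom}(\mathbf 1_{\mathcal D},F\mathbf 1_{\mathcal C})$), and $C^k=0$ for $k<0$. For $c\in C^k$ define $\mathrm dc\in C^{k+1}$ by $$(\mathrm dc)(n_1,\dots,n_{k+1})=(-1)^{k-1}\mu(n_1,c(n_2,\dots,n_{k+1}))+\sum_{i=1}^k(-1)^{i+k-1}c(n_1,\dots,\mu(n_i,n_{i+1}),\dots,n_{k+1})+\mu(c(n_1,\dots,n_k),n_{k+1});$$ for $k=0$ this reads $(\mathrm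 dc)(n)=\mu(c,n)-\mu(n,c)$. *Product.* For $c\in C^i$, $c'\in C^j$ let $c\cdot c'\in C^{i+j}$ be $$(c\cdot c')(n_1,\dots,n_{i+j})=(-1)^{ij}\mu\bigl(c(n_1,\dots,n_i)\otimes c'(n_{i+1},\dots,n_{i+j})\bigr).$$ *Substitutions (braces).* For $c\in C^i$, $c_p\in C^{j_p}$ ($1\le p\le r$) and $N=i+j_1+\cdots+j_r-r$ let $c\{c_1,\dots,c_r\}=c\circ(c_1,\dots,c_r)\in C^N$ be $$\sum(-1)^{\sum_p(j_p-1)k_p}\,c\bigl(n_1,\dots,n_{k_1},c_1(n_{k_1+1},\dots,n_{k_1+j_1}),\dots,n_{k_r},c_r(n_{k_r+1},\dots,n_{k_r+j_r}),\dots,n_N\bigr),$$ the sum being over all $0\le k_1$, $k_1+j_1\le k_2$, $\dots$, $k_r+j_r\le N$ (an empty sum is $0$; for $r=0$ this is $c$). **Theorem.** The graded abelian group $C^\bullet=\bigoplus_k C^k$ with $\mathrm d$, the product and the substitutions is a strong homotopy Gerstenhaber algebra (homotopy G-algebra of Gerstenhaber and Voronov). That is, writing $\deg x=n$ and $|x|=n-1$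 for $x\in C^n$, all operations are well defined and additive in each variable, $\mathrm d$, the product and $x\{x_1,\dots,x_n\}$ have degrees $1$, $0$ and $-n$, and for all homogeneous elements: 1. $\mathrm d^2=0$, the product is associative, and $\mathrm d(xy)=(\mathrm dx)y+(-1)^{\deg x}x\,\mathrm dy$; 2. $x\{\}=x$, and (pre-Jacobi identity) $$x\{x_1,\dots,x_m\}\{y_1,\dots,y_n\}=\sum_{0\le i_1\le l_1\le i_2\le\cdots\le i_m\le l_m\le n}(-1)^{\sum_p|x_p|\sum_{q\le i_p}|y_q|}\,x\{y_1,\dots,y_{i_1},x_1\{y_{i_1+1},\dots,y_{l_1}\},y_{l_1+1},\dots,y_{i_m},x_m\{y_{i_m+1},\dots,y_{l_m}\},\dots,y_n\};$$ 3. $(x_1x_2)\{y_1,\dots,y_n\}=\sum_{k=0}^n(-1)^{(|x_2|+1)(|y_1|+\cdots+|y_k|)}\,x_1\{y_1,\dots,y_k\}\cdot x_2\{y_{k+1},\dots,y_n\}$; 4. for $n\ge0$, $$\begin{aligned}&\mathrm d(x\{x_1,\dots,x_{n+1}\})-(\mathrm dx)\{x_1,\dots,x_{n+1}\}-(-1)^{|x|}\sum_{i=1}^{n+1}(-1)^{|x_1|+\cdots+|x_{i-1}|}x\{x_1,\dots,\mathrm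 dx_i,\dots,x_{n+1}\}\\&=(-1)^{(|x|+1)|x_1|}x_1\cdot x\{x_2,\dots,x_{n+1}\}-(-1)^{|x|}\sum_{i=1}^{n}(-1)^{|x_1|+\cdots+|x_i|}x\{x_1,\dots,x_i\cdot x_{i+1},\dots,x_{n+1}\}\\&\quad+(-1)^{|x|+|x_1|+\cdots+|x_n|}x\{x_1,\dots,x_n\}\cdot x_{n+1}.\end{aligned}$$ -/

import Mathlib

open CategoryTheory MonoidalCategory

universe v₁ v₂ u₁ u₂

/-! ### Strong homotopy Gerstenhaber algebras -/

namespace HomotopyG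

variable {A : Type*} [AddCommGroup A]

/-- A homogeneous element of a `ℤ`-graded abelian group `(V n)`, together with its degree. -/
abbrev Homog (V : ℤ → AddSubgroup A) : Type _ := Σ n : ℤ, V n

/-- The underlying element. -/
def Homog.val {V : ℤ → AddSubgroup A} (x : Homog V) : A := (x.2 : A)

/-- The degree of a homogeneous element. -/
def Homog.deg {V : ℤ → AddSubgroup A} (x : Homog V) : ℤ := x.1

/-- The shifted degree `|x| = deg x - 1`. -/
def Homog.sdeg {V : ℤ → AddSubgroup A} (x : Homog V) : ℤ := x.1 - 1

/-- The underlying elements of a list of homogeneous elements. -/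
def vals {V : ℤ → AddSubgroup A} (xs : List (Homog V)) : List A := xs.map Homog.val

/-- The sum of the shifted degrees `|x₁| + ⋯ + |xₙ|`. -/
def sdegs {V : ℤ → AddSubgroup A} (xs : List (Homog V)) : ℤ := (xs.map Homog.sdeg).sum

/-- `nestings brace [x₁, …, xₘ] s [y₁, …, yₙ]` lists, with signs, the sequences
`y₁, …, y_{i₁}, x₁{y_{i₁+1}, …, y_{j₁}}, y_{j₁+1}, …, y_{iₘ}, xₘ{y_{iₘ+1}, …, y_{jₘ}}, …, yₙ`
for all `0 ≤ i₁ ≤ j₁ ≤ i₂ ≤ ⋯ ≤ iₘ ≤ jₘ ≤ n`.  The sign is `(-1)^ε` with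
`ε = ∑ₚ |xₚ| (s + |y₁| + ⋯ + |y_{iₚ}|)`.  One such sequence is built by choosing the number
`k` of `y`'s in front of `x₁`, the number `j` of `y`'s which go into `x₁`, and then
a sequence for the remaining `x`'s and `y`'s. -/
def nestings {V : ℤ → AddSubgroup A} (brace : A → List A → A) :
    List (Homog V) → ℤ → List (Homog V) → List (ℤˣ × List A)
  | [], _, ys => [(1, vals ys)]
  | x :: xs, s, ys =>
    (List.range (ys.length + 1)).flatMap fun k =>
      (List.range ((ys.drop k).length + 1)).flatMap fun j =>
        (nestings brace xs (s + sdegs (ys.take k) + sdegs ((ys.drop k).take j))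
            ((ys.drop k).drop j)).map fun t =>
          ((x.sdeg * (s + sdegs (ys.take k))).negOnePow * t.1,
            vals (ys.take k) ++ brace x.val (vals ((ys.drop k).take j)) :: t.2)

/-- Let `V = ⨁ₙ V n` be a `ℤ`-graded abelian group, presented by an independent family of
subgroups of an ambient abelian group `A`, and let `d x`, `mul x y = x · y` and
`brace x [x₁, …, xₙ] = x{x₁, …, xₙ}` be operations.  `IsHomotopyGAlgebra V d mul brace` says that
the operations restrict to (multi)additive operations on homogeneous elements of `V`, of degrees
`1`, `0` and `-n` respectively, which make `V` a strong homotopy Gerstenhaber algebra in the sense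
of Gerstenhaber and Voronov: a differential graded associative algebra and a brace algebra,
subject to the two compatibilities `mul_brace` and `d_brace`. -/
structure IsHomotopyGAlgebra (V : ℤ → AddSubgroup A) (d : A → A) (mul : A → A → A)
    (brace : A → List A → A) : Prop where
  indep : iSupIndep V
  -- the differential
  d_mem : ∀ x : Homog V, d x.val ∈ V (x.deg + 1)
  d_add : ∀ (n : ℤ) (x y : V n), d ((x : A) + y) = d x + d y
  d_d : ∀ x : Homog V, d (d x.val) = 0
  -- the dot product
  mul_mem : ∀ x y : Homog V, mul x.val y.val ∈ V (x.deg + y.deg)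
  add_mul : ∀ (n : ℤ) (x y : V n) (z : Homog V),
    mul ((x : A) + y) z.val = mul x z.val + mul y z.val
  mul_add : ∀ (x : Homog V) (n : ℤ) (y z : V n),
    mul x.val ((y : A) + z) = mul x.val y + mul x.val z
  mul_assoc : ∀ x y z : Homog V, mul (mul x.val y.val) z.val = mul x.val (mul y.val z.val)
  d_mul : ∀ x y : Homog V,
    d (mul x.val y.val) = mul (d x.val) y.val + x.deg.negOnePow • mul x.val (d y.val)
  -- the braces
  brace_mem : ∀ (x : Homog V) (xs : List (Homog V)),
    brace x.val (vals xs) ∈ V (x.deg + (xs.map Homog.deg).sum - xs.length)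
  brace_add_left : ∀ (n : ℤ) (x y : V n) (zs : List (Homog V)),
    brace ((x : A) + y) (vals zs) = brace x (vals zs) + brace y (vals zs)
  brace_add_right : ∀ (x : Homog V) (as : List (Homog V)) (n : ℤ) (y z : V n)
      (bs : List (Homog V)),
    brace x.val (vals as ++ ((y : A) + z) :: vals bs) =
      brace x.val (vals as ++ (y : A) :: vals bs) + brace x.val (vals as ++ (z : A) :: vals bs)
  brace_nil : ∀ x : Homog V, brace x.val [] = x.val
  /-- The (higher) pre-Jacobi identity: `x{x₁, …, xₘ}{y₁, …, yₙ}` is the signed sum of all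
  `x{y₁, …, y_{i₁}, x₁{y_{i₁+1}, …, y_{j₁}}, y_{j₁+1}, …, xₘ{y_{iₘ+1}, …, y_{jₘ}}, …, yₙ}`. -/
  brace_brace : ∀ (x : Homog V) (xs ys : List (Homog V)),
    brace (brace x.val (vals xs)) (vals ys) =
      ((nestings brace xs 0 ys).map fun t => t.1 • brace x.val t.2).sum
  /-- Distributivity: `(x₁ · x₂){y₁, …, yₙ}` is the sum over `0 ≤ k ≤ n` of
  `± x₁{y₁, …, yₖ} · x₂{yₖ₊₁, …, yₙ}`, with sign exponent `(|x₂| + 1)(|y₁| + ⋯ + |yₖ|)`. -/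
  mul_brace : ∀ (x₁ x₂ : Homog V) (ys : List (Homog V)),
    brace (mul x₁.val x₂.val) (vals ys) =
      ∑ k ∈ Finset.range (ys.length + 1),
        ((x₂.sdeg + 1) * sdegs (ys.take k)).negOnePow •
          mul (brace x₁.val (vals (ys.take k))) (brace x₂.val (vals (ys.drop k)))
  /-- The higher homotopies: for `n ≥ 0`
  `d(x{x₁, …, xₙ₊₁}) - (dx){x₁, …, xₙ₊₁}
      - (-1)^|x| ∑ᵢ (-1)^(|x₁| + ⋯ + |xᵢ₋₁|) x{x₁, …, dxᵢ, …, xₙ₊₁}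
    = (-1)^((|x| + 1)|x₁|) x₁ · x{x₂, …, xₙ₊₁}
      - (-1)^|x| ∑ᵢ (-1)^(|x₁| + ⋯ + |xᵢ|) x{x₁, …, xᵢ · xᵢ₊₁, …, xₙ₊₁}
      + (-1)^(|x| + |x₁| + ⋯ + |xₙ|) x{x₁, …, xₙ} · xₙ₊₁`. -/
  d_brace : ∀ (x : Homog V) (n : ℕ) (y : Fin (n + 1) → Homog V),
    d (brace x.val (vals (List.ofFn y))) - brace (d x.val) (vals (List.ofFn y))
        - x.sdeg.negOnePow • ∑ i : Fin (n + 1),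
            (sdegs ((List.ofFn y).take i)).negOnePow •
              brace x.val (vals ((List.ofFn y).take i) ++
                d (y i).val :: vals ((List.ofFn y).drop (i + 1))) =
      ((x.sdeg + 1) * (y 0).sdeg).negOnePow •
          mul (y 0).val (brace x.val (vals ((List.ofFn y).drop 1)))
        - x.sdeg.negOnePow • ∑ i : Fin n,
            (sdegs ((List.ofFn y).take (i + 1))).negOnePow •
              brace x.val (vals ((List.ofFn y).take i) ++
                mul (y i.castSucc).val (y i.succ).val :: vals ((List.ofFn y).drop (i + 2)))
        + (x.sdeg + sdegs ((List.ofFn y).take n)).negOnePow •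
            mul (brace x.val (vals ((List.ofFn y).take n))) (y (Fin.last n)).val

end HomotopyG

/-! ### Iterated tensor products -/

namespace MonoidalHochschild

section Tensor

variable {C : Type u₁} [Category.{v₁} C] {D : Type u₂} [Category.{v₂} D] [MonoidalCategory D]

/-- `G x₁ ⊗ (G x₂ ⊗ (⋯ ⊗ (G xₖ ⊗ 𝟙)))`; the empty tensor product is the unit object. -/
def tensorList (G : C ⥤ D) : List C → D
  | [] => 𝟙_ D
  | x :: l => G.obj x ⊗ tensorList G l

/-- A morphism in `Cᵏ` between two `k`-tuples (lists of length `k`) of objects. -/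
inductive ListHom : List C → List C → Type (max u₁ v₁)
  | nil : ListHom [] []
  | cons {x y : C} {l m : List C} (f : x ⟶ y) (φ : ListHom l m) : ListHom (x :: l) (y :: m)

/-- The action of the iterated tensor product on morphisms. -/
def tensorListMap (G : C ⥤ D) :
    {l m : List C} → ListHom l m → (tensorList G l ⟶ tensorList G m)
  | _, _, .nil => 𝟙 _
  | _, _, .cons f φ => G.map f ⊗ₘ tensorListMap G φ

/-- The canonical isomorphism
`G x₁ ⊗ ⋯ ⊗ G xₙ ≅ (G x₁ ⊗ ⋯ ⊗ G xₖ) ⊗ (G xₖ₊₁ ⊗ ⋯ ⊗ G xₙ)`. -/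
def splitIso (G : C ⥤ D) : (k : ℕ) → (l : List C) →
    (tensorList G l ≅ tensorList G (l.take k) ⊗ tensorList G (l.drop k))
  | 0, l => (λ_ (tensorList G l)).symm
  | _ + 1, [] => (λ_ (𝟙_ D)).symm
  | k + 1, x :: l => whiskerLeftIso (G.obj x) (splitIso G k l) ≪≫ (α_ _ _ _).symm

end Tensor

/-! ### The Hochschild complex of a (lax) monoidal functor -/

section Hochschild

variable {C : Type u₁} [Category.{v₁} C] [MonoidalCategory C]
  {D : Type u₂} [Category.{v₂} D] [MonoidalCategory D]

/-- Families of morphisms `F x₁ ⊗ ⋯ ⊗ F xₖ ⟶ F (x₁ ⊗ ⋯ ⊗ xₖ)`, without any naturality, for all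
`k` and all `x₁, …, xₖ`.  For `k = 0` this is a morphism `𝟙 ⟶ F 𝟙`. -/
abbrev Family (F : C ⥤ D) : Type (max u₁ v₂) :=
  ∀ l : List C, tensorList F l ⟶ F.obj (tensorList (𝟭 C) l)

/-- Naturality in all variables. -/
def IsNatural (F : C ⥤ D) (c : Family F) : Prop :=
  ∀ (l m : List C) (φ : ListHom l m),
    tensorListMap F φ ≫ c m = c l ≫ F.map (tensorListMap (𝟭 C) φ)

/-- The group of Hochschild `n`-cochains: natural transformations
`F x₁ ⊗ ⋯ ⊗ F xₙ ⟶ F (x₁ ⊗ ⋯ ⊗ xₙ)` of functors of `n` variables, realised as natural families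
which vanish on all lists of length different from `n`. It is zero for `n < 0`. -/
def cochains [Preadditive D] (F : C ⥤ D) (n : ℤ) : AddSubgroup (Family F) where
  carrier := {c | IsNatural F c ∧ ∀ l : List C, (l.length : ℤ) ≠ n → c l = 0}
  add_mem' := by
    rintro a b ⟨ha, ha'⟩ ⟨hb, hb'⟩
    refine ⟨fun l m φ => ?_, fun l hl => ?_⟩
    · simp [ha l m φ, hb l m φ]
    · simp [ha' l hl, hb' l hl]
  zero_mem' := ⟨fun l m φ => by simp, fun l _ => rfl⟩
  neg_mem' := by
    rintro a ⟨ha, ha'⟩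
    refine ⟨fun l m φ => ?_, fun l hl => ?_⟩
    · simp [ha l m φ]
    · simp [ha' l hl]

/-- `μ (c (n₁, …, nₖ) ⊗ c' (nₖ₊₁, …, nₙ))`. -/
def juxtapose (F : C ⥤ D) [F.LaxMonoidal] (c c' : Family F) (k : ℕ) (l : List C) :
    tensorList F l ⟶ F.obj (tensorList (𝟭 C) l) :=
  (splitIso F k l).hom ≫ (c (l.take k) ⊗ₘ c' (l.drop k)) ≫
    Functor.LaxMonoidal.μ F _ _ ≫ F.map (splitIso (𝟭 C) k l).inv

/-- The identity transformation `F x ⟶ F x`, as a `1`-cochain. -/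
def identityCochain [Preadditive D] (F : C ⥤ D) : Family F
  | [x] => (ρ_ (F.obj x)).hom ≫ F.map (ρ_ x).inv
  | _ => 0

/-- A way of combining the inputs `F x₁ ⊗ ⋯ ⊗ F xₙ` into new inputs `F z₁ ⊗ ⋯ ⊗ F zᵢ`, along with
a (coherence) morphism `z₁ ⊗ ⋯ ⊗ zᵢ ⟶ x₁ ⊗ ⋯ ⊗ xₙ`. -/
structure Regrouping (F : C ⥤ D) (l : List C) where
  outer : List C
  hom : tensorList F l ⟶ tensorList F outer
  coh : tensorList (𝟭 C) outer ⟶ tensorList (𝟭 C) l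

namespace Regrouping

variable {F : C ⥤ D}

/-- Leave all inputs alone. -/
def refl (F : C ⥤ D) (l : List C) : Regrouping F l := ⟨l, 𝟙 _, 𝟙 _⟩

/-- Put one more unchanged input in front. -/
def keep (x : C) {l : List C} (s : Regrouping F l) : Regrouping F (x :: l) :=
  ⟨x :: s.outer, F.obj x ◁ s.hom, x ◁ s.coh⟩

/-- Replace the first `j` inputs `n₁, …, nⱼ` by the single input `c (n₁, …, nⱼ)` in
`F (x₁ ⊗ ⋯ ⊗ xⱼ)`, and treat the other ones according to `s`. -/
def plug (c : Family F) (j : ℕ) {l : List C} (s : Regrouping F (l.drop j)) : Regrouping F l :=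
  ⟨tensorList (𝟭 C) (l.take j) :: s.outer,
    (splitIso F j l).hom ≫ (c (l.take j) ⊗ₘ s.hom),
    (tensorList (𝟭 C) (l.take j) ◁ s.coh) ≫ (splitIso (𝟭 C) j l).inv⟩

/-- Replace the two inputs `nᵢ, nᵢ₊₁` (counted from `i = 0`) by the single input `μ (nᵢ, nᵢ₊₁)` in
`F (xᵢ ⊗ xᵢ₊₁)`. (If there are too few inputs, leave them alone.) -/
def merge (F : C ⥤ D) [F.LaxMonoidal] : (i : ℕ) → (l : List C) → Regrouping F l
  | 0, x :: y :: l =>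
    ⟨(x ⊗ y) :: l,
      (α_ (F.obj x) (F.obj y) (tensorList F l)).inv ≫
        (Functor.LaxMonoidal.μ F x y ▷ tensorList F l),
      (α_ x y (tensorList (𝟭 C) l)).hom⟩
  | i + 1, x :: l => keep x (merge F i l)
  | _, l => refl F l

/-- Evaluate `c` on the new inputs. -/
def eval {l : List C} (s : Regrouping F l) (c : Family F) :
    tensorList F l ⟶ F.obj (tensorList (𝟭 C) l) :=
  s.hom ≫ c s.outer ≫ F.map s.coh

end Regrouping

variable [Preadditive D]

/-- The Hochschild differential. For a `k`-cochain `c`, `(dc) (n₁, …, nₖ₊₁)` is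
`(-1)^(k-1) μ (n₁, c (n₂, …, nₖ₊₁)) + ∑_{i=1}^k (-1)^(i+k-1) c (n₁, …, μ (nᵢ, nᵢ₊₁), …, nₖ₊₁)
  + μ (c (n₁, …, nₖ), nₖ₊₁)` (the summation index below is `i - 1`). -/
def differential (F : C ⥤ D) [F.LaxMonoidal] (c : Family F) : Family F
  | [] => 0
  | x :: xs =>
    ((xs.length : ℤ) - 1).negOnePow • juxtapose F (identityCochain F) c 1 (x :: xs)
      + ∑ i ∈ Finset.range xs.length,
          ((i : ℤ) + xs.length).negOnePow • (Regrouping.merge F i (x :: xs)).eval c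
      + juxtapose F c (identityCochain F) xs.length (x :: xs)

/-- The product. For an `i`-cochain `c` and a `j`-cochain `c'`, `(c c') (n₁, …, nᵢ₊ⱼ)` is
`(-1)^(i j) μ (c (n₁, …, nᵢ) ⊗ c' (nᵢ₊₁, …, nᵢ₊ⱼ))`; all terms of the sum below with `k ≠ i`
vanish. -/
def product (F : C ⥤ D) [F.LaxMonoidal] (c c' : Family F) : Family F := fun l =>
  ∑ k ∈ Finset.range (l.length + 1),
    ((k : ℤ) * ((l.length : ℤ) - k)).negOnePow • juxtapose F c c' k l

variable {F : C ⥤ D}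

/-- Insert a cochain `c` into inputs `n_{a+1}, …, n_N` in all possible ways, i.e. choose `k ≥ a`
and `j ≥ 0` with `k + j ≤ N`, keep `n_{a+1}, …, n_k`, replace `n_{k+1}, …, n_{k+j}` by their image
under `c` with the sign `(-1)^((j-1)k)`, and continue with `R` on the rest. -/
def insertNext (c : Family F)
    (R : ℕ → (l : List C) → List (ℤˣ × Regrouping F l)) :
    ℕ → (l : List C) → List (ℤˣ × Regrouping F l)
  | a, [] => (R a []).map fun s => ((-(a : ℤ)).negOnePow * s.1, s.2.plug (l := []) c 0)
  | a, x :: l =>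
    ((List.range (l.length + 2)).flatMap fun j =>
      (R (a + j) ((x :: l).drop j)).map fun s =>
        ((((j : ℤ) - 1) * a).negOnePow * s.1, s.2.plug c j))
    ++ (insertNext c R (a + 1) l).map fun s => (s.1, s.2.keep x)

/-- All ways, with signs, of inserting the cochains `c₁, …, cᵣ` in this order into inputs
`n_{a+1}, …, n_N`: for all `a ≤ k₁`, `k₁ + j₁ ≤ k₂`, …, `kᵣ + jᵣ ≤ N`, the inputs
`n_{kₚ+1}, …, n_{kₚ+jₚ}` are replaced by `cₚ (n_{kₚ+1}, …, n_{kₚ+jₚ})` and the other inputs are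
kept. The sign is `(-1)^(∑ₚ (jₚ-1)kₚ)`. -/
def insertions : List (Family F) → ℕ → (l : List C) → List (ℤˣ × Regrouping F l)
  | [] => fun _ l => [(1, Regrouping.refl F l)]
  | c :: cs => insertNext c (insertions cs)

/-- The substitution `c ∘ (c₁, …, cᵣ)`: its value on `(n₁, …, n_N)` is the sum of all
`(-1)^(∑ₚ (jₚ-1)kₚ) c (n₁, …, n_{k₁}, c₁ (n_{k₁+1}, …, n_{k₁+j₁}), …,
  n_{kᵣ}, cᵣ (n_{kᵣ+1}, …, n_{kᵣ+jᵣ}), …, n_N)`.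
If `c` is an `i`-cochain and each `cₚ` is a `jₚ`-cochain, only the terms with these values of the
`jₚ`, and only `N = i + j₁ + ⋯ + jᵣ - r`, contribute. -/
def substitution (F : C ⥤ D) (c : Family F) (cs : List (Family F)) : Family F := fun l =>
  ((insertions cs 0 l).map fun s => s.1 • s.2.eval c).sum

end Hochschild

end MonoidalHochschild

/-!
The theorem is proved in two steps. Cochains with the substitutions form a brace algebra, and the
lax structure `μ`, seen as a `2`-cochain, satisfies `μ{μ} = 0`, as it is associative. The remaining
structure is determined by `μ` and the braces, namely
`dx = μ{x} - (-1)^|x| x{μ}` and `x · y = (-1)^(deg x) μ{x, y}`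
(`isMultiplication_muHomog`), and an argument of Gerstenhaber and Voronov derives all identities
formally (`IsMultiplication.isHomotopyGAlgebra`).

*The pre-Jacobi identity.* A way of inserting cochains into inputs `n₁, …, n_N` results in a
regrouping: a list `o` of objects, a morphism from the tensor product of the inputs to that of `F z`
for `z` in `o`, and a coherence morphism. The substitution `x{y₁, …, yᵣ}` is the sum of the values
of `x` on all these. More generally `insSum ys` sums an arbitrary function of a regrouping (a
`Functional`), and the identity is proved at this level (`insSum_insSum`): inserting `ys` and then
`xs` into the result is the same as inserting all nestings of the `xs` in the `ys`. This is an
induction that considers what happens to the first new input. If `x₁` is applied to the first few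
new inputs, then these come from an initial segment of the `ys` and an initial segment of the inputs
`n`: inserting and then cutting the result in two amounts to cutting both the `ys` and the inputs in
two, and inserting separately (`insSum_cutSum_atCut`). The functionals that occur are additive in
the morphism of the inputs, and do not distinguish regroupings which differ by a morphism between
the targets (`Functional.IsGood`); for the evaluation of a cochain, the latter is naturality. It
allows one to replace a nested regrouping by a single input.

All decompositions of lists are `Cut`s, an inductive family along which the canonical isomorphisms
are defined by recursion, so that no transport along equations between lists is needed.

*The formal part.* A cochain of degree `k` has only `k` inputs, so `μ{x₁, …, xₙ} = 0` for `n > 2`,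
and most terms of the pre-Jacobi identity vanish when `μ` is involved. The identities `d² = 0`,
`(xy)z = x(yz)` and the Leibniz rule come from `μ{μ}{x₁, …, xₙ} = 0` for `n = 1, 3, 2` and, where
`d` occurs, from the expansions of `x{μ}{μ}` and `μ{x, y}{μ}`. Distributivity is the expansion of
`μ{x₁, x₂}{y₁, …, yₙ}`, and the formula for `d (x{x₁, …, xₙ₊₁})` follows from the expansions of
`μ{x}{x₁, …, xₙ₊₁}`, `x{μ}{x₁, …, xₙ₊₁}` and `x{x₁, …, xₙ₊₁}{μ}`.
-/

/-! ### Cuts of lists -/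

namespace MonoidalHochschild

universe w w' u

open HomotopyG

section Cuts

variable {X : Type u} {E : Type w} [AddCommGroup E] {E' : Type w'} [AddCommGroup E']

/-- `Cut l a b` says that `l = a ++ b`. It is an inductive family, and not an equation, so that
isomorphisms such as `Cut.split` are defined by recursion, with no transport along equations of
lists. -/
inductive Cut : List X → List X → List X → Type u
  | nil (l : List X) : Cut l [] l
  | cons (x : X) {l a b : List X} (q : Cut l a b) : Cut (x :: l) (x :: a) b

theorem Cut.length_eq {l a b : List X} (q : Cut l a b) : l.length = a.length + b.length := by
  induction q with
  | nil => simp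
  | cons x q ih => simp [ih]; omega

/-- The cut with empty second part. -/
def Cut.full : (l : List X) → Cut l l []
  | [] => .nil []
  | x :: l => .cons x (Cut.full l)

/-- From `l = (a ++ b) ++ c` to `l = a ++ (b ++ c)`; the first component is `b ++ c`. -/
def Cut.assoc : {l m c a b : List X} → Cut l m c → Cut m a b →
    Σ n : List X, Cut l a n × Cut n b c
  | _, _, _, _, _, q, .nil _ => ⟨_, .nil _, q⟩
  | _, _, _, _, _, .cons x q, .cons _ r =>
    ⟨(Cut.assoc q r).1, .cons x (Cut.assoc q r).2.1, (Cut.assoc q r).2.2⟩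

theorem Cut.assoc_nil {l m c : List X} (q : Cut l m c) :
    q.assoc (.nil m) = ⟨l, .nil l, q⟩ := by
  cases q <;> rfl

theorem Cut.assoc_cons {l m c a b : List X} (x : X) (q : Cut l m c) (r : Cut m a b) :
    (Cut.cons x q).assoc (.cons x r) =
      ⟨(q.assoc r).1, .cons x (q.assoc r).2.1, (q.assoc r).2.2⟩ := rfl

/-- Auxiliary to `cutSum`. -/
def cutSumFun : (l : List X) → ((a b : List X) → Cut l a b → E) → E
  | [], f => f [] [] (.nil [])
  | x :: l, f => f [] (x :: l) (.nil _) + cutSumFun l fun a b q => f (x :: a) b (.cons x q)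

/-- The sum of a function over all cuts of a list. -/
def cutSum (l : List X) : ((a b : List X) → Cut l a b → E) →+ E where
  toFun := cutSumFun l
  map_zero' := by
    induction l with
    | nil => rfl
    | cons x l ih => exact (congrArg₂ (· + ·) rfl ih).trans (add_zero _)
  map_add' := by
    induction l with
    | nil => exact fun f g => rfl
    | cons x l ih =>
      exact fun f g => (congrArg₂ (· + ·) rfl (ih _ _)).trans (add_add_add_comm _ _ _ _)

@[simp] theorem cutSum_nil (f : (a b : List X) → Cut [] a b → E) :
    cutSum [] f = f [] [] (.nil []) := rfl

theorem cutSum_cons (x : X) (l : List X) (f : (a b : List X) → Cut (x :: l) a b → E) :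
    cutSum (x :: l) f =
      f [] (x :: l) (.nil _) + cutSum l fun a b q => f (x :: a) b (.cons x q) := rfl

theorem cutSum_congr (l : List X) {f g : (a b : List X) → Cut l a b → E}
    (h : ∀ a b q, f a b q = g a b q) : cutSum l f = cutSum l g :=
  congrArg _ (funext fun a => funext fun b => funext fun q => h a b q)

theorem map_cutSum (φ : E →+ E') (l : List X) (f : (a b : List X) → Cut l a b → E) :
    φ (cutSum l f) = cutSum l fun a b q => φ (f a b q) := by
  induction l with
  | nil => rfl
  | cons x l ih => rw [cutSum_cons, cutSum_cons, map_add, ih]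

theorem cutSum_add (l : List X) (f g : (a b : List X) → Cut l a b → E) :
    (cutSum l fun a b q => f a b q + g a b q) = cutSum l f + cutSum l g :=
  map_add (cutSum l) f g

theorem smul_cutSum (ε : ℤˣ) (l : List X) (f : (a b : List X) → Cut l a b → E) :
    ε • cutSum l f = cutSum l fun a b q => ε • f a b q :=
  map_cutSum (DistribSMul.toAddMonoidHom E ε) l f

theorem cutSum_comm {Y : Type*} (l : List X) (m : List Y)
    (f : (a b : List X) → Cut l a b → (a' b' : List Y) → Cut m a' b' → E) :
    (cutSum l fun a b q => cutSum m fun a' b' q' => f a b q a' b' q') =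
      cutSum m fun a' b' q' => cutSum l fun a b q => f a b q a' b' q' := by
  induction l with
  | nil => rfl
  | cons x l ih => simp only [cutSum_cons, ih, cutSum_add]

theorem cutSum_assoc (l : List X)
    (f : (a b c n : List X) → Cut l a n → Cut n b c → E) :
    (cutSum l fun m c q => cutSum m fun a b r =>
        f a b c (q.assoc r).1 (q.assoc r).2.1 (q.assoc r).2.2) =
      cutSum l fun a n q => cutSum n fun b c r => f a b c n q r := by
  induction l with
  | nil => rfl
  | cons x l ih =>
    simp only [cutSum_cons, cutSum_add, cutSum_nil,
      ← ih fun a b c n q r => f (x :: a) b c n (.cons x q) r, add_assoc]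
    rfl

theorem cutSum_eq_full (l : List X) (f : (a b : List X) → Cut l a b → E)
    (h : ∀ a b q, b ≠ [] → f a b q = 0) : cutSum l f = f l [] (Cut.full l) := by
  induction l with
  | nil => rfl
  | cons x l ih =>
    rw [cutSum_cons, h _ _ _ (by simp), zero_add, ih _ fun a b q hb => h _ _ _ hb]
    rfl

/-- Every position in a list gives a cut. -/
def Cut.at : (k : ℕ) → (l : List X) → Cut l (l.take k) (l.drop k)
  | 0, l => .nil l
  | _ + 1, [] => .nil []
  | k + 1, x :: l => .cons x (Cut.at k l)

theorem sum_at_eq_cutSum (l : List X)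
    (f : (a b : List X) → Cut l a b → E) :
    ((List.range (l.length + 1)).map fun j => f (l.take j) (l.drop j) (Cut.at j l)).sum =
      cutSum l f := by
  induction l with
  | nil => exact add_zero _
  | cons x l ih =>
    rw [cutSum_cons, ← ih fun a b q => f (x :: a) b (.cons x q), List.length_cons,
      List.range_succ_eq_map]
    simp only [List.map_cons, List.sum_cons, List.map_map]
    rfl

theorem sum_flatMap {Y : Type*} (l : List Y) (f : Y → List E) :
    (l.flatMap f).sum = (l.map fun a => (f a).sum).sum := by
  induction l with
  | nil => rfl
  | cons x l ih => simp [ih]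

theorem sum_take_drop_eq_cutSum (l : List X) (f : List X → List X → E) :
    ((List.range (l.length + 1)).map fun j => f (l.take j) (l.drop j)).sum =
      cutSum l fun a b _ => f a b :=
  sum_at_eq_cutSum l fun a b _ => f a b

end Cuts

section Split

variable {C : Type u₁} [Category.{v₁} C] {D : Type u₂} [Category.{v₂} D] [MonoidalCategory D]

/-- The canonical isomorphism `G x₁ ⊗ ⋯ ⊗ G xₙ ≅ (G x₁ ⊗ ⋯ ⊗ G xₖ) ⊗ (G xₖ₊₁ ⊗ ⋯ ⊗ G xₙ)`. -/
def Cut.split (G : C ⥤ D) : {l a b : List C} → Cut l a b →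
    (tensorList G l ≅ tensorList G a ⊗ tensorList G b)
  | _, _, _, .nil l => (λ_ (tensorList G l)).symm
  | _, _, _, .cons x q => whiskerLeftIso (G.obj x) (q.split G) ≪≫ (α_ _ _ _).symm

theorem Cut.split_assoc (G : C ⥤ D) {l m c a b : List C} (q : Cut l m c) (r : Cut m a b) :
    (q.split G).hom ≫ (r.split G).hom ▷ tensorList G c ≫ (α_ _ _ _).hom =
      ((q.assoc r).2.1.split G).hom ≫ tensorList G a ◁ ((q.assoc r).2.2.split G).hom := by
  induction r generalizing l with
  | nil => rw [Cut.assoc_nil]; simp [Cut.split, tensorList]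
  | cons x r ih =>
    cases q with
    | cons _ q =>
      have := congrArg (fun f => G.obj x ◁ f ≫ (α_ _ _ _).inv) (ih q)
      rw [Cut.assoc_cons]
      simp only [MonoidalCategory.whiskerLeft_comp, Category.assoc] at this
      simp only [Cut.split, tensorList, Iso.trans_hom, whiskerLeftIso_hom, Iso.symm_hom,
        comp_whiskerRight, Category.assoc]
      simp only [← associator_inv_naturality_middle_assoc]
      simp [this]

theorem splitIso_eq (G : C ⥤ D) (k : ℕ) (l : List C) :
    splitIso G k l = (Cut.at k l).split G := by
  induction k generalizing l with
  | zero => rfl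
  | succ k ih =>
    cases l with
    | nil => rfl
    | cons x l => simp only [splitIso, Cut.at, Cut.split, ih]; rfl

end Split

/-! ### Functionals on regroupings -/

section Homs

variable {C : Type u₁} [Category.{v₁} C] {D : Type u₂} [Category.{v₂} D] [MonoidalCategory D]

/-- Identities. -/
def ListHom.id : (l : List C) → ListHom l l
  | [] => .nil
  | x :: l => .cons (𝟙 x) (ListHom.id l)

theorem ListHom.length_eq {l m : List C} (φ : ListHom l m) : l.length = m.length := by
  induction φ with
  | nil => rfl
  | cons f φ ih => simp [ih]

theorem tensorListMap_id (G : C ⥤ D) (l : List C) : tensorListMap G (ListHom.id l) = 𝟙 _ := by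
  induction l with
  | nil => rfl
  | cons x l ih => simp [ListHom.id, tensorListMap, ih, tensorList]

/-- `𝟙 ⊗ f`, with the type in terms of `tensorList`. -/
def keepHom (G : C ⥤ D) (x : C) {l o : List C} (f : tensorList G l ⟶ tensorList G o) :
    tensorList G (x :: l) ⟶ tensorList G (x :: o) :=
  G.obj x ◁ f

theorem keepHom_id (G : C ⥤ D) (x : C) (l : List C) : keepHom G x (𝟙 (tensorList G l)) = 𝟙 _ :=
  MonoidalCategory.whiskerLeft_id _ _

theorem keepHom_comp (G : C ⥤ D) (x : C) {l o p : List C} (f : tensorList G l ⟶ tensorList G o)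
    (g : tensorList G o ⟶ tensorList G p) :
    keepHom G x (f ≫ g) = keepHom G x f ≫ keepHom G x g :=
  MonoidalCategory.whiskerLeft_comp _ _ _

theorem tensorListMap_cons_id (G : C ⥤ D) (x : C) {l o : List C} (φ : ListHom l o) :
    tensorListMap G (.cons (𝟙 x) φ) = keepHom G x (tensorListMap G φ) := by
  simp only [tensorListMap, keepHom, CategoryTheory.Functor.map_id, id_tensorHom]
  rfl

theorem keepHom_add [Preadditive D] [MonoidalPreadditive D] (G : C ⥤ D) (x : C) {l o : List C}
    (f g : tensorList G l ⟶ tensorList G o) :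
    keepHom G x (f + g) = keepHom G x f + keepHom G x g :=
  MonoidalPreadditive.whiskerLeft_add _ _

end Homs

section Functionals

variable {C : Type u₁} [Category.{v₁} C] [MonoidalCategory C]
  {D : Type u₂} [Category.{v₂} D] [MonoidalCategory D] {F : C ⥤ D}
  {E : Type w} [AddCommGroup E] {E' : Type w'} [AddCommGroup E']

/-- Apply `m` to the inputs in the first part of a cut, and `f` to the other ones. -/
def plugHom {l a b o : List C} (q : Cut l a b)
    (m : tensorList F a ⟶ F.obj (tensorList (𝟭 C) a)) (f : tensorList F b ⟶ tensorList F o) :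
    tensorList F l ⟶ tensorList F (tensorList (𝟭 C) a :: o) :=
  (q.split F).hom ≫ (m ⊗ₘ f)

/-- The coherence morphism which belongs to `plugHom`. -/
def plugCoh {l a b o : List C} (q : Cut l a b) (c : tensorList (𝟭 C) o ⟶ tensorList (𝟭 C) b) :
    tensorList (𝟭 C) (tensorList (𝟭 C) a :: o) ⟶ tensorList (𝟭 C) l :=
  (tensorList (𝟭 C) a ◁ c) ≫ (q.split (𝟭 C)).inv

theorem plugHom_comp {l a b o p : List C} (q : Cut l a b)
    (m : tensorList F a ⟶ F.obj (tensorList (𝟭 C) a)) (f : tensorList F b ⟶ tensorList F o)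
    (g : tensorList F o ⟶ tensorList F p) :
    plugHom q m (f ≫ g) = plugHom q m f ≫ keepHom F _ g := by
  have : (m ⊗ₘ (f ≫ g)) = (m ⊗ₘ f) ≫ F.obj (tensorList (𝟭 C) a) ◁ g := by
    simp [MonoidalCategory.tensorHom_def]
  exact (congrArg ((q.split F).hom ≫ ·) this).trans (Category.assoc _ _ _).symm

theorem plugCoh_comp {l a b o p : List C} (q : Cut l a b)
    (c : tensorList (𝟭 C) o ⟶ tensorList (𝟭 C) b) (d : tensorList (𝟭 C) p ⟶ tensorList (𝟭 C) o) :
    plugCoh q (d ≫ c) = keepHom (𝟭 C) (tensorList (𝟭 C) a) d ≫ plugCoh q c :=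
   (congrArg (· ≫ (q.split (𝟭 C)).inv) (MonoidalCategory.whiskerLeft_comp _ d c)).trans
    (Category.assoc _ _ _)

variable (F) in
/-- A function of a regrouping of `l` (with target `o`, morphism `f` of the inputs, and coherence
morphism `c`) with values in `E`. -/
abbrev Functional (l : List C) (E : Type w) :=
  (o : List C) → (tensorList F l ⟶ tensorList F o) →
    (tensorList (𝟭 C) o ⟶ tensorList (𝟭 C) l) → E

/-- The value of `h` after one more unchanged input has been put in front. -/
def Functional.keep {x : C} {l : List C} (h : Functional F (x :: l) E) : Functional F l E :=
  fun o f c => h (x :: o) (keepHom F x f) (keepHom (𝟭 C) x c)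

/-- The value of `h` after the inputs in the first part of a cut have been replaced by the single
input given by `m`. -/
def Functional.plug {l a b : List C} (h : Functional F l E)
    (m : tensorList F a ⟶ F.obj (tensorList (𝟭 C) a)) (q : Cut l a b) : Functional F b E :=
  fun o f c => h (tensorList (𝟭 C) a :: o) (plugHom q m f) (plugCoh q c)

variable [Preadditive D]

/-- A functional on regroupings which is additive in the morphism of the inputs, and takes the same
value on two regroupings that differ by a morphism between the targets.  Evaluation of a natural
family is of this form. -/
structure Functional.IsGood {l : List C} (h : Functional F l E) : Prop where
  map_add : ∀ o f g c, h o (f + g) c = h o f c + h o g c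
  map_comp : ∀ {o o' : List C} (φ : ListHom o o') (f : tensorList F l ⟶ tensorList F o)
    (c : tensorList (𝟭 C) o' ⟶ tensorList (𝟭 C) l),
    h o' (f ≫ tensorListMap F φ) c = h o f (tensorListMap (𝟭 C) φ ≫ c)

theorem Functional.IsGood.map_zero {l : List C} {h : Functional F l E} (hh : h.IsGood) (o : List C)
    (c : tensorList (𝟭 C) o ⟶ tensorList (𝟭 C) l) : h o 0 c = 0 := by
  have := hh.map_add o 0 0 c
  simpa using this

variable (F) in
/-- Evaluation of the family `c`. -/
def evalFunctional (c : Family F) (l : List C) :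
    Functional F l (tensorList F l ⟶ F.obj (tensorList (𝟭 C) l)) :=
  fun o f p => f ≫ c o ≫ F.map p

theorem isGood_evalFunctional {c : Family F} (hc : IsNatural F c) (l : List C) :
    (evalFunctional F c l).IsGood where
  map_add o f g p := by simp [evalFunctional]
  map_comp φ f p := by
    simp only [evalFunctional, Category.assoc, Functor.map_comp]
    rw [reassoc_of% (hc _ _ φ)]

variable [MonoidalPreadditive D]

theorem plugHom_add_left {l a b o : List C} (q : Cut l a b)
    (m m' : tensorList F a ⟶ F.obj (tensorList (𝟭 C) a)) (f : tensorList F b ⟶ tensorList F o) :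
    plugHom q (m + m') f = plugHom q m f + plugHom q m' f :=
   (congrArg ((q.split F).hom ≫ ·) (MonoidalPreadditive.add_tensor _ _ _)).trans
    (Preadditive.comp_add _ _ _ _ _ _)

theorem plugHom_add_right {l a b o : List C} (q : Cut l a b)
    (m : tensorList F a ⟶ F.obj (tensorList (𝟭 C) a)) (f g : tensorList F b ⟶ tensorList F o) :
    plugHom q m (f + g) = plugHom q m f + plugHom q m g :=
   (congrArg ((q.split F).hom ≫ ·) (MonoidalPreadditive.tensor_add _ _ _)).trans
    (Preadditive.comp_add _ _ _ _ _ _)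

omit [MonoidalCategory C] in
theorem keepHom_zero (x : C) (l o : List C) :
    keepHom F x (0 : tensorList F l ⟶ tensorList F o) = 0 :=
  MonoidalPreadditive.whiskerLeft_zero

theorem plugHom_zero_left {l a b o : List C} (q : Cut l a b) (f : tensorList F b ⟶ tensorList F o) :
    plugHom q 0 f = 0 := by
  simpa using plugHom_add_left q 0 0 f

theorem plugHom_zero_right {l a b o : List C} (q : Cut l a b)
    (m : tensorList F a ⟶ F.obj (tensorList (𝟭 C) a)) :
    plugHom q m (0 : tensorList F b ⟶ tensorList F o) = 0 := by
  simpa using plugHom_add_right q m 0 (0 : tensorList F b ⟶ tensorList F o)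

theorem Functional.plug_zero {l a b : List C} {h : Functional F l E} (h0 : ∀ o c, h o 0 c = 0)
    (q : Cut l a b) : h.plug 0 q = 0 := by
  funext o f c
  rw [Functional.plug, plugHom_zero_left, h0]
  rfl

theorem Functional.IsGood.plug_add {l a b : List C} {h : Functional F l E} (hh : h.IsGood)
    (m m' : tensorList F a ⟶ F.obj (tensorList (𝟭 C) a)) (q : Cut l a b) :
    h.plug (m + m') q = h.plug m q + h.plug m' q := by
  funext o f c
  simp only [Functional.plug, Pi.add_apply, plugHom_add_left, hh.map_add]

theorem Functional.IsGood.keep {x : C} {l : List C} {h : Functional F (x :: l) E}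
    (hh : h.IsGood) : h.keep.IsGood where
  map_add o f g c := by
    simp only [Functional.keep, keepHom_add, hh.map_add]
  map_comp {o o'} φ f c := by
    simp only [Functional.keep, keepHom_comp, ← tensorListMap_cons_id, hh.map_comp]

theorem Functional.IsGood.plug {l a b : List C} {h : Functional F l E} (hh : h.IsGood)
    (m : tensorList F a ⟶ F.obj (tensorList (𝟭 C) a)) (q : Cut l a b) :
    (h.plug m q).IsGood where
  map_add o f g c := by
    simp only [Functional.plug, plugHom_add_right, hh.map_add]
  map_comp {o o'} φ f c := by
    simp only [Functional.plug, plugHom_comp, plugCoh_comp, ← tensorListMap_cons_id, hh.map_comp]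

end Functionals

/-! ### Sums over insertions of cochains -/

section Insertions

variable {C : Type u₁} [Category.{v₁} C] [MonoidalCategory C]
  {D : Type u₂} [Category.{v₂} D] [MonoidalCategory D] {F : C ⥤ D}
  {E : Type w} [AddCommGroup E] {E' : Type w'} [AddCommGroup E']

/-- The terms of `insSum` in which the first inputs are replaced by their image under a cochain
`y` of shifted degree `e`, while the sum over the ways to treat the other inputs is `R`. -/
def plugSum (e : ℤ) (y : Family F) (R : ℤ → (l : List C) → Functional F l E →+ E) (a : ℤ)
    (l : List C) : Functional F l E →+ E where
  toFun h := cutSum l fun u v q => (e * a).negOnePow • R (a + u.length) v (h.plug (y u) q)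
  map_zero' := by
    refine (cutSum_congr l fun u v q => ?_).trans (map_zero (cutSum l))
    exact (congrArg _ (map_zero (R (a + u.length) v))).trans (smul_zero _)
  map_add' h h' := by
    rw [← cutSum_add]
    refine cutSum_congr l fun u v q => ?_
    rw [← smul_add, ← map_add]
    rfl

/-- `Functional.keep` as a homomorphism. -/
def keepAddHom {x : C} {l : List C} : Functional F (x :: l) E →+ Functional F l E where
  toFun := Functional.keep
  map_zero' := rfl
  map_add' := fun _ _ => rfl

/-- The terms of `insSum` in which the first input is kept, while the sum over the ways to treat
the other inputs is `R`. -/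
def keepSum (R : ℤ → (l : List C) → Functional F l E →+ E) (a : ℤ) :
    (l : List C) → Functional F l E →+ E
  | [] => 0
  | _ :: l => (R (a + 1) l).comp keepAddHom

theorem keepSum_nil (R : ℤ → (l : List C) → Functional F l E →+ E) (a : ℤ)
    (h : Functional F [] E) : keepSum R a [] h = 0 := rfl

theorem keepSum_cons (R : ℤ → (l : List C) → Functional F l E →+ E) (a : ℤ) (x : C) (l : List C)
    (h : Functional F (x :: l) E) : keepSum R a (x :: l) h = R (a + 1) l h.keep := rfl

theorem plugSum_apply (e : ℤ) (y : Family F) (R : ℤ → (l : List C) → Functional F l E →+ E) (a : ℤ)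
    (l : List C) (h : Functional F l E) :
    plugSum e y R a l h =
      cutSum l fun u v q => (e * a).negOnePow • R (a + u.length) v (h.plug (y u) q) := rfl

theorem map_plugSum (φ : E →+ E') (e : ℤ) (y : Family F)
    (R : ℤ → (l : List C) → Functional F l E →+ E) (R' : ℤ → (l : List C) → Functional F l E' →+ E')
    (hR : ∀ a l h, φ (R a l h) = R' a l fun o f c => φ (h o f c)) (a : ℤ) (l : List C)
    (h : Functional F l E) :
    φ (plugSum e y R a l h) = plugSum e y R' a l fun o f c => φ (h o f c) := by
  rw [plugSum_apply, plugSum_apply, map_cutSum]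
  refine cutSum_congr l fun u v q => ?_
  rw [Units.smul_def, Units.smul_def, map_zsmul, hR]
  rfl

/-- The sum over all ways to insert a cochain `y` of shifted degree `e` and then to treat the
inputs after it as in `R`. -/
def insNext (e : ℤ) (y : Family F) (R : ℤ → (l : List C) → Functional F l E →+ E) :
    ℤ → (l : List C) → Functional F l E →+ E
  | a, [] => plugSum e y R a []
  | a, x :: l => plugSum e y R a (x :: l) + (insNext e y R (a + 1) l).comp keepAddHom

/-- The sum of the values of a functional over all ways of inserting the homogeneous cochains
`y₁, …, yᵣ` in this order into the inputs `n_{a+1}, …, n_N`.  If `yₚ` is inserted after `kₚ` of the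
original inputs, then the sign exponent is `∑ₚ |yₚ| kₚ`. -/
def insSum [Preadditive D] : List (Homog (cochains F)) → ℤ → (l : List C) → Functional F l E →+ E
  | [] => fun _ l =>
    { toFun := fun h => h l (𝟙 _) (𝟙 _)
      map_zero' := rfl
      map_add' := fun _ _ => rfl }
  | y :: ys => insNext y.sdeg y.val (insSum ys)

variable [Preadditive D]

/-- The terms of `insSum` in which nothing is left to do, or in which the first input is
replaced. -/
def frontSum (ys : List (Homog (cochains F))) (a : ℤ) (l : List C) : Functional F l E →+ E :=
  match ys, l with
  | [], [] => insSum [] a []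
  | [], _ :: _ => 0
  | y :: ys, l => plugSum y.sdeg y.val (insSum ys) a l

theorem insSum_nil (a : ℤ) (l : List C) (h : Functional F l E) :
    insSum [] a l h = h l (𝟙 _) (𝟙 _) := rfl

theorem frontSum_cons (y : Homog (cochains F)) (ys : List (Homog (cochains F))) (a : ℤ)
    (l : List C) (h : Functional F l E) :
    frontSum (y :: ys) a l h = plugSum y.sdeg y.val (insSum ys) a l h := rfl

theorem insSum_eq (ys : List (Homog (cochains F))) (a : ℤ) (l : List C) (h : Functional F l E) :
    insSum ys a l h = frontSum ys a l h + keepSum (insSum ys) a l h := by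
  cases ys with
  | nil =>
    cases l with
    | nil => exact (add_zero _).symm
    | cons x l =>
      refine Eq.trans ?_ (zero_add _).symm
      rw [keepSum_cons, insSum_nil, insSum_nil, Functional.keep, keepHom_id, keepHom_id]
  | cons y ys =>
    cases l with
    | nil => exact (add_zero _).symm
    | cons x l => rfl

theorem insSum_cons_eq (y : Homog (cochains F)) (ys : List (Homog (cochains F))) (a : ℤ)
    (l : List C) (h : Functional F l E) :
    insSum (y :: ys) a l h =
      plugSum y.sdeg y.val (insSum ys) a l h + keepSum (insSum (y :: ys)) a l h :=
  insSum_eq _ _ _ _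

theorem insSum_cons_nil (y : Homog (cochains F)) (ys : List (Homog (cochains F))) (a : ℤ)
    (h : Functional F [] E) :
    insSum (y :: ys) a [] h = plugSum y.sdeg y.val (insSum ys) a [] h := rfl

theorem insSum_cons_cons (y : Homog (cochains F)) (ys : List (Homog (cochains F))) (a : ℤ)
    (x : C) (l : List C) (h : Functional F (x :: l) E) :
    insSum (y :: ys) a (x :: l) h =
      plugSum y.sdeg y.val (insSum ys) a (x :: l) h + insSum (y :: ys) (a + 1) l h.keep := rfl

theorem map_insSum (φ : E →+ E') (ys : List (Homog (cochains F))) (a : ℤ) (l : List C)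
    (h : Functional F l E) :
    φ (insSum ys a l h) = insSum ys a l fun o f c => φ (h o f c) := by
  induction ys generalizing a l with
  | nil => rfl
  | cons y ys ih =>
    induction l generalizing a with
    | nil => exact map_plugSum φ _ _ _ _ ih _ _ _
    | cons x l ih' =>
      rw [insSum_cons_eq, insSum_cons_eq, map_add, map_plugSum φ _ _ _ _ ih, keepSum_cons,
        keepSum_cons, ih']
      rfl

theorem smul_insSum (ε : ℤˣ) (ys : List (Homog (cochains F))) (a : ℤ) (l : List C)
    (h : Functional F l E) :
    ε • insSum ys a l h = insSum ys a l fun o f c => ε • h o f c :=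
  map_insSum (DistribSMul.toAddMonoidHom E ε) ys a l h

/-- The sum over the insertions into inputs that are preceded by `b` more inputs. -/
theorem insSum_add (ys : List (Homog (cochains F))) (a b : ℤ) (l : List C)
    (h : Functional F l E) :
    insSum ys (a + b) l h = (sdegs ys * b).negOnePow • insSum ys a l h := by
  induction ys generalizing a l with
  | nil => simp [sdegs, insSum_nil]
  | cons y ys ih =>
    have key (a : ℤ) (l : List C) (h : Functional F l E) :
        plugSum y.sdeg y.val (insSum ys) (a + b) l h =
          (sdegs (y :: ys) * b).negOnePow • plugSum y.sdeg y.val (insSum ys) a l h := by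
      rw [plugSum_apply, plugSum_apply, smul_cutSum]
      refine cutSum_congr l fun u v q => ?_
      rw [add_right_comm, ih, smul_smul, smul_smul, ← Int.negOnePow_add, ← Int.negOnePow_add]
      congr 2
      simp [sdegs]
      ring
    induction l generalizing a with
    | nil => exact key _ _ _
    | cons x l ih' =>
      rw [insSum_cons_eq, insSum_cons_eq, key, keepSum_cons, keepSum_cons, add_right_comm, ih',
        smul_add]

theorem val_apply_eq_zero (y : Homog (cochains F)) (l : List C) (hl : (l.length : ℤ) ≠ y.deg) :
    y.val l = 0 :=
  y.2.2.2 l hl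

theorem isNatural_val (y : Homog (cochains F)) : IsNatural F y.val := y.2.2.1

variable [MonoidalPreadditive D]

/-- Inserting cochains of shifted degrees `|y₁|, …, |yᵣ|` into `N` inputs leaves
`N - |y₁| - ⋯ - |yᵣ|` inputs. -/
theorem insSum_eq_zero (ys : List (Homog (cochains F))) (a : ℤ) (l : List C)
    (h : Functional F l E) (h0 : ∀ o c, h o 0 c = 0)
    (H : ∀ o f c, (o.length : ℤ) = l.length - sdegs ys → h o f c = 0) : insSum ys a l h = 0 := by
  induction ys generalizing a l with
  | nil => exact H _ _ _ (by simp [sdegs])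
  | cons y ys ih =>
    have key (a : ℤ) (l : List C) (h : Functional F l E) (h0 : ∀ o c, h o 0 c = 0)
        (H : ∀ o f c, (o.length : ℤ) = l.length - sdegs (y :: ys) → h o f c = 0) :
        plugSum y.sdeg y.val (insSum ys) a l h = 0 := by
      rw [plugSum_apply]
      refine (cutSum_congr l fun u v q => ?_).trans (map_zero _)
      by_cases hu : (u.length : ℤ) = y.deg
      · rw [ih _ v, smul_zero]; · rfl
        · intro o c
          rw [Functional.plug, plugHom_zero_right, h0]
        · intro o f c ho
          refine H _ _ _ ?_
          have := q.length_eq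
          simp only [sdegs, List.map_cons, List.sum_cons, Homog.sdeg, List.length_cons] at ho ⊢
          simp only [Homog.deg] at hu
          push_cast
          omega
      · rw [val_apply_eq_zero y u hu, Functional.plug_zero h0, map_zero, smul_zero]; rfl
    induction l generalizing a with
    | nil => exact key _ _ _ h0 H
    | cons x l ih' =>
      rw [insSum_cons_eq, key _ _ _ h0 H, zero_add, keepSum_cons]
      refine ih' _ _ (fun o c => ?_) fun o f c ho => H _ _ _ ?_
      · rw [Functional.keep, keepHom_zero, h0]
      · push_cast [List.length_cons]
        omega

theorem insSum_congr (ys : List (Homog (cochains F))) (a : ℤ) (l : List C)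
    (h h' : Functional F l E) (h0 : ∀ o c, h o 0 c = 0) (h0' : ∀ o c, h' o 0 c = 0)
    (H : ∀ o f c, (o.length : ℤ) = l.length - sdegs ys → h o f c = h' o f c) :
    insSum ys a l h = insSum ys a l h' := by
  rw [← sub_eq_zero, ← map_sub]
  exact insSum_eq_zero ys a l _ (fun o c => by simp [h0, h0']) fun o f c ho => by simp [H o f c ho]

/-- In `insertNext` every `j` is allowed as the number of inputs of `y`, with the sign exponent
`(j - 1) k`.  As `y` vanishes unless `j` is its degree, the exponent may be replaced by `|y| k`. -/
theorem sum_insertNext (y : Homog (cochains F)) (R : ℕ → (l : List C) → List (ℤˣ × Regrouping F l))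
    (R' : ℤ → (l : List C) → Functional F l E →+ E)
    (hR : ∀ (a : ℕ) l (h : Functional F l E), (∀ o c, h o 0 c = 0) →
      ((R a l).map fun s => s.1 • h s.2.outer s.2.hom s.2.coh).sum = R' a l h) (a : ℕ) (l : List C)
    (h : Functional F l E) (h0 : ∀ o c, h o 0 c = 0) :
    ((insertNext y.val R a l).map fun s => s.1 • h s.2.outer s.2.hom s.2.coh).sum =
      insNext y.sdeg y.val R' a l h := by
  have key (a j : ℕ) (l : List C) (h : Functional F l E) (h0 : ∀ o c, h o 0 c = 0)
      (hj : j ≤ l.length) :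
      ((R (a + j) (l.drop j)).map fun s => ((((j : ℤ) - 1) * a).negOnePow * s.1) •
        h (s.2.plug y.val j).outer (s.2.plug y.val j).hom (s.2.plug y.val j).coh).sum =
      (y.sdeg * a).negOnePow • R' (a + (l.take j).length) (l.drop j)
        (h.plug (y.val (l.take j)) (Cut.at j l)) := by
    have h1 (s : Regrouping F (l.drop j)) :
        h (s.plug y.val j).outer (s.plug y.val j).hom (s.plug y.val j).coh =
          (h.plug (y.val (l.take j)) (Cut.at j l)) s.outer s.hom s.coh := by
      simp only [Regrouping.plug, Functional.plug, plugHom, plugCoh, splitIso_eq]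
    have h2 := hR (a + j) (l.drop j) (h.plug (y.val (l.take j)) (Cut.at j l)) fun o c => by
      rw [Functional.plug, plugHom_zero_right, h0]
    simp only [h1, mul_smul]
    rw [List.length_take, min_eq_left hj]
    push_cast at h2
    rw [← h2]
    by_cases hy : (j : ℤ) = y.deg
    · rw [List.smul_sum, List.map_map, Homog.sdeg, hy]
      rfl
    · have : h.plug (y.val (l.take j)) (Cut.at j l) = 0 := by
        rw [val_apply_eq_zero y _ (by rwa [List.length_take, min_eq_left hj]),
          Functional.plug_zero h0]
      simp [this]
  induction l generalizing a with
  | nil =>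
    have := key a 0 [] h h0 le_rfl
    simp only [Nat.cast_zero, zero_sub, neg_mul, one_mul] at this
    simp only [insertNext, List.map_map]
    exact this
  | cons x l ih =>
    simp only [insertNext, List.map_append, List.sum_append, List.map_flatMap, sum_flatMap,
      List.map_map]
    refine congrArg₂ (· + ·) ?_ ?_
    · rw [plugSum_apply, ← sum_at_eq_cutSum]
      congr 1
      refine List.map_congr_left fun j hj => ?_
      exact key a j (x :: l) h h0 (Nat.lt_succ_iff.mp (List.mem_range.mp hj))
    · exact_mod_cast ih (a + 1) h.keep fun o c => by rw [Functional.keep, keepHom_zero, h0]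

theorem sum_insertions (ys : List (Homog (cochains F))) (a : ℕ) (l : List C)
    (h : Functional F l E) (h0 : ∀ o c, h o 0 c = 0) :
    ((insertions (vals ys) a l).map fun s => s.1 • h s.2.outer s.2.hom s.2.coh).sum =
      insSum ys a l h := by
  induction ys generalizing a l with
  | nil => simp [vals, insertions, Regrouping.refl, insSum_nil]
  | cons y ys ih => exact sum_insertNext y _ _ (fun a l h h0 => ih a l h h0) a l h h0

end Insertions
/-! ### Insertions and cuts -/

section Coherence

-- These identities are stated for arbitrary objects, as the objects to which they are applied have
-- the form of a tensor product only after `tensorList` is unfolded.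

variable {D : Type u₂} [Category.{v₂} D] [MonoidalCategory D]

theorem whiskerLeft_comp_consIso_hom {X L O A B : D} (s : L ⟶ O) (e : O ≅ A ⊗ B) :
    X ◁ s ≫ (whiskerLeftIso X e ≪≫ (α_ X A B).symm).hom = X ◁ (s ≫ e.hom) ≫ (α_ X A B).inv := by
  simp

theorem consIso_inv_comp_whiskerLeft {X L O A B : D} (c : O ⟶ L) (e : O ≅ A ⊗ B) :
    (whiskerLeftIso X e ≪≫ (α_ X A B).symm).inv ≫ X ◁ c = (α_ X A B).hom ≫ X ◁ (e.inv ≫ c) := by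
  simp

theorem tensorHom_comp_consIso_hom {X L U V O A B : D} (q : L ⟶ U ⊗ V) (m : U ⟶ X) (s : V ⟶ O)
    (e : O ≅ A ⊗ B) :
    (q ≫ (m ⊗ₘ s)) ≫ (whiskerLeftIso X e ≪≫ (α_ X A B).symm).hom =
      q ≫ (m ⊗ₘ (s ≫ e.hom)) ≫ (α_ X A B).inv := by
  simp [MonoidalCategory.tensorHom_def]

theorem consIso_inv_comp_whiskerLeft_comp {X L V O A B : D} (q : X ⊗ V ⟶ L) (c : O ⟶ V)
    (e : O ≅ A ⊗ B) :
    (whiskerLeftIso X e ≪≫ (α_ X A B).symm).inv ≫ X ◁ c ≫ q =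
      (α_ X A B).hom ≫ X ◁ (e.inv ≫ c) ≫ q := by
  simp

theorem consIso_hom_comp_tensorHom {X L U V A B : D} (e : L ≅ U ⊗ V) (s : U ⟶ A) (t : V ⟶ B) :
    (whiskerLeftIso X e ≪≫ (α_ X U V).symm).hom ≫ (X ◁ s ⊗ₘ t) =
      X ◁ (e.hom ≫ (s ⊗ₘ t)) ≫ (α_ X A B).inv := by
  simp [MonoidalCategory.tensorHom_def]

theorem tensorHom_comp_consIso_inv {X L U V A B : D} (e : L ≅ U ⊗ V) (s : A ⟶ U) (t : B ⟶ V) :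
    (X ◁ s ⊗ₘ t) ≫ (whiskerLeftIso X e ≪≫ (α_ X U V).symm).inv =
      (α_ X A B).hom ≫ X ◁ ((s ⊗ₘ t) ≫ e.inv) := by
  simp [MonoidalCategory.tensorHom_def]

theorem split_comp_tensorHom {L M N A B C X O P : D} {q : L ≅ M ⊗ C} {r : M ≅ A ⊗ B}
    {q' : L ≅ A ⊗ N} {r' : N ≅ B ⊗ C}
    (h : q.hom ≫ r.hom ▷ C ≫ (α_ A B C).hom = q'.hom ≫ A ◁ r'.hom)
    (y : A ⟶ X) (s : B ⟶ O) (t : C ⟶ P) :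
    q.hom ≫ ((r.hom ≫ (y ⊗ₘ s)) ⊗ₘ t) =
      q'.hom ≫ (y ⊗ₘ (r'.hom ≫ (s ⊗ₘ t))) ≫ (α_ X O P).inv := by
  have h' := congrArg (· ≫ (y ⊗ₘ (s ⊗ₘ t)) ≫ (α_ X O P).inv) h
  simp only [Category.assoc] at h'
  simp only [MonoidalCategory.tensorHom_def, MonoidalCategory.whiskerLeft_comp,
    Category.assoc] at h' ⊢
  rw [← whisker_exchange_assoc]
  simpa using h'

theorem tensorHom_comp_split_inv {L M N A B C O P : D} {q : L ≅ M ⊗ C} {r : M ≅ A ⊗ B}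
    {q' : L ≅ A ⊗ N} {r' : N ≅ B ⊗ C}
    (h : q.hom ≫ r.hom ▷ C ≫ (α_ A B C).hom = q'.hom ≫ A ◁ r'.hom)
    (s : O ⟶ B) (t : P ⟶ C) :
    ((A ◁ s ≫ r.inv) ⊗ₘ t) ≫ q.inv =
      (α_ A O P).hom ≫ A ◁ ((s ⊗ₘ t) ≫ r'.inv) ≫ q'.inv := by
  have h' : r.inv ▷ C ≫ q.inv = (α_ A B C).hom ≫ A ◁ r'.inv ≫ q'.inv := by
    rw [← cancel_epi (r.hom ▷ C), ← cancel_epi q.hom, reassoc_of% h]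
    simp
  have h'' : (A ◁ s ≫ r.inv) ⊗ₘ t = (A ◁ s ⊗ₘ t) ≫ r.inv ▷ C := by
    simp [MonoidalCategory.tensorHom_def']
  rw [h'', Category.assoc, h']
  simp [MonoidalCategory.tensorHom_def]

end Coherence

section Pairs

variable {C : Type u₁} [Category.{v₁} C] [MonoidalCategory C]
  {D : Type u₂} [Category.{v₂} D] [MonoidalCategory D] {F : C ⥤ D}
  {E : Type w}

variable (F) in
/-- A function of a regrouping of `l` into two groups of new inputs, with values in `E`. -/
abbrev PairFunctional (l : List C) (E : Type w) :=
  (o₁ o₂ : List C) → (tensorList F l ⟶ tensorList F o₁ ⊗ tensorList F o₂) →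
    (tensorList (𝟭 C) o₁ ⊗ tensorList (𝟭 C) o₂ ⟶ tensorList (𝟭 C) l) → E

namespace PairFunctional

/-- The value of `f` after one more unchanged input has been put in front. -/
def keep {x : C} {l : List C} (f : PairFunctional F (x :: l) E) : PairFunctional F l E :=
  fun o₁ o₂ s c => f (x :: o₁) o₂ (F.obj x ◁ s ≫ (α_ _ _ _).inv) ((α_ _ _ _).hom ≫ x ◁ c)

/-- The value of `f` after the inputs in the first part of a cut have been replaced by the single
input given by `m`. -/
def plug {l a b : List C} (f : PairFunctional F l E)
    (m : tensorList F a ⟶ F.obj (tensorList (𝟭 C) a)) (q : Cut l a b) : PairFunctional F b E :=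
  fun o₁ o₂ s c => f (tensorList (𝟭 C) a :: o₁) o₂
    ((q.split F).hom ≫ (m ⊗ₘ s) ≫ (α_ _ _ _).inv)
    ((α_ _ _ _).hom ≫ tensorList (𝟭 C) a ◁ c ≫ (q.split (𝟭 C)).inv)

/-- The value of `f` on the regrouping of all inputs, followed by a cut of the new inputs. -/
def atCut {l : List C} (f : PairFunctional F l E) (o : List C)
    (s : tensorList F l ⟶ tensorList F o) (c : tensorList (𝟭 C) o ⟶ tensorList (𝟭 C) l)
    (o₁ o₂ : List C) (r : Cut o o₁ o₂) : E :=
  f o₁ o₂ (s ≫ (r.split F).hom) ((r.split (𝟭 C)).inv ≫ c)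

/-- The value of `f` on two regroupings of the two parts of a cut. -/
def pair {l u v : List C} (f : PairFunctional F l E) (q : Cut l u v) (o₁ : List C)
    (s₁ : tensorList F u ⟶ tensorList F o₁) (c₁ : tensorList (𝟭 C) o₁ ⟶ tensorList (𝟭 C) u) :
    Functional F v E :=
  fun o₂ s₂ c₂ => f o₁ o₂ ((q.split F).hom ≫ (s₁ ⊗ₘ s₂)) ((c₁ ⊗ₘ c₂) ≫ (q.split (𝟭 C)).inv)

theorem atCut_keep {x : C} {l o : List C} (f : PairFunctional F (x :: l) E)
    (s : tensorList F l ⟶ tensorList F o) (c : tensorList (𝟭 C) o ⟶ tensorList (𝟭 C) l)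
    {o₁ o₂ : List C} (r : Cut o o₁ o₂) :
    f.atCut (x :: o) (keepHom F x s) (keepHom (𝟭 C) x c) (x :: o₁) o₂ (.cons x r) =
      f.keep.atCut o s c o₁ o₂ r := by
  unfold atCut keep keepHom
  congr 1
  · exact whiskerLeft_comp_consIso_hom _ _
  · exact consIso_inv_comp_whiskerLeft _ _

theorem atCut_plug {l u v o : List C} (f : PairFunctional F l E) (q : Cut l u v)
    (m : tensorList F u ⟶ F.obj (tensorList (𝟭 C) u))
    (s : tensorList F v ⟶ tensorList F o) (c : tensorList (𝟭 C) o ⟶ tensorList (𝟭 C) v)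
    {o₁ o₂ : List C} (r : Cut o o₁ o₂) :
    f.atCut _ (plugHom q m s) (plugCoh q c) _ o₂ (.cons (tensorList (𝟭 C) u) r) =
      (f.plug m q).atCut o s c o₁ o₂ r := by
  unfold atCut plug plugHom plugCoh
  congr 1
  · exact tensorHom_comp_consIso_hom _ _ _ _
  · exact consIso_inv_comp_whiskerLeft_comp _ _ _

theorem pair_nil {l : List C} (f : PairFunctional F l E) (o : List C)
    (s : tensorList F l ⟶ tensorList F o) (c : tensorList (𝟭 C) o ⟶ tensorList (𝟭 C) l) :
    f.pair (.nil l) [] (𝟙 _) (𝟙 _) o s c = f.atCut o s c [] o (.nil o) :=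
  congrArg₂ (f [] o)
    ((congrArg (_ ≫ ·) (id_tensorHom _ s)).trans (leftUnitor_inv_naturality s).symm)
    ((congrArg (· ≫ _) (id_tensorHom _ c)).trans (leftUnitor_naturality c))

theorem pair_keep {x : C} {l u v o₁ : List C} (f : PairFunctional F (x :: l) E) (q : Cut l u v)
    (s : tensorList F u ⟶ tensorList F o₁) (c : tensorList (𝟭 C) o₁ ⟶ tensorList (𝟭 C) u) :
    f.pair (.cons x q) (x :: o₁) (keepHom F x s) (keepHom (𝟭 C) x c) = f.keep.pair q o₁ s c := by
  funext o₂ s₂ c₂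
  unfold pair keep keepHom
  congr 1
  · exact consIso_hom_comp_tensorHom _ _ _
  · exact tensorHom_comp_consIso_inv _ _ _

theorem pair_plug {l m a b c o₁ : List C} (f : PairFunctional F l E) (q : Cut l m c)
    (r : Cut m a b) (y : tensorList F a ⟶ F.obj (tensorList (𝟭 C) a))
    (s : tensorList F b ⟶ tensorList F o₁) (p : tensorList (𝟭 C) o₁ ⟶ tensorList (𝟭 C) b) :
    f.pair q _ (plugHom r y s) (plugCoh r p) =
      (f.plug y (q.assoc r).2.1).pair (q.assoc r).2.2 o₁ s p := by
  funext o₂ s₂ c₂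
  unfold pair plug plugHom plugCoh
  congr 1
  · exact split_comp_tensorHom (Cut.split_assoc F q r) _ _ _
  · exact tensorHom_comp_split_inv (Cut.split_assoc (𝟭 C) q r) _ _

end PairFunctional

variable [AddCommGroup E] [Preadditive D]

theorem insSum_atCut_plug {l u v : List C} (ys : List (Homog (cochains F))) (a : ℤ)
    (f : PairFunctional F l E) (m : tensorList F u ⟶ F.obj (tensorList (𝟭 C) u)) (q : Cut l u v) :
    insSum ys a v (Functional.plug (fun o s c => cutSum o (f.atCut o s c)) m q) =
      insSum ys a v (Functional.plug (fun o s c => f.atCut o s c [] o (.nil o)) m q) +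
        insSum ys a v (fun o s c => cutSum o ((f.plug m q).atCut o s c)) := by
  rw [← map_add]
  congr 1
  funext o s c
  simp only [Functional.plug, cutSum_cons, PairFunctional.atCut_plug]
  rfl

theorem insSum_atCut_keep {x : C} {l : List C} (ys : List (Homog (cochains F))) (a : ℤ)
    (f : PairFunctional F (x :: l) E) :
    insSum ys a l (Functional.keep fun o s c => cutSum o (f.atCut o s c)) =
      insSum ys a l (Functional.keep fun o s c => f.atCut o s c [] o (.nil o)) +
        insSum ys a l (fun o s c => cutSum o (f.keep.atCut o s c)) := by
  rw [← map_add]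
  congr 1
  funext o s c
  simp only [Functional.keep, cutSum_cons, PairFunctional.atCut_keep]
  rfl

/-- The sum of the values of a functional over all cuts of the inputs, and all ways of inserting
`ys` into the first and `zs` into the second part. -/
def pairSum (ys zs : List (Homog (cochains F))) (a : ℤ) (l : List C) (f : PairFunctional F l E) :
    E :=
  cutSum l fun u v q => insSum ys a u fun o s c => insSum zs (a + u.length) v (f.pair q o s c)

theorem pairSum_nil_nil (zs : List (Homog (cochains F))) (a : ℤ) (f : PairFunctional F [] E) :
    pairSum [] zs a [] f = insSum zs a [] fun o s c => f.atCut o s c [] o (.nil o) := by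
  simp only [pairSum, cutSum_nil, insSum_nil]
  congr 1
  · simp
  · funext o s c
    exact f.pair_nil o s c

theorem pairSum_nil_cons (zs : List (Homog (cochains F))) (a : ℤ) (x : C) (l : List C)
    (f : PairFunctional F (x :: l) E) :
    pairSum [] zs a (x :: l) f = insSum zs a (x :: l) (fun o s c => f.atCut o s c [] o (.nil o)) +
      pairSum [] zs (a + 1) l f.keep := by
  simp only [pairSum, cutSum_cons, insSum_nil]
  congr 1
  · congr 1
    · simp
    · funext o s c
      exact f.pair_nil o s c
  · refine cutSum_congr l fun u v q => ?_
    rw [← PairFunctional.pair_keep, keepHom_id, keepHom_id]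
    congr 2
    push_cast [List.length_cons]
    ring

/-- The terms of `pairSum` in which the first input is replaced. -/
theorem cutSum_plugSum_pair (y : Homog (cochains F)) (ys zs : List (Homog (cochains F))) (a : ℤ)
    (l : List C) (f : PairFunctional F l E) :
    (cutSum l fun u v q => plugSum y.sdeg y.val (insSum ys) a u fun o s c =>
        insSum zs (a + u.length) v (f.pair q o s c)) =
      cutSum l fun u v q => (y.sdeg * a).negOnePow •
        pairSum ys zs (a + u.length) v (f.plug (y.val u) q) := by
  simp only [pairSum, smul_cutSum, ← cutSum_assoc l fun u v w n q r =>
    (y.sdeg * a).negOnePow • insSum ys (a + u.length) v fun o s c =>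
      insSum zs (a + u.length + v.length) w ((f.plug (y.val u) q).pair r o s c)]
  refine cutSum_congr l fun m w q => ?_
  rw [plugSum_apply]
  refine cutSum_congr m fun u v r => ?_
  congr 2
  funext o s c
  rw [Functional.plug, PairFunctional.pair_plug, r.length_eq]
  push_cast
  rw [add_assoc]

theorem pairSum_cons_nil (y : Homog (cochains F)) (ys zs : List (Homog (cochains F))) (a : ℤ)
    (f : PairFunctional F [] E) :
    pairSum (y :: ys) zs a [] f = (y.sdeg * a).negOnePow •
        pairSum ys zs a [] (f.plug (y.val []) (.nil [])) := by
  have := cutSum_plugSum_pair y ys zs a [] f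
  simp only [cutSum_nil, List.length_nil, Nat.cast_zero, add_zero] at this
  rw [← this]
  simp [pairSum, insSum_cons_eq, keepSum_nil]

theorem pairSum_cons_cons (y : Homog (cochains F)) (ys zs : List (Homog (cochains F))) (a : ℤ)
    (x : C) (l : List C) (f : PairFunctional F (x :: l) E) :
    pairSum (y :: ys) zs a (x :: l) f =
      (cutSum (x :: l) fun u v q => (y.sdeg * a).negOnePow •
        pairSum ys zs (a + u.length) v (f.plug (y.val u) q)) +
      pairSum (y :: ys) zs (a + 1) l f.keep := by
  rw [← cutSum_plugSum_pair]
  simp only [pairSum, insSum_cons_eq y ys a, cutSum_add]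
  congr 1
  rw [cutSum_cons, keepSum_nil, zero_add]
  refine cutSum_congr l fun u v q => ?_
  rw [keepSum_cons]
  congr 1
  funext o s c
  rw [Functional.keep, PairFunctional.pair_keep]
  congr 2
  push_cast [List.length_cons]
  ring

/-- Inserting `ys` and then cutting the new inputs in two amounts to cutting `ys` and the inputs in
two and inserting both parts separately. -/
theorem insSum_cutSum_atCut (ys : List (Homog (cochains F))) (a : ℤ) (l : List C)
    (f : PairFunctional F l E) :
    insSum ys a l (fun o s c => cutSum o (f.atCut o s c)) =
      cutSum ys fun ys₁ ys₂ _ => pairSum ys₁ ys₂ a l f := by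
  induction ys generalizing a l with
  | nil =>
    rw [cutSum_nil, insSum_nil]
    induction l generalizing a with
    | nil =>
      rw [pairSum_nil_nil]
      rfl
    | cons x l ih =>
      rw [pairSum_nil_cons, ← ih, insSum_nil, cutSum_cons]
      congr 1
      refine cutSum_congr l fun u v q => ?_
      rw [← PairFunctional.atCut_keep, keepHom_id, keepHom_id]
  | cons y ys ih =>
    -- The terms in which the first input is replaced, for all `l`.
    have key (a : ℤ) (l : List C) (f : PairFunctional F l E) :
        plugSum y.sdeg y.val (insSum ys) a l (fun o s c => cutSum o (f.atCut o s c)) =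
          plugSum y.sdeg y.val (insSum ys) a l (fun o s c => f.atCut o s c [] o (.nil o)) +
            cutSum ys fun ys₁ ys₂ _ => cutSum l fun u v q => (y.sdeg * a).negOnePow •
              pairSum ys₁ ys₂ (a + u.length) v (f.plug (y.val u) q) := by
      simp only [plugSum_apply, cutSum_comm ys l, ← smul_cutSum, ← cutSum_add, ← smul_add, ← ih]
      congr 1
      exact cutSum_congr l fun u v q => insSum_atCut_plug _ _ _ _ _
    induction l generalizing a with
    | nil =>
      rw [insSum_cons_nil, key, cutSum_cons, pairSum_nil_nil, insSum_cons_nil]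
      congr 1
      refine cutSum_congr ys fun ys₁ ys₂ _ => ?_
      rw [pairSum_cons_nil, cutSum_nil, List.length_nil, Nat.cast_zero, add_zero]
    | cons x l ih' =>
      rw [insSum_cons_cons, insSum_atCut_keep, ih', key, cutSum_cons, cutSum_cons,
        pairSum_nil_cons, insSum_cons_cons]
      simp only [pairSum_cons_cons, cutSum_add]
      abel

end Pairs
end MonoidalHochschild

/-! ### Sums over nestings -/

namespace HomotopyG

open MonoidalHochschild

universe w w'

variable {A : Type*} [AddCommGroup A] {V : ℤ → AddSubgroup A} {E : Type w} [AddCommGroup E]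
  {E' : Type w'} [AddCommGroup E']

theorem sdegs_nil : sdegs ([] : List (Homog V)) = 0 := rfl

theorem sdegs_cons (y : Homog V) (ys : List (Homog V)) : sdegs (y :: ys) = y.sdeg + sdegs ys := by
  simp [sdegs]

theorem deg_eq (x : Homog V) : x.deg = x.sdeg + 1 := by
  simp [Homog.deg, Homog.sdeg]

theorem sum_deg_sub_length (ys : List (Homog V)) :
    (ys.map Homog.deg).sum - ys.length = sdegs ys := by
  induction ys with
  | nil => rfl
  | cons y ys ih =>
    rw [sdegs_cons, ← ih, List.map_cons, List.sum_cons, List.length_cons, deg_eq]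
    push_cast
    ring

/-- The terms of `nestSum` which begin with `B x [y₁, …, yⱼ]`, while the sum over the nestings of
what remains is `R`. -/
def nestFront (B : Homog V → List (Homog V) → Homog V) (x : Homog V)
    (R : ℤ → List (Homog V) → (List (Homog V) → E) →+ E) (s : ℤ) (ys : List (Homog V)) :
    (List (Homog V) → E) →+ E where
  toFun Φ := cutSum ys fun ys₁ ys₂ _ => (x.sdeg * s).negOnePow •
    R (s + sdegs ys₁) ys₂ fun zs => Φ (B x ys₁ :: zs)
  map_zero' := by
    refine (cutSum_congr ys fun u v q => ?_).trans (map_zero (cutSum ys))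
    exact (congrArg _ (map_zero (R (s + sdegs u) v))).trans (smul_zero _)
  map_add' Φ Ψ := by
    rw [← cutSum_add]
    refine cutSum_congr ys fun u v q => ?_
    rw [← smul_add, ← map_add]
    rfl

/-- `Φ ↦ Φ (y :: ·)` -/
def consAddHom (y : Homog V) : (List (Homog V) → E) →+ (List (Homog V) → E) where
  toFun Φ := fun zs => Φ (y :: zs)
  map_zero' := rfl
  map_add' _ _ := rfl

/-- The sum over all nestings of `x` in `y₁, …, yₙ`, where the sum over the nestings of what remains
is `R`. -/
def nestNext (B : Homog V → List (Homog V) → Homog V) (x : Homog V)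
    (R : ℤ → List (Homog V) → (List (Homog V) → E) →+ E) :
    ℤ → List (Homog V) → (List (Homog V) → E) →+ E
  | s, [] => nestFront B x R s []
  | s, y :: ys =>
    nestFront B x R s (y :: ys) + (nestNext B x R (s + y.sdeg) ys).comp (consAddHom y)

/-- The signed sum of the values of a function over all sequences
`y₁, …, y_{i₁}, B x₁ [y_{i₁+1}, …, y_{j₁}], y_{j₁+1}, …, B xₘ [y_{iₘ+1}, …, y_{jₘ}], …, yₙ`, with
the signs of `nestings`. -/
def nestSum (B : Homog V → List (Homog V) → Homog V) :
    List (Homog V) → ℤ → List (Homog V) → (List (Homog V) → E) →+ E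
  | [] => fun _ ys =>
    { toFun := fun Φ => Φ ys
      map_zero' := rfl
      map_add' := fun _ _ => rfl }
  | x :: xs => nestNext B x (nestSum B xs)

variable (B : Homog V → List (Homog V) → Homog V)

theorem nestSum_nil (s : ℤ) (ys : List (Homog V)) (Φ : List (Homog V) → E) :
    nestSum B [] s ys Φ = Φ ys := rfl

theorem nestFront_apply (x : Homog V) (R : ℤ → List (Homog V) → (List (Homog V) → E) →+ E)
    (s : ℤ) (ys : List (Homog V)) (Φ : List (Homog V) → E) :
    nestFront B x R s ys Φ = cutSum ys fun ys₁ ys₂ _ => (x.sdeg * s).negOnePow •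
      R (s + sdegs ys₁) ys₂ fun zs => Φ (B x ys₁ :: zs) := rfl

theorem nestSum_cons_nil (x : Homog V) (xs : List (Homog V)) (s : ℤ) (Φ : List (Homog V) → E) :
    nestSum B (x :: xs) s [] Φ = nestFront B x (nestSum B xs) s [] Φ := rfl

theorem nestSum_cons_cons (x y : Homog V) (xs ys : List (Homog V)) (s : ℤ)
    (Φ : List (Homog V) → E) :
    nestSum B (x :: xs) s (y :: ys) Φ = nestFront B x (nestSum B xs) s (y :: ys) Φ +
      nestSum B (x :: xs) (s + y.sdeg) ys fun zs => Φ (y :: zs) := rfl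

theorem map_nestFront (φ : E →+ E') (x : Homog V)
    (R : ℤ → List (Homog V) → (List (Homog V) → E) →+ E)
    (R' : ℤ → List (Homog V) → (List (Homog V) → E') →+ E')
    (hR : ∀ s ys Φ, φ (R s ys Φ) = R' s ys fun zs => φ (Φ zs)) (s : ℤ) (ys : List (Homog V))
    (Φ : List (Homog V) → E) :
    φ (nestFront B x R s ys Φ) = nestFront B x R' s ys fun zs => φ (Φ zs) := by
  rw [nestFront_apply, nestFront_apply, map_cutSum]
  refine cutSum_congr ys fun u v q => ?_
  rw [Units.smul_def, Units.smul_def, map_zsmul, hR]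

theorem map_nestSum (φ : E →+ E') (xs : List (Homog V)) (s : ℤ) (ys : List (Homog V))
    (Φ : List (Homog V) → E) :
    φ (nestSum B xs s ys Φ) = nestSum B xs s ys fun zs => φ (Φ zs) := by
  induction xs generalizing s ys Φ with
  | nil => rfl
  | cons x xs ih =>
    induction ys generalizing s Φ with
    | nil => exact map_nestFront B φ x _ _ ih _ _ _
    | cons y ys ih' =>
      rw [nestSum_cons_cons, nestSum_cons_cons, map_add, map_nestFront B φ x _ _ ih, ih']

theorem smul_nestSum (ε : ℤˣ) (xs : List (Homog V)) (s : ℤ) (ys : List (Homog V))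
    (Φ : List (Homog V) → E) :
    ε • nestSum B xs s ys Φ = nestSum B xs s ys fun zs => ε • Φ zs :=
  map_nestSum B (DistribSMul.toAddMonoidHom E ε) xs s ys Φ

theorem nestSum_cutSum {X : Type*} (m : List X) (xs : List (Homog V)) (s : ℤ)
    (ys : List (Homog V)) (H : (b c : List X) → Cut m b c → List (Homog V) → E) :
    nestSum B xs s ys (fun zs => cutSum m fun b c q => H b c q zs) =
      cutSum m fun b c q => nestSum B xs s ys (H b c q) := by
  rw [← map_cutSum]
  congr 1
  funext zs
  exact (map_cutSum (AddMonoidHom.mk' (fun h : List (Homog V) → E => h zs) fun _ _ => rfl)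
    m H).symm

theorem sum_nestings {brace : A → List A → A} (hB : ∀ x ys, (B x ys).val = brace x.val (vals ys))
    (xs : List (Homog V)) (s : ℤ) (ys : List (Homog V)) (Φ : List A → E) :
    ((nestings brace xs s ys).map fun t => t.1 • Φ t.2).sum =
      nestSum B xs s ys fun zs => Φ (vals zs) := by
  induction xs generalizing s ys Φ with
  | nil => simp [nestings, nestSum_nil]
  | cons x xs ih =>
    -- The terms in which `k` of the `y`s come before `x`.
    let T (s : ℤ) (ys : List (Homog V)) (Φ : List A → E) (k : ℕ) : E :=
      ((List.range ((ys.drop k).length + 1)).map fun j =>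
        ((nestings brace xs (s + sdegs (ys.take k) + sdegs ((ys.drop k).take j))
          ((ys.drop k).drop j)).map fun t =>
            ((x.sdeg * (s + sdegs (ys.take k))).negOnePow * t.1) •
              Φ (vals (ys.take k) ++ brace x.val (vals ((ys.drop k).take j)) :: t.2)).sum).sum
    have hT (s : ℤ) (ys : List (Homog V)) (Φ : List A → E) :
        ((nestings brace (x :: xs) s ys).map fun t => t.1 • Φ t.2).sum =
          ((List.range (ys.length + 1)).map (T s ys Φ)).sum := by
      simp only [nestings, List.map_flatMap, sum_flatMap, List.map_map]
      rfl
    have hT0 (s : ℤ) (ys : List (Homog V)) (Φ : List A → E) :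
        T s ys Φ 0 = nestFront B x (nestSum B xs) s ys fun zs => Φ (vals zs) := by
      simp only [T, List.take_zero, List.drop_zero, sdegs_nil, add_zero, mul_smul]
      rw [nestFront_apply, ← sum_take_drop_eq_cutSum ys fun ys₁ ys₂ => (x.sdeg * s).negOnePow •
        nestSum B xs (s + sdegs ys₁) ys₂ fun zs => Φ (vals (B x ys₁ :: zs))]
      congr 1
      refine List.map_congr_left fun j _ => ?_
      have := ih (s + sdegs (ys.take j)) (ys.drop j) fun as =>
        Φ (brace x.val (vals (ys.take j)) :: as)
      rw [show (fun zs => Φ (vals (B x (ys.take j) :: zs))) = fun zs : List (Homog V) =>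
          Φ (brace x.val (vals (ys.take j)) :: vals zs) by
        funext zs; rw [← hB]; rfl]
      rw [← this, List.smul_sum, List.map_map]
      rfl
    rw [hT]
    induction ys generalizing s Φ with
    | nil =>
      rw [nestSum_cons_nil, ← hT0]
      exact add_zero _
    | cons y ys ih' =>
      rw [nestSum_cons_cons, ← hT0, List.length_cons, List.range_succ_eq_map, List.map_cons,
        List.sum_cons, List.map_map]
      refine congrArg₂ (· + ·) rfl (Eq.trans ?_ (ih' (s + y.sdeg) fun as => Φ (y.val :: as)))
      congr 1
      refine List.map_congr_left fun k _ => ?_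
      simp only [T, Function.comp_apply, List.take_succ_cons, List.drop_succ_cons, sdegs_cons,
        add_assoc]
      rfl

end HomotopyG

namespace MonoidalHochschild

universe w

open HomotopyG

/-! ### Substitution is natural -/

section CoherenceNat

variable {D : Type u₂} [Category.{v₂} D] [MonoidalCategory D]

theorem consIso_hom_natural {X X' L L' U U' V V' : D} (f : X ⟶ X') (g : L ⟶ L') (s : U ⟶ U')
    (t : V ⟶ V') (e : L ≅ U ⊗ V) (e' : L' ≅ U' ⊗ V') (h : g ≫ e'.hom = e.hom ≫ (s ⊗ₘ t)) :
    (f ⊗ₘ g) ≫ (whiskerLeftIso X' e' ≪≫ (α_ X' U' V').symm).hom =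
      (whiskerLeftIso X e ≪≫ (α_ X U V).symm).hom ≫ ((f ⊗ₘ s) ⊗ₘ t) := by
  have h' : (f ⊗ₘ g) ≫ X' ◁ e'.hom = X ◁ e.hom ≫ (f ⊗ₘ (s ⊗ₘ t)) := by
    rw [← id_tensorHom, ← id_tensorHom, MonoidalCategory.tensorHom_comp_tensorHom,
      MonoidalCategory.tensorHom_comp_tensorHom, h, Category.comp_id, Category.id_comp]
  simp only [Iso.trans_hom, whiskerLeftIso_hom, Iso.symm_hom, Category.assoc]
  rw [reassoc_of% h', associator_inv_naturality]

theorem leftUnitor_inv_natural {L L' : D} (g : L ⟶ L') :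
    g ≫ (λ_ L').symm.hom = (λ_ L).symm.hom ≫ (𝟙 (𝟙_ D) ⊗ₘ g) := by
  simp

theorem whiskerLeft_comp_tensorHom_of_comp_eq {U U' V V' O P : D} (s : U ⟶ U')
    {t : V ⟶ V'} {a : O ⟶ V} {b : P ⟶ V'} {r : O ⟶ P} (hr : a ≫ t = r ≫ b) :
    U ◁ a ≫ (s ⊗ₘ t) = (s ⊗ₘ r) ≫ U' ◁ b := by
  rw [← id_tensorHom, ← id_tensorHom, MonoidalCategory.tensorHom_comp_tensorHom,
    MonoidalCategory.tensorHom_comp_tensorHom, hr, Category.comp_id, Category.id_comp]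

theorem comp_tensorHom_of_comp_eq {L L' U U' V V' X X' O P : D} {g : L ⟶ L'} {s : U ⟶ U'}
    {t : V ⟶ V'} {e : L ⟶ U ⊗ V} {e' : L' ⟶ U' ⊗ V'} (h : g ≫ e' = e ≫ (s ⊗ₘ t))
    {y : U ⟶ X} {y' : U' ⟶ X'} {k : X ⟶ X'} (hy : s ≫ y' = y ≫ k) {a : V ⟶ O} {b : V' ⟶ P}
    {r : O ⟶ P}
    (hr : t ≫ b = a ≫ r) :
    g ≫ e' ≫ (y' ⊗ₘ b) = (e ≫ (y ⊗ₘ a)) ≫ (k ⊗ₘ r) := by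
  rw [reassoc_of% h, Category.assoc, MonoidalCategory.tensorHom_comp_tensorHom,
    MonoidalCategory.tensorHom_comp_tensorHom, hy, hr]

theorem whiskerLeft_comp_inv_of_comp_eq {L L' U U' V V' O P : D} {g : L ⟶ L'} {s : U ⟶ U'}
    {t : V ⟶ V'} {e : L ≅ U ⊗ V} {e' : L' ≅ U' ⊗ V'} (h : g ≫ e'.hom = e.hom ≫ (s ⊗ₘ t))
    {a : O ⟶ V} {b : P ⟶ V'} {r : O ⟶ P} (hr : a ≫ t = r ≫ b) :
    (U ◁ a ≫ e.inv) ≫ g = (s ⊗ₘ r) ≫ U' ◁ b ≫ e'.inv := by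
  rw [← cancel_mono e'.hom]
  simp only [Category.assoc, h, Iso.inv_hom_id_assoc, Iso.inv_hom_id, Category.comp_id]
  exact whiskerLeft_comp_tensorHom_of_comp_eq s hr

end CoherenceNat

section Natural

variable {C : Type u₁} [Category.{v₁} C] [MonoidalCategory C]
  {D : Type u₂} [Category.{v₂} D] [MonoidalCategory D] {F : C ⥤ D}
  {E : Type w} [AddCommGroup E]

/-- Sums over cuts may be compared along a morphism of tuples, as this induces morphisms between the
parts of the cuts. -/
theorem cutSum_listHom {l m : List C} (φ : ListHom l m) (f : (u v : List C) → Cut l u v → E)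
    (g : (u v : List C) → Cut m u v → E)
    (h : ∀ (u v : List C) (q : Cut l u v) (u' v' : List C) (q' : Cut m u' v') (φ₁ : ListHom u u')
      (φ₂ : ListHom v v'),
      tensorListMap F φ ≫ (q'.split F).hom =
        (q.split F).hom ≫ (tensorListMap F φ₁ ⊗ₘ tensorListMap F φ₂) →
      tensorListMap (𝟭 C) φ ≫ (q'.split (𝟭 C)).hom =
        (q.split (𝟭 C)).hom ≫ (tensorListMap (𝟭 C) φ₁ ⊗ₘ tensorListMap (𝟭 C) φ₂) →
      f u v q = g u' v' q') :
    cutSum l f = cutSum m g := by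
  induction φ with
  | nil =>
    exact h [] [] (.nil []) [] [] (.nil []) .nil .nil (leftUnitor_inv_natural _)
      (leftUnitor_inv_natural _)
  | @cons x y l m k φ ih =>
    rw [cutSum_cons, cutSum_cons]
    refine congrArg₂ (· + ·) (h _ _ (.nil _) _ _ (.nil _) .nil (.cons k φ)
      (leftUnitor_inv_natural _) (leftUnitor_inv_natural _)) (ih _ _ ?_)
    intro u v q u' v' q' φ₁ φ₂ h₁ h₂
    exact h _ _ _ _ _ _ (.cons k φ₁) φ₂ (consIso_hom_natural _ _ _ _ _ _ h₁)
      (consIso_hom_natural _ _ _ _ _ _ h₂)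

variable [Preadditive D]

theorem insSum_listHom (ys : List (Homog (cochains F))) (a : ℤ) {l m : List C} (φ : ListHom l m)
    (h : Functional F l E) (h' : Functional F m E)
    (H : ∀ {o p : List C} (ψ : ListHom o p) (f : tensorList F l ⟶ tensorList F o)
      (g : tensorList F m ⟶ tensorList F p) (c : tensorList (𝟭 C) o ⟶ tensorList (𝟭 C) l)
      (d : tensorList (𝟭 C) p ⟶ tensorList (𝟭 C) m),
      tensorListMap F φ ≫ g = f ≫ tensorListMap F ψ →
      c ≫ tensorListMap (𝟭 C) φ = tensorListMap (𝟭 C) ψ ≫ d → h o f c = h' p g d) :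
    insSum ys a l h = insSum ys a m h' := by
  induction ys generalizing a l m with
  | nil =>
    exact H φ (𝟙 _) (𝟙 _) (𝟙 _) (𝟙 _)
      ((Category.comp_id _).trans (Category.id_comp _).symm)
      ((Category.id_comp _).trans (Category.comp_id _).symm)
  | cons y ys ih =>
    have key (a : ℤ) {l m : List C} (φ : ListHom l m) (h : Functional F l E) (h' : Functional F m E)
        (H : ∀ {o p : List C} (ψ : ListHom o p) (f : tensorList F l ⟶ tensorList F o)
          (g : tensorList F m ⟶ tensorList F p) (c : tensorList (𝟭 C) o ⟶ tensorList (𝟭 C) l)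
          (d : tensorList (𝟭 C) p ⟶ tensorList (𝟭 C) m),
          tensorListMap F φ ≫ g = f ≫ tensorListMap F ψ →
          c ≫ tensorListMap (𝟭 C) φ = tensorListMap (𝟭 C) ψ ≫ d → h o f c = h' p g d) :
        plugSum y.sdeg y.val (insSum ys) a l h = plugSum y.sdeg y.val (insSum ys) a m h' := by
      rw [plugSum_apply, plugSum_apply]
      refine cutSum_listHom (F := F) φ _ _ fun u v q u' v' q' φ₁ φ₂ h₁ h₂ => ?_
      rw [φ₁.length_eq]
      refine congrArg _ (ih _ φ₂ _ _ fun ψ f g c d hf hc => ?_)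
      exact H (.cons (tensorListMap (𝟭 C) φ₁) ψ) (plugHom q (y.val u) f) (plugHom q' (y.val u') g)
        (plugCoh q c) (plugCoh q' d)
        (comp_tensorHom_of_comp_eq h₁ (isNatural_val y _ _ φ₁) hf)
        (whiskerLeft_comp_inv_of_comp_eq h₂ hc)
    induction φ generalizing a with
    | nil => exact key a .nil h h' H
    | @cons x x' l m k φ ih' =>
      rw [insSum_cons_cons, insSum_cons_cons]
      refine congrArg₂ (· + ·) (key a (.cons k φ) h h' H) (ih' _ _ _ fun ψ f g c d hf hc => ?_)
      exact H (.cons k ψ) _ _ _ _ (whiskerLeft_comp_tensorHom_of_comp_eq _ hf.symm).symm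
        (whiskerLeft_comp_tensorHom_of_comp_eq _ hc)

variable [MonoidalPreadditive D]

theorem substitution_vals (x : Family F) (ys : List (Homog (cochains F))) (l : List C) :
    substitution F x (vals ys) l = insSum ys 0 l (evalFunctional F x l) := by
  have := sum_insertions ys 0 l (evalFunctional F x l) fun o c => by simp [evalFunctional]
  exact this

theorem substitution_mem (x : Homog (cochains F)) (ys : List (Homog (cochains F))) :
    substitution F x.val (vals ys) ∈
      cochains F (x.deg + (ys.map Homog.deg).sum - ys.length) := by
  have hdeg := sum_deg_sub_length ys
  refine ⟨fun l m φ => ?_, fun l hl => ?_⟩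
  · rw [substitution_vals, substitution_vals]
    refine (map_insSum (Preadditive.leftComp _ (tensorListMap F φ)) ys 0 m _).trans
      (Eq.trans ?_ (map_insSum (Preadditive.rightComp _ (F.map (tensorListMap (𝟭 C) φ))) ys 0 l
        _).symm)
    refine (insSum_listHom ys 0 φ _ _ fun ψ f g c d hf hc => ?_).symm
    change (f ≫ x.val _ ≫ F.map c) ≫ F.map (tensorListMap (𝟭 C) φ) =
      tensorListMap F φ ≫ g ≫ x.val _ ≫ F.map d
    simp only [Category.assoc, ← F.map_comp, hc]
    rw [reassoc_of% hf, reassoc_of% (isNatural_val x _ _ ψ), F.map_comp]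
  · rw [substitution_vals]
    refine insSum_eq_zero ys 0 l _ (fun o c => by simp [evalFunctional]) fun o f c ho => ?_
    rw [evalFunctional, val_apply_eq_zero x o (by omega), Limits.zero_comp, Limits.comp_zero]

/-- The brace of homogeneous cochains. -/
def homogBrace (x : Homog (cochains F)) (ys : List (Homog (cochains F))) : Homog (cochains F) :=
  ⟨_, _, substitution_mem x ys⟩

theorem homogBrace_val (x : Homog (cochains F)) (ys : List (Homog (cochains F))) :
    (homogBrace x ys).val = substitution F x.val (vals ys) := rfl

end Natural
/-! ### The pre-Jacobi identity -/

section CoherencePlug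

variable {D : Type u₂} [Category.{v₂} D] [MonoidalCategory D]

theorem comp_tensorHom_comp_tensorHom {L U V A B X O : D} (q : L ⟶ U ⊗ V) (s : U ⟶ A) (t : V ⟶ B)
    (y : A ⟶ X) (f : B ⟶ O) :
    (q ≫ (s ⊗ₘ t)) ≫ (y ⊗ₘ f) = q ≫ ((s ≫ y) ⊗ₘ (t ≫ f)) := by
  simp

theorem whiskerLeft_comp_tensorHom_comp {L A U B V O : D} (c : O ⟶ B) (c₁ : A ⟶ U) (c₂ : B ⟶ V)
    (q : U ⊗ V ⟶ L) {i : O ⟶ O} (hi : i = 𝟙 O) :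
    A ◁ c ≫ (c₁ ⊗ₘ c₂) ≫ q = (c₁ ⊗ₘ i) ≫ U ◁ (c ≫ c₂) ≫ q := by
  subst hi
  simp [MonoidalCategory.tensorHom_def', whisker_exchange_assoc]

theorem comp_tensorHom_comp_id {L U V X X' O : D} (q : L ⟶ U ⊗ V) (s : U ⟶ X) (t : V ⟶ O)
    (k : X ⟶ X') {i : O ⟶ O} (hi : i = 𝟙 O) {s' : U ⟶ X'} (hs : s ≫ k = s') :
    (q ≫ (s ⊗ₘ t)) ≫ (k ⊗ₘ i) = q ≫ (s' ⊗ₘ t) := by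
  subst hi hs
  rw [Category.assoc, MonoidalCategory.tensorHom_comp_tensorHom, Category.comp_id]

end CoherencePlug

section PreJacobi

variable {C : Type u₁} [Category.{v₁} C] [MonoidalCategory C]
  {D : Type u₂} [Category.{v₂} D] [MonoidalCategory D] {F : C ⥤ D} [Preadditive D]
  [MonoidalPreadditive D] {E : Type w} [AddCommGroup E]

theorem homogBrace_sdeg (x : Homog (cochains F)) (ys : List (Homog (cochains F))) :
    (homogBrace x ys).sdeg = x.sdeg + sdegs ys := by
  rw [← sum_deg_sub_length]
  simp only [homogBrace, Homog.sdeg, Homog.deg]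
  ring

/-- The functional which follows a regrouping by another one. -/
def Functional.after {l o : List C} (h : Functional F l E) (f : tensorList F l ⟶ tensorList F o)
    (c : tensorList (𝟭 C) o ⟶ tensorList (𝟭 C) l) : Functional F o E :=
  fun o' f' c' => h o' (f ≫ f') (c' ≫ c)

omit [Preadditive D] [MonoidalPreadditive D] [AddCommGroup E] in
theorem Functional.after_keep_keep {x : C} {l o : List C} (h : Functional F (x :: l) E)
    (f : tensorList F l ⟶ tensorList F o) (c : tensorList (𝟭 C) o ⟶ tensorList (𝟭 C) l) :
    (h.after (keepHom F x f) (keepHom (𝟭 C) x c)).keep = h.keep.after f c := by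
  funext o' f' c'
  simp only [Functional.after, Functional.keep, keepHom_comp]

omit [Preadditive D] [MonoidalPreadditive D] [AddCommGroup E] in
theorem Functional.after_plug_keep {l u v o : List C} (h : Functional F l E)
    (m : tensorList F u ⟶ F.obj (tensorList (𝟭 C) u)) (q : Cut l u v)
    (f : tensorList F v ⟶ tensorList F o) (c : tensorList (𝟭 C) o ⟶ tensorList (𝟭 C) v) :
    (h.after (plugHom q m f) (plugCoh q c)).keep = (h.plug m q).after f c := by
  funext o' f' c'
  simp only [Functional.after, Functional.keep, Functional.plug, plugHom_comp, plugCoh_comp]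

omit [MonoidalPreadditive D] in
/-- Inserting into both parts of a cut, and then evaluating `x` on the new inputs of the first part.
By naturality of `x`, this amounts to replacing the first part by a single input. -/
theorem Functional.IsGood.apply_pair {l u v o₁ o₂ : List C} {h : Functional F l E} (hh : h.IsGood)
    (x : Family F) (q : Cut l u v) (s₁ : tensorList F u ⟶ tensorList F o₁)
    (c₁ : tensorList (𝟭 C) o₁ ⟶ tensorList (𝟭 C) u) (s₂ : tensorList F v ⟶ tensorList F o₂)
    (c₂ : tensorList (𝟭 C) o₂ ⟶ tensorList (𝟭 C) v) (o : List C)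
    (f : tensorList F o₂ ⟶ tensorList F o) (c : tensorList (𝟭 C) o ⟶ tensorList (𝟭 C) o₂) :
    h (tensorList (𝟭 C) o₁ :: o) (((q.split F).hom ≫ (s₁ ⊗ₘ s₂)) ≫ (x o₁ ⊗ₘ f))
        ((tensorList (𝟭 C) o₁ ◁ c) ≫ (c₁ ⊗ₘ c₂) ≫ (q.split (𝟭 C)).inv) =
      (h.plug (s₁ ≫ x o₁ ≫ F.map c₁) q).after s₂ c₂ o f c := by
  have := hh.map_comp (.cons c₁ (ListHom.id o))
    (show tensorList F l ⟶ tensorList F (tensorList (𝟭 C) o₁ :: o) from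
      (q.split F).hom ≫ ((s₁ ≫ x o₁) ⊗ₘ (s₂ ≫ f)))
    (plugCoh q (c ≫ c₂))
  refine Eq.trans ?_ (this.symm.trans ?_)
  · exact congrArg₂ (h _) (comp_tensorHom_comp_tensorHom _ _ _ _ _)
      (whiskerLeft_comp_tensorHom_comp _ _ _ _ (tensorListMap_id _ _))
  · exact congrArg (h _ · _) (comp_tensorHom_comp_id _ _ _ _ (tensorListMap_id _ _)
      (Category.assoc _ _ _))

/-- The terms of the iterated sum in `insSum_insSum` in which the first of the new inputs is
replaced. -/
theorem insSum_plugSum_after (x : Homog (cochains F)) (xs ys : List (Homog (cochains F)))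
    (IH : ∀ (ys : List (Homog (cochains F))) (a s b : ℤ), b = a + s → ∀ (l : List C)
      (h : Functional F l E), h.IsGood →
      insSum ys b l (fun o f c => insSum xs a o (h.after f c)) =
        nestSum homogBrace xs s ys fun zs => insSum zs b l h)
    (a s : ℤ) (l : List C) (h : Functional F l E) (hh : h.IsGood) :
    insSum ys (a + s) l (fun o f c => plugSum x.sdeg x.val (insSum xs) a o (h.after f c)) =
      nestFront homogBrace x (nestSum homogBrace xs) s ys fun zs => frontSum zs (a + s) l h := by
  let g : PairFunctional F l E := fun o₁ o₂ t c => (x.sdeg * a).negOnePow •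
    insSum xs (a + o₁.length) o₂ fun o' f' c' =>
      h (tensorList (𝟭 C) o₁ :: o') (t ≫ (x.val o₁ ⊗ₘ f')) ((tensorList (𝟭 C) o₁ ◁ c') ≫ c)
  have h1 (o : List C) (f : tensorList F l ⟶ tensorList F o)
      (c : tensorList (𝟭 C) o ⟶ tensorList (𝟭 C) l) :
      plugSum x.sdeg x.val (insSum xs) a o (h.after f c) = cutSum o (g.atCut o f c) := by
    rw [plugSum_apply]
    refine cutSum_congr o fun u v q => ?_
    refine congrArg (fun k => (x.sdeg * a).negOnePow • insSum xs (a + u.length) v k) ?_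
    funext o' f' c'
    exact congrArg₂ (h _) (Category.assoc _ _ _).symm (Category.assoc _ _ _)
  simp only [h1, insSum_cutSum_atCut, nestFront_apply, frontSum_cons, plugSum_apply]
  refine cutSum_congr ys fun ys₁ ys₂ _ => ?_
  rw [nestSum_cutSum, smul_cutSum]
  refine cutSum_congr l fun u v q => ?_
  let K : (tensorList F u ⟶ F.obj (tensorList (𝟭 C) u)) →+ E := AddMonoidHom.mk'
    (fun m => nestSum homogBrace xs (s + sdegs ys₁) ys₂ fun zs =>
      insSum zs (a + s + u.length) v (h.plug m q)) fun m m' => by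
        rw [← map_add]
        congr 1
        funext zs
        rw [hh.plug_add, map_add]
        rfl
  have hK (m : tensorList F u ⟶ F.obj (tensorList (𝟭 C) u)) (b : ℤ)
      (hb : b = a + u.length - sdegs ys₁) :
      insSum ys₂ (a + s + u.length) v (fun o₂ s₂ c₂ => insSum xs b o₂ ((h.plug m q).after s₂ c₂)) =
        K m :=
    IH _ _ _ _ (by rw [hb]; ring) _ _ (hh.plug m q)
  have hg (o : List C) (t : tensorList F u ⟶ tensorList F o)
      (c : tensorList (𝟭 C) o ⟶ tensorList (𝟭 C) u) :
      insSum ys₂ (a + s + u.length) v (g.pair q o t c) = (x.sdeg * a).negOnePow •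
        insSum ys₂ (a + s + u.length) v fun o₂ s₂ c₂ => insSum xs (a + o.length) o₂
          ((h.plug (evalFunctional F x.val u o t c) q).after s₂ c₂) := by
    rw [smul_insSum]
    congr 1
    funext o₂ s₂ c₂
    refine congrArg (fun k => (x.sdeg * a).negOnePow • insSum xs (a + o.length) o₂ k) ?_
    funext o' f' c'
    exact hh.apply_pair x.val q t c s₂ c₂ o' f' c'
  have h2 : insSum ys₁ (a + s) u (fun o t c => insSum ys₂ (a + s + u.length) v (g.pair q o t c)) =
      insSum ys₁ (a + s) u fun o t c => (x.sdeg * a).negOnePow •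
        K (evalFunctional F x.val u o t c) := by
    refine insSum_congr ys₁ (a + s) u _ _ (fun o c => ?_) (fun o c => ?_) fun o t c ho => ?_
    · rw [hg, evalFunctional, Limits.zero_comp, Functional.plug_zero hh.map_zero]
      refine (congrArg _ ((congrArg _ ?_).trans (map_zero (insSum ys₂ _ v)))).trans (smul_zero _)
      funext o₂ s₂ c₂
      exact map_zero (insSum xs _ o₂)
    · rw [evalFunctional, Limits.zero_comp, map_zero, smul_zero]
    · rw [hg, hK _ _ (by rw [ho]; ring)]
  rw [h2, ← smul_insSum, ← map_insSum, ← zero_add (a + s), insSum_add, ← substitution_vals,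
    ← homogBrace_val, ← smul_nestSum, smul_smul, zero_add, homogBrace_sdeg]
  change _ = _ • K _
  rw [Units.smul_def (sdegs ys₁ * (a + s)).negOnePow, map_zsmul, ← Units.smul_def, smul_smul,
    ← Int.negOnePow_add, ← Int.negOnePow_add]
  congr 1
  rw [Int.negOnePow_eq_iff]
  refine ⟨- (x.sdeg * s), ?_⟩
  ring

/-- The pre-Jacobi identity before evaluation: inserting `ys` and then `xs` amounts to inserting all
nestings of `xs` in `ys`. -/
theorem insSum_insSum (xs ys : List (Homog (cochains F))) (a s b : ℤ) (hb : b = a + s)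
    (l : List C) (h : Functional F l E) (hh : h.IsGood) :
    insSum ys b l (fun o f c => insSum xs a o (h.after f c)) =
      nestSum homogBrace xs s ys fun zs => insSum zs b l h := by
  subst hb
  induction xs generalizing ys a s l with
  | nil =>
    rw [nestSum_nil]
    congr 1
    funext o f c
    rw [insSum_nil, Functional.after, Category.comp_id, Category.id_comp]
  | cons x xs IH =>
    have hfront (ys : List (Homog (cochains F))) (a s : ℤ) (l : List C) (h : Functional F l E)
        (hh : h.IsGood) := insSum_plugSum_after (E := E) x xs ys
      (fun ys a s b hb l h hh => by rw [hb]; exact IH ys a s l h hh) a s l h hh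
    -- Of the terms in which the first of the new inputs is kept, those in which the first of the
    -- old inputs is replaced.
    let G (a : ℤ) {l : List C} (h : Functional F l E) : Functional F l E :=
      fun o f c => keepSum (insSum (x :: xs)) a o (h.after f c)
    have hG_keep (a : ℤ) {y : C} {l : List C} (h : Functional F (y :: l) E) :
        (G a h).keep = fun o f c => insSum (x :: xs) (a + 1) o (h.keep.after f c) := by
      funext o f c
      rw [← Functional.after_keep_keep]
      rfl
    have hG_plug (a : ℤ) {l u v : List C} (h : Functional F l E)
        (m : tensorList F u ⟶ F.obj (tensorList (𝟭 C) u)) (q : Cut l u v) :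
        (G a h).plug m q = fun o f c => insSum (x :: xs) (a + 1) o ((h.plug m q).after f c) := by
      funext o f c
      rw [← Functional.after_plug_keep]
      rfl
    have tail (ys : List (Homog (cochains F)))
        (H : ∀ (a s : ℤ) (l : List C) (h : Functional F l E), h.IsGood →
          insSum ys (a + s) l (fun o f c => plugSum x.sdeg x.val (insSum xs) a o (h.after f c)) +
              frontSum ys (a + s) l (G a h) =
            nestSum homogBrace (x :: xs) s ys fun zs => frontSum zs (a + s) l h)
        (a s : ℤ) (l : List C) (h : Functional F l E) (hh : h.IsGood) :
        insSum ys (a + s) l (fun o f c => insSum (x :: xs) a o (h.after f c)) =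
          nestSum homogBrace (x :: xs) s ys fun zs => insSum zs (a + s) l h := by
      have h1 (a : ℤ) (l : List C) (h : Functional F l E) :
          (fun o f c => insSum (x :: xs) a o (h.after f c)) =
            (fun o f c => plugSum x.sdeg x.val (insSum xs) a o (h.after f c)) + G a h := by
        funext o f c
        exact insSum_cons_eq _ _ _ _ _
      have h2 (a : ℤ) (l : List C) (h : Functional F l E) : (fun zs => insSum zs (a + s) l h) =
          (fun zs => frontSum zs (a + s) l h) + fun zs => keepSum (insSum zs) (a + s) l h := by
        funext zs
        exact insSum_eq _ _ _ _
      induction l generalizing a with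
      | nil =>
        rw [h1, h2, map_add, map_add, insSum_eq ys _ _ (G a h), ← add_assoc, H a s _ h hh]
        congr 1
        exact (map_zero (nestSum homogBrace (x :: xs) s ys)).symm
      | cons y l ih =>
        rw [h1, h2, map_add, map_add, insSum_eq ys _ _ (G a h), ← add_assoc, H a s _ h hh]
        congr 1
        have := ih (a + 1) h.keep hh.keep
        rw [add_right_comm] at this
        rw [keepSum_cons, hG_keep, this]
        rfl
    induction ys generalizing a s l with
    | nil =>
      refine tail [] (fun a s l h hh => ?_) a s l h hh
      rw [nestSum_cons_nil, ← hfront _ a s l h hh]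
      refine (congrArg _ ?_).trans (add_zero _)
      cases l <;> rfl
    | cons y ys ih =>
      refine tail (y :: ys) (fun a s l h hh => ?_) a s l h hh
      rw [nestSum_cons_cons, hfront _ a s l h hh]
      congr 1
      simp only [frontSum_cons, plugSum_apply]
      rw [nestSum_cutSum]
      refine cutSum_congr l fun u v q => ?_
      rw [← smul_nestSum, hG_plug]
      congr 1
      by_cases hu : (u.length : ℤ) = y.deg
      · have hab : a + s + u.length = a + 1 + (s + y.sdeg) := by
          rw [hu, Homog.sdeg, Homog.deg]
          ring
        rw [hab, ih (a + 1) (s + y.sdeg) v _ (hh.plug _ q)]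
      · rw [val_apply_eq_zero y u hu, Functional.plug_zero hh.map_zero]
        refine Eq.trans ((congrArg _ ?_).trans (map_zero (insSum ys (a + s + u.length) v)))
          ((congrArg _ ?_).trans (map_zero (nestSum homogBrace (x :: xs) (s + y.sdeg) ys))).symm
        · funext o f c
          exact map_zero (insSum (x :: xs) (a + 1) o)
        · funext zs
          exact map_zero (insSum zs (a + s + u.length) v)

theorem substitution_substitution (x : Homog (cochains F)) (xs ys : List (Homog (cochains F))) :
    substitution F (substitution F x.val (vals xs)) (vals ys) =
      ((nestings (substitution F) xs 0 ys).map fun t => t.1 • substitution F x.val t.2).sum := by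
  rw [sum_nestings homogBrace homogBrace_val xs 0 ys fun as => substitution F x.val as]
  funext l
  refine Eq.trans ?_ (map_nestSum homogBrace (Pi.evalAddMonoidHom
    (fun l => tensorList F l ⟶ F.obj (tensorList (𝟭 C) l)) l) xs 0 ys
    fun zs => substitution F x.val (vals zs)).symm
  simp only [Pi.evalAddMonoidHom_apply, substitution_vals]
  rw [← insSum_insSum xs ys 0 0 0 (add_zero 0).symm l _
    (isGood_evalFunctional (isNatural_val x) l), ← homogBrace_val]
  congr 1
  funext o f c
  rw [evalFunctional, homogBrace_val, substitution_vals]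
  refine (map_insSum (AddMonoidHom.mk' (fun m => f ≫ m ≫ F.map c) fun m m' => by simp) xs 0 o
    _).trans ?_
  congr 1
  funext o' f' c'
  simp [evalFunctional, Functional.after]

end PreJacobi
end MonoidalHochschild

/-! ### Homotopy G-algebras from brace algebras -/

namespace HomotopyG

open MonoidalHochschild

universe w

variable {A : Type*} [AddCommGroup A] {V : ℤ → AddSubgroup A} {E : Type w} [AddCommGroup E]

/-- A graded brace algebra in which `x{x₁, …, xₙ}` vanishes for `n > deg x`, as it does for
cochains: `x` has only `deg x` inputs. -/
structure IsBraceAlgebra (V : ℤ → AddSubgroup A) (brace : A → List A → A) : Prop where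
  brace_mem : ∀ (x : Homog V) (xs : List (Homog V)),
    brace x.val (vals xs) ∈ V (x.deg + (xs.map Homog.deg).sum - xs.length)
  brace_add_left : ∀ (n : ℤ) (x y : V n) (zs : List (Homog V)),
    brace ((x : A) + y) (vals zs) = brace x (vals zs) + brace y (vals zs)
  brace_add_right : ∀ (x : Homog V) (as : List (Homog V)) (n : ℤ) (y z : V n)
      (bs : List (Homog V)),
    brace x.val (vals as ++ ((y : A) + z) :: vals bs) =
      brace x.val (vals as ++ (y : A) :: vals bs) + brace x.val (vals as ++ (z : A) :: vals bs)
  brace_nil : ∀ x : Homog V, brace x.val [] = x.val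
  brace_brace : ∀ (x : Homog V) (xs ys : List (Homog V)),
    brace (brace x.val (vals xs)) (vals ys) =
      ((nestings brace xs 0 ys).map fun t => t.1 • brace x.val t.2).sum
  brace_eq_zero : ∀ (x : Homog V) (xs : List (Homog V)), x.deg < xs.length →
    brace x.val (vals xs) = 0

/-- Additivity in each entry of a list of homogeneous elements. -/
def IsMultiadditive (V : ℤ → AddSubgroup A) (ψ : List A → E) : Prop :=
  ∀ (as : List (Homog V)) (n : ℤ) (y z : V n) (bs : List (Homog V)),
    ψ (vals as ++ ((y : A) + z) :: vals bs) =
      ψ (vals as ++ (y : A) :: vals bs) + ψ (vals as ++ (z : A) :: vals bs)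

namespace IsMultiadditive

variable {ψ : List A → E}

theorem cons (hψ : IsMultiadditive V ψ) (x : Homog V) :
    IsMultiadditive V fun as => ψ (x.val :: as) :=
  fun as n y z bs => hψ (x :: as) n y z bs

theorem head_sub_smul (hψ : IsMultiadditive V ψ) {n : ℤ} {a b : A} (ha : a ∈ V n) (hb : b ∈ V n)
    (ε : ℤˣ) (bs : List (Homog V)) :
    ψ ((a - ε • b) :: vals bs) = ψ (a :: vals bs) - ε • ψ (b :: vals bs) := by
  let f : V n →+ E := AddMonoidHom.mk' (fun y => ψ ((y : A) :: vals bs)) fun y z =>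
    hψ [] n y z bs
  have := map_sub f ⟨a, ha⟩ ((ε : ℤ) • ⟨b, hb⟩)
  rwa [map_zsmul] at this

theorem head_smul (hψ : IsMultiadditive V ψ) {n : ℤ} {a : A} (ha : a ∈ V n) (ε : ℤˣ)
    (bs : List (Homog V)) : ψ ((ε • a) :: vals bs) = ε • ψ (a :: vals bs) := by
  let f : V n →+ E := AddMonoidHom.mk' (fun y => ψ ((y : A) :: vals bs)) fun y z =>
    hψ [] n y z bs
  exact map_zsmul f (ε : ℤ) ⟨a, ha⟩

theorem head_zero (hψ : IsMultiadditive V ψ) (bs : List (Homog V)) : ψ (0 :: vals bs) = 0 := by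
  have := hψ [] 0 0 0 bs
  rw [ZeroMemClass.coe_zero, add_zero] at this
  exact left_eq_add.mp this

end IsMultiadditive

theorem vals_cons (x : Homog V) (xs : List (Homog V)) : vals (x :: xs) = x.val :: vals xs := rfl

section Nestings

variable (B : Homog V → List (Homog V) → Homog V)

theorem nestSum_eq_zero (xs : List (Homog V)) (s : ℤ) (ys : List (Homog V))
    (Φ : List (Homog V) → E) (h : ∀ zs, xs.length ≤ zs.length → Φ zs = 0) :
    nestSum B xs s ys Φ = 0 := by
  induction xs generalizing s ys Φ with
  | nil => exact h _ (Nat.zero_le _)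
  | cons x xs ih =>
    have key (s : ℤ) (ys : List (Homog V)) (Φ : List (Homog V) → E)
        (h : ∀ zs, (x :: xs).length ≤ zs.length → Φ zs = 0) :
        nestFront B x (nestSum B xs) s ys Φ = 0 := by
      rw [nestFront_apply]
      refine (cutSum_congr ys fun u v q => ?_).trans (map_zero _)
      rw [ih (s + sdegs u) v (fun zs => Φ (B x u :: zs)) fun zs hz => h _ (Nat.succ_le_succ hz),
        smul_zero]
      rfl
    induction ys generalizing s Φ with
    | nil => exact key _ _ _ h
    | cons y ys ih' =>
      rw [nestSum_cons_cons, key _ _ _ h, zero_add]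
      exact ih' _ _ fun zs hz => h _ (hz.trans (Nat.le_succ _))

/-- If only the sequences with as many entries as there are `x`s count, then all `y`s have to go
into an `x`. -/
theorem nestSum_cons_eq_nestFront (x : Homog V) (xs : List (Homog V)) (s : ℤ)
    (ys : List (Homog V)) (Φ : List (Homog V) → E)
    (h : ∀ zs, xs.length + 1 < zs.length → Φ zs = 0) :
    nestSum B (x :: xs) s ys Φ = nestFront B x (nestSum B xs) s ys Φ := by
  cases ys with
  | nil => rfl
  | cons y ys =>
    rw [nestSum_cons_cons, nestSum_eq_zero B (x :: xs) _ ys _ fun zs hz => h _ ?_, add_zero]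
    simpa using hz

theorem nestSum_singleton (x : Homog V) (s : ℤ) (ys : List (Homog V))
    (Φ : List (Homog V) → E) (h : ∀ zs, 1 < zs.length → Φ zs = 0) :
    nestSum B [x] s ys Φ = (x.sdeg * s).negOnePow • Φ [B x ys] := by
  rw [nestSum_cons_eq_nestFront B x [] s ys Φ (by simpa using h), nestFront_apply,
    cutSum_eq_full]
  · rfl
  · intro u v q hv
    rw [nestSum_nil, h _ (by simpa [List.length_pos_iff] using hv), smul_zero]

theorem nestSum_nil_right {brace : A → List A → A}
    (hB : ∀ x ys, (B x ys).val = brace x.val (vals ys)) (hb : ∀ x : Homog V, brace x.val [] = x.val)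
    (xs : List (Homog V)) (s : ℤ) (ψ : List A → E) :
    nestSum B xs s [] (fun zs => ψ (vals zs)) = (sdegs xs * s).negOnePow • ψ (vals xs) := by
  induction xs generalizing s ψ with
  | nil => simp [nestSum_nil, sdegs_nil]
  | cons x xs ih =>
    have h1 : (fun zs => ψ (vals (B x [] :: zs))) =
        fun zs : List (Homog V) => (fun as => ψ (x.val :: as)) (vals zs) := by
      funext zs
      rw [vals_cons, hB, vals, List.map_nil, hb]
    rw [nestSum_cons_nil, nestFront_apply, cutSum_nil, h1, ih _ fun as => ψ (x.val :: as),
      smul_smul, ← Int.negOnePow_add, sdegs_nil, add_zero, sdegs_cons, add_mul]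
    rfl

end Nestings

theorem cutSum_append_singleton {X : Type*} (l : List X) (z : X) (f : List X → List X → E)
    (h : ∀ u v, 1 < v.length → f u v = 0) :
    (cutSum (l ++ [z]) fun u v _ => f u v) = f l [z] + f (l ++ [z]) [] := by
  induction l generalizing f with
  | nil => rfl
  | cons x l ih =>
    rw [List.cons_append, cutSum_cons, ih fun u v => f (x :: u) v, h _ _ (by simp), zero_add]
    exact fun u v hv => h _ _ hv

namespace IsBraceAlgebra

variable {brace : A → List A → A} (hV : IsBraceAlgebra V brace)

/-- The brace of homogeneous elements. -/
def homog (x : Homog V) (xs : List (Homog V)) : Homog V := ⟨_, _, hV.brace_mem x xs⟩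

theorem homog_val (x : Homog V) (xs : List (Homog V)) :
    (hV.homog x xs).val = brace x.val (vals xs) := rfl

theorem homog_sdeg (x : Homog V) (xs : List (Homog V)) :
    (hV.homog x xs).sdeg = x.sdeg + sdegs xs := by
  rw [← sum_deg_sub_length]
  simp only [homog, Homog.sdeg, Homog.deg]
  ring

include hV

theorem homog_nil_val (x : Homog V) : (hV.homog x []).val = x.val := hV.brace_nil x

theorem isMultiadditive (x : Homog V) : IsMultiadditive V (brace x.val) :=
  fun as n y z bs => hV.brace_add_right x as n y z bs

theorem brace_sub_smul_left {n : ℤ} {a b : A} (ha : a ∈ V n) (hb : b ∈ V n) (ε : ℤˣ)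
    (zs : List (Homog V)) :
    brace (a - ε • b) (vals zs) = brace a (vals zs) - ε • brace b (vals zs) := by
  let f : V n →+ A := AddMonoidHom.mk' (fun y => brace (y : A) (vals zs)) fun y z =>
    hV.brace_add_left n y z zs
  have := map_sub f ⟨a, ha⟩ ((ε : ℤ) • ⟨b, hb⟩)
  rwa [map_zsmul] at this

theorem brace_smul_left {n : ℤ} {a : A} (ha : a ∈ V n) (ε : ℤˣ) (zs : List (Homog V)) :
    brace (ε • a) (vals zs) = ε • brace a (vals zs) := by
  let f : V n →+ A := AddMonoidHom.mk' (fun y => brace (y : A) (vals zs)) fun y z =>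
    hV.brace_add_left n y z zs
  exact map_zsmul f (ε : ℤ) ⟨a, ha⟩

theorem zero_brace (zs : List (Homog V)) : brace 0 (vals zs) = 0 := by
  have := hV.brace_add_left 0 0 0 zs
  simpa using this

theorem brace_brace_eq (x : Homog V) (xs ys : List (Homog V)) :
    brace (brace x.val (vals xs)) (vals ys) =
      nestSum hV.homog xs 0 ys fun zs => brace x.val (vals zs) := by
  rw [hV.brace_brace, sum_nestings hV.homog hV.homog_val xs 0 ys fun as => brace x.val as]

end IsBraceAlgebra

/-! ### Multiplications on brace algebras -/

theorem cutSum_eq_nil {X : Type*} (l : List X) (f : (u v : List X) → Cut l u v → E)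
    (h : ∀ u v q, u ≠ [] → f u v q = 0) : cutSum l f = f [] l (.nil l) := by
  cases l with
  | nil => rfl
  | cons x l =>
    rw [cutSum_cons]
    refine (congrArg _ ((cutSum_congr l fun u v q => ?_).trans (map_zero _))).trans (add_zero _)
    exact h _ _ _ (by simp)

/-- `∑ᵢ (-1)^(s + |y₁| + ⋯ + |yᵢ₋₁|) ψ (y₁, …, d yᵢ, …, yₙ)` -/
def derSum (d : A → A) : ℤ → List (Homog V) → (List A → E) → E
  | _, [], _ => 0
  | s, y :: ys, ψ => s.negOnePow • ψ (d y.val :: vals ys) +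
      derSum d (s + y.sdeg) ys fun as => ψ (y.val :: as)

/-- `∑ᵢ (-1)^(s + |y₁| + ⋯ + |yᵢ|) ψ (y₁, …, yᵢ · yᵢ₊₁, …, yₙ)` -/
def mulSum (mul : A → A → A) : ℤ → List (Homog V) → (List A → E) → E
  | _, [], _ => 0
  | _, [_], _ => 0
  | s, y :: z :: ys, ψ => (s + y.sdeg).negOnePow • ψ (mul y.val z.val :: vals ys) +
      mulSum mul (s + y.sdeg) (z :: ys) fun as => ψ (y.val :: as)

/-- `ψ (f z, y₁, …, yₙ)` for a list `z, y₁, …, yₙ`, and zero for the empty list. -/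
def applyHead (f : Homog V → A) (ψ : List A → E) : List (Homog V) → E
  | [] => 0
  | z :: ys => ψ (f z :: vals ys)

/-- A multiplication on a brace algebra: an element `m` of degree `2` with `m{m} = 0`, together with
the differential and the product it defines. -/
structure IsMultiplication (brace : A → List A → A) (m : Homog V) (d : A → A)
    (mul : A → A → A) : Prop where
  deg_eq : m.deg = 2
  brace_self : brace m.val [m.val] = 0
  d_eq : ∀ x : Homog V, d x.val = brace m.val [x.val] - x.sdeg.negOnePow • brace x.val [m.val]
  mul_eq : ∀ x y : Homog V, mul x.val y.val = x.deg.negOnePow • brace m.val [x.val, y.val]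

namespace IsMultiplication

variable {brace : A → List A → A} (hV : IsBraceAlgebra V brace) {m : Homog V} {d : A → A}
    {mul : A → A → A} (hm : IsMultiplication brace m d mul)

include hm in
theorem sdeg_eq : m.sdeg = 1 := by
  have := hm.deg_eq
  rw [HomotopyG.deg_eq] at this
  omega

include hV hm

theorem brace_eq_zero (zs : List (Homog V)) (h : 2 < zs.length) : brace m.val (vals zs) = 0 :=
  hV.brace_eq_zero m zs (by rw [hm.deg_eq]; exact_mod_cast h)

theorem brace_singleton_mem (x : Homog V) : brace m.val [x.val] ∈ V (x.deg + 1) := by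
  have := hV.brace_mem m [x]
  rw [hm.deg_eq] at this
  refine (congrArg (fun n => _ ∈ V n) ?_).mpr this
  simp
  ring

theorem singleton_brace_mem (x : Homog V) : brace x.val [m.val] ∈ V (x.deg + 1) := by
  have := hV.brace_mem x [m]
  refine (congrArg (fun n => _ ∈ V n) ?_).mpr this
  simp [hm.deg_eq]
  ring

theorem brace_pair_mem (x y : Homog V) : brace m.val [x.val, y.val] ∈ V (x.deg + y.deg) := by
  have := hV.brace_mem m [x, y]
  rw [hm.deg_eq] at this
  refine (congrArg (fun n => _ ∈ V n) ?_).mpr this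
  simp

theorem d_mem (x : Homog V) : d x.val ∈ V (x.deg + 1) := by
  rw [hm.d_eq]
  exact sub_mem (hm.brace_singleton_mem hV x)
    (zsmul_mem (hm.singleton_brace_mem hV x) (x.sdeg.negOnePow : ℤ))

theorem mul_mem (x y : Homog V) : mul x.val y.val ∈ V (x.deg + y.deg) := by
  rw [hm.mul_eq]
  exact zsmul_mem (hm.brace_pair_mem hV x y) (x.deg.negOnePow : ℤ)

theorem head_d {ψ : List A → E} (hψ : IsMultiadditive V ψ) (y : Homog V) (ys : List (Homog V)) :
    ψ (d y.val :: vals ys) =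
      ψ (brace m.val [y.val] :: vals ys) -
        y.sdeg.negOnePow • ψ (brace y.val [m.val] :: vals ys) := by
  rw [hm.d_eq, hψ.head_sub_smul (hm.brace_singleton_mem hV y) (hm.singleton_brace_mem hV y)]

theorem head_mul {ψ : List A → E} (hψ : IsMultiadditive V ψ) (y z : Homog V)
    (ys : List (Homog V)) :
    ψ (mul y.val z.val :: vals ys) =
      y.deg.negOnePow • ψ (brace m.val [y.val, z.val] :: vals ys) := by
  rw [hm.mul_eq, hψ.head_smul (hm.brace_pair_mem hV y z)]

/-- The terms of a sum over nestings of `m` that begin with a brace of `m`. -/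
theorem nestFront_eq {ψ : List A → E} (hψ : IsMultiadditive V ψ) (s : ℤ) (y : Homog V)
    (ys : List (Homog V)) :
    nestFront hV.homog m (nestSum hV.homog []) s (y :: ys) (fun zs => ψ (vals zs)) =
      s.negOnePow • (ψ (m.val :: y.val :: vals ys) + ψ (brace m.val [y.val] :: vals ys)
        + applyHead (fun z => brace m.val [y.val, z.val]) ψ ys) := by
  rw [nestFront_apply, ← smul_cutSum, hm.sdeg_eq, one_mul]
  congr 1
  simp only [nestSum_nil, cutSum_cons, vals_cons, IsBraceAlgebra.homog_nil_val, add_assoc]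
  congr 1
  cases ys with
  | nil => exact (add_zero _).symm
  | cons z ys =>
    rw [cutSum_cons, cutSum_eq_nil]
    · rfl
    · intro u v q hu
      rw [hV.homog_val, hm.brace_eq_zero hV _ (by simpa [List.length_pos_iff] using hu)]
      exact hψ.head_zero _

/-- Nestings of a sequence in the single element `m`: either `m` comes after `x`, or it goes into
`x`, or it comes before `x`. -/
theorem nestSum_cons_singleton {ψ : List A → E} (x : Homog V) (xs : List (Homog V)) :
    nestSum hV.homog (x :: xs) 0 [m] (fun zs => ψ (vals zs)) =
      nestSum hV.homog xs 0 [m] (fun zs => ψ (x.val :: vals zs)) +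
      (sdegs xs).negOnePow • ψ (brace x.val [m.val] :: vals xs) +
      (x.sdeg + sdegs xs).negOnePow • ψ (m.val :: x.val :: vals xs) := by
  have h1 := nestSum_nil_right hV.homog hV.homog_val hV.brace_nil xs 1
    fun as => ψ (brace x.val [m.val] :: as)
  have h2 := nestSum_nil_right hV.homog hV.homog_val hV.brace_nil (x :: xs) 1
    fun as => ψ (m.val :: as)
  rw [sdegs_cons] at h2
  rw [mul_one] at h1 h2
  rw [nestSum_cons_cons, nestFront_apply, cutSum_cons, cutSum_nil, hm.sdeg_eq, zero_add]
  simp only [vals_cons, IsBraceAlgebra.homog_nil_val, sdegs_cons, sdegs_nil, add_zero, mul_zero,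
    Int.negOnePow_zero, one_smul, hm.sdeg_eq, zero_add]
  rw [h2, ← h1]
  rfl

/-- The sum over all nestings of `m` in `ys`, compared with the sum over all nestings of `ys` in
`m`.  With the braces of `x` as `ψ`, the left hand side is `x{m}{y₁, …, yₙ}` and the last sum is
`x{y₁, …, yₙ}{m}`; this is where the sums over `d yᵢ` and `yᵢ · yᵢ₊₁` in the formula for
`d (x{y₁, …, yₙ})` come from. -/
theorem nestSum_mul (s : ℤ) (ys : List (Homog V)) {ψ : List A → E} (hψ : IsMultiadditive V ψ) :
    nestSum hV.homog [m] s ys (fun zs => ψ (vals zs)) =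
      derSum d s ys ψ - mulSum mul s ys ψ +
        (s + sdegs ys).negOnePow • nestSum hV.homog ys 0 [m] (fun zs => ψ (vals zs)) := by
  induction ys generalizing s ψ with
  | nil =>
    rw [nestSum_nil_right hV.homog hV.homog_val hV.brace_nil]
    simp [derSum, mulSum, nestSum_nil, sdegs, hm.sdeg_eq]
  | cons y ys ih =>
    have hmul : mulSum mul s (y :: ys) ψ = (s + y.sdeg).negOnePow •
        applyHead (fun z => mul y.val z.val) ψ ys +
        mulSum mul (s + y.sdeg) ys fun as => ψ (y.val :: as) := by
      cases ys with
      | nil => simp [mulSum, applyHead]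
      | cons z ys => rfl
    have hmul' : applyHead (fun z => mul y.val z.val) ψ ys =
        - y.sdeg.negOnePow • applyHead (fun z => brace m.val [y.val, z.val]) ψ ys := by
      cases ys with
      | nil => simp [applyHead]
      | cons z ys =>
        simp [applyHead, hm.head_mul hV hψ, HomotopyG.deg_eq, Int.negOnePow_succ]
    rw [nestSum_cons_cons, hm.nestFront_eq hV hψ, hmul, hmul', derSum,
      hm.head_d hV hψ, hm.nestSum_cons_singleton hV, sdegs_cons]
    simp only [vals_cons]
    rw [ih (s + y.sdeg) (hψ.cons y)]
    generalize applyHead (fun z => brace m.val [y.val, z.val]) ψ ys = t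
    simp only [Int.negOnePow_add]
    rcases Int.units_eq_one_or s.negOnePow with h | h <;>
    rcases Int.units_eq_one_or y.sdeg.negOnePow with h' | h' <;>
    rcases Int.units_eq_one_or (sdegs ys).negOnePow with h'' | h'' <;>
    simp only [h, h', h'', one_smul, Units.neg_smul, smul_add, smul_sub, smul_neg, mul_one, mul_neg,
      neg_neg] <;>
    abel

end IsMultiplication
/-! ### The identities of a homotopy G-algebra -/

namespace IsBraceAlgebra

variable {brace : A → List A → A} (hV : IsBraceAlgebra V brace)

include hV

theorem brace_singleton_singleton (x y z : Homog V) :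
    brace (brace x.val [y.val]) [z.val] =
      brace x.val [y.val, z.val] + brace x.val [brace y.val [z.val]] +
        (y.sdeg * z.sdeg).negOnePow • brace x.val [z.val, y.val] := by
  refine (hV.brace_brace_eq x [y] [z]).trans ?_
  simp only [nestSum_cons_cons, nestSum_cons_nil, nestFront_apply, cutSum_cons, cutSum_nil,
    nestSum_nil, mul_zero, Int.negOnePow_zero, one_smul, zero_add, vals_cons,
    hV.homog_val]
  rw [show brace y.val (vals []) = y.val from hV.brace_nil y]
  rfl

end IsBraceAlgebra

namespace IsMultiplication

variable {brace : A → List A → A} (hV : IsBraceAlgebra V brace) {m : Homog V} {d : A → A}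
    {mul : A → A → A} (hm : IsMultiplication brace m d mul)

include hV hm

/-- `m{m}{y₁, …, yₙ} = 0`, expanded by the pre-Jacobi identity. -/
theorem self_brace_self (ys : List (Homog V)) :
    nestSum hV.homog [m] 0 ys (fun zs => brace m.val (vals zs)) = 0 := by
  refine (hV.brace_brace_eq m [m] ys).symm.trans ?_
  rw [vals_cons, vals, List.map_nil, hm.brace_self, hV.zero_brace]

/-- `m{m}{x} = 0` -/
theorem brace_brace_singleton (x : Homog V) :
    brace m.val [brace m.val [x.val]] =
      - brace m.val [m.val, x.val] - x.sdeg.negOnePow • brace m.val [x.val, m.val] := by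
  have := hV.brace_singleton_singleton m m x
  have h0 : brace (brace m.val [m.val]) [x.val] = 0 := by
    rw [hm.brace_self]
    exact hV.zero_brace [x]
  rw [h0, hm.sdeg_eq, one_mul] at this
  rw [← sub_eq_zero]
  refine Eq.trans ?_ this.symm
  abel

/-- The terms of `x{m}{m}` other than `x{m{m}}` cancel, since `|m|` is odd. -/
theorem brace_self_brace_self (x : Homog V) : brace (brace x.val [m.val]) [m.val] = 0 := by
  rw [hV.brace_singleton_singleton, hm.sdeg_eq, hm.brace_self,
    show brace x.val [0] = 0 from (hV.isMultiadditive x).head_zero []]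
  simp

theorem d_d (x : Homog V) : d (d x.val) = 0 := by
  let y : Homog V := ⟨x.deg + 1, d x.val, hm.d_mem hV x⟩
  have hy : y.val = d x.val := rfl
  have hd : y.sdeg = x.sdeg + 1 := by
    simp [y, Homog.sdeg, Homog.deg]
  have h1 : brace m.val [y.val] =
      brace m.val [brace m.val [x.val]] - x.sdeg.negOnePow • brace m.val [brace x.val [m.val]] := by
    rw [hy, hm.d_eq]
    exact (hV.isMultiadditive m).head_sub_smul (hm.brace_singleton_mem hV x)
      (hm.singleton_brace_mem hV x) _ []
  have h2 : brace y.val [m.val] = brace (brace m.val [x.val]) [m.val] -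
      x.sdeg.negOnePow • brace (brace x.val [m.val]) [m.val] := by
    rw [hy, hm.d_eq]
    exact hV.brace_sub_smul_left (hm.brace_singleton_mem hV x) (hm.singleton_brace_mem hV x) _ [m]
  rw [← hy, hm.d_eq, h1, h2, hm.brace_self_brace_self hV, hV.brace_singleton_singleton,
    hm.brace_brace_singleton hV, hd, Int.negOnePow_succ, hm.sdeg_eq, mul_one]
  -- The identity is linear in the braces, with coefficients that depend on the parity of `|x|`.
  rcases Int.units_eq_one_or x.sdeg.negOnePow with h | h <;>
  simp only [h, one_smul, Units.neg_smul, smul_zero, sub_zero, neg_neg] <;>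
  abel

/-- `m{m}{x, y} = 0` -/
theorem brace_brace_pair (x y : Homog V) :
    brace m.val [brace m.val [x.val, y.val]] =
      - brace m.val [brace m.val [x.val], y.val] -
        x.sdeg.negOnePow • brace m.val [x.val, brace m.val [y.val]] := by
  have := hm.self_brace_self hV [x, y]
  have h0 (zs : List (Homog V)) (h : 2 < zs.length) := hm.brace_eq_zero hV zs h
  simp only [nestSum_cons_cons, nestSum_cons_nil, nestFront_apply, cutSum_cons, cutSum_nil,
    nestSum_nil] at this
  rw [h0 [hV.homog m [], x, y] (by simp), h0 [x, hV.homog m [], y] (by simp),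
    h0 [x, y, hV.homog m []] (by simp)] at this
  simp only [mul_zero, Int.negOnePow_zero, one_smul, hm.sdeg_eq, one_mul, zero_add, smul_zero,
    add_zero, vals_cons, hV.homog_val] at this
  rw [← sub_eq_zero, ← this]
  simp only [vals, List.map_nil]
  abel

/-- `m{m}{x, y, z} = 0` -/
theorem brace_brace_triple (x y z : Homog V) :
    brace m.val [brace m.val [x.val, y.val], z.val] =
      - x.sdeg.negOnePow • brace m.val [x.val, brace m.val [y.val, z.val]] := by
  have := hm.self_brace_self hV [x, y, z]
  have h0 (zs : List (Homog V)) (h : 2 < zs.length) := hm.brace_eq_zero hV zs h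
  simp only [nestSum_cons_cons, nestSum_cons_nil, nestFront_apply, cutSum_cons, cutSum_nil,
    nestSum_nil] at this
  rw [h0 [hV.homog m [], x, y, z] (by simp), h0 [hV.homog m [x], y, z] (by simp),
    h0 [x, hV.homog m [], y, z] (by simp), h0 [x, hV.homog m [y], z] (by simp),
    h0 [x, y, hV.homog m [], z] (by simp), h0 [x, y, hV.homog m [z]] (by simp),
    h0 [x, y, z, hV.homog m []] (by simp)] at this
  simp only [vals_cons, hV.homog_val] at this
  rw [show brace m.val (x.val :: y.val :: z.val :: vals []) = 0 from h0 [x, y, z] (by simp),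
    show brace m.val (0 :: vals []) = 0 from (hV.isMultiadditive m).head_zero []] at this
  simp only [mul_zero, Int.negOnePow_zero, one_smul, hm.sdeg_eq, one_mul, zero_add, smul_zero,
    add_zero] at this
  rw [← sub_eq_zero, ← this]
  simp only [vals, List.map_nil, Units.neg_smul]
  abel

theorem mul_assoc (x y z : Homog V) :
    mul (mul x.val y.val) z.val = mul x.val (mul y.val z.val) := by
  let xy : Homog V := ⟨x.deg + y.deg, mul x.val y.val, hm.mul_mem hV x y⟩
  let yz : Homog V := ⟨y.deg + z.deg, mul y.val z.val, hm.mul_mem hV y z⟩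
  have h1 := hm.mul_eq xy z
  have h2 := hm.mul_eq x yz
  have h3 : brace m.val [mul x.val y.val, z.val] =
      x.deg.negOnePow • brace m.val [brace m.val [x.val, y.val], z.val] :=
    hm.head_mul hV (hV.isMultiadditive m) x y [z]
  have h4 : brace m.val [x.val, mul y.val z.val] =
      y.deg.negOnePow • brace m.val [x.val, brace m.val [y.val, z.val]] :=
    hm.head_mul hV ((hV.isMultiadditive m).cons x) y z []
  refine h1.trans (Eq.trans ?_ h2.symm)
  change (x.deg + y.deg).negOnePow • brace m.val [mul x.val y.val, z.val] =
    x.deg.negOnePow • brace m.val [x.val, mul y.val z.val]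
  rw [h3, h4, hm.brace_brace_triple hV, HomotopyG.deg_eq x]
  simp only [Int.negOnePow_add, Int.negOnePow_one]
  rcases Int.units_eq_one_or x.sdeg.negOnePow with h | h <;>
  rcases Int.units_eq_one_or y.deg.negOnePow with h' | h' <;>
  simp [h, h']

theorem d_mul (x y : Homog V) :
    d (mul x.val y.val) = mul (d x.val) y.val + x.deg.negOnePow • mul x.val (d y.val) := by
  let xy : Homog V := ⟨x.deg + y.deg, mul x.val y.val, hm.mul_mem hV x y⟩
  let dx : Homog V := ⟨x.deg + 1, d x.val, hm.d_mem hV x⟩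
  let dy : Homog V := ⟨y.deg + 1, d y.val, hm.d_mem hV y⟩
  have hxy : xy.sdeg = x.sdeg + y.sdeg + 1 := by
    simp only [xy, Homog.sdeg, Homog.deg]
    ring
  have h1 : d (mul x.val y.val) = brace m.val [mul x.val y.val] -
      (x.sdeg + y.sdeg + 1).negOnePow • brace (mul x.val y.val) [m.val] := by
    rw [← hxy]
    exact hm.d_eq xy
  have h2 : brace m.val [mul x.val y.val] =
      x.deg.negOnePow • brace m.val [brace m.val [x.val, y.val]] :=
    hm.head_mul hV (hV.isMultiadditive m) x y []
  have h3 : brace (mul x.val y.val) [m.val] = x.deg.negOnePow •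
      (brace m.val [x.val, brace y.val [m.val]] +
        y.sdeg.negOnePow • brace m.val [brace x.val [m.val], y.val]) := by
    rw [hm.mul_eq]
    refine (hV.brace_smul_left (hm.brace_pair_mem hV x y) _ [m]).trans
      (congrArg _ ((hV.brace_brace_eq m [x, y] [m]).trans ?_))
    have h0 (zs : List (Homog V)) (h : 2 < zs.length) := hm.brace_eq_zero hV zs h
    rw [hm.nestSum_cons_singleton hV]
    have h4 := hm.nestSum_cons_singleton hV (ψ := fun as => brace m.val (x.val :: as)) y []
    rw [show nestSum hV.homog [y] 0 [m] (fun zs => brace m.val (x.val :: vals zs)) = _ from h4,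
      show brace m.val (m.val :: x.val :: vals [y]) = 0 from h0 [m, x, y] (by simp),
      show brace m.val (x.val :: m.val :: y.val :: vals []) = 0 from h0 [x, m, y] (by simp),
      nestSum_nil, show brace m.val (x.val :: y.val :: vals [m]) = 0 from h0 [x, y, m] (by simp)]
    simp [sdegs, vals]
  have h4 : mul (d x.val) y.val = (x.deg + 1).negOnePow •
    (brace m.val [brace m.val [x.val], y.val] -
      x.sdeg.negOnePow • brace m.val [brace x.val [m.val], y.val]) := by
    refine (hm.mul_eq dx y).trans (congrArg _ ?_)
    exact hm.head_d hV (hV.isMultiadditive m) x [y]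
  have h5 : mul x.val (d y.val) = x.deg.negOnePow • (brace m.val [x.val, brace m.val [y.val]] -
      y.sdeg.negOnePow • brace m.val [x.val, brace y.val [m.val]]) := by
    refine (hm.mul_eq x dy).trans (congrArg _ ?_)
    exact hm.head_d hV ((hV.isMultiadditive m).cons x) y []
  rw [h1, h2, h3, h4, h5, hm.brace_brace_pair hV, HomotopyG.deg_eq x]
  simp only [Int.negOnePow_add, Int.negOnePow_one]
  rcases Int.units_eq_one_or x.sdeg.negOnePow with h | h <;>
  rcases Int.units_eq_one_or y.sdeg.negOnePow with h' | h' <;>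
  simp only [h, h', one_smul, Units.neg_smul, mul_one, mul_neg, neg_neg, smul_add, smul_sub,
    smul_neg] <;>
  abel

theorem mul_brace (x₁ x₂ : Homog V) (ys : List (Homog V)) :
    brace (mul x₁.val x₂.val) (vals ys) =
      cutSum ys fun u v _ => ((x₂.sdeg + 1) * sdegs u).negOnePow •
        mul (brace x₁.val (vals u)) (brace x₂.val (vals v)) := by
  have h0 (zs : List (Homog V)) (h : 2 < zs.length) := hm.brace_eq_zero hV zs h
  have h1 : brace (brace m.val [x₁.val, x₂.val]) (vals ys) = _ := hV.brace_brace_eq m [x₁, x₂] ys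
  rw [hm.mul_eq, hV.brace_smul_left (hm.brace_pair_mem hV x₁ x₂), h1,
    nestSum_cons_eq_nestFront _ _ _ _ _ _ h0, nestFront_apply, smul_cutSum]
  refine cutSum_congr ys fun u v q => ?_
  have h2 := hm.mul_eq (hV.homog x₁ u) (hV.homog x₂ v)
  rw [hV.homog_val, hV.homog_val] at h2
  rw [nestSum_singleton hV.homog x₂ _ v (fun zs => brace m.val (vals (hV.homog x₁ u :: zs)))
      fun zs h => h0 (hV.homog x₁ u :: zs) (Nat.succ_lt_succ h), h2, smul_smul, smul_smul,
    smul_smul, vals_cons, vals_cons, hV.homog_val, hV.homog_val, HomotopyG.deg_eq,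
    HomotopyG.deg_eq, hV.homog_sdeg]
  refine congrArg₂ (· • ·) ?_ rfl
  rw [← Int.negOnePow_add, ← Int.negOnePow_add, ← Int.negOnePow_add, Int.negOnePow_eq_iff]
  refine ⟨- sdegs u, ?_⟩
  ring

/-- The pre-Jacobi identity for `m{x}{y₁, …, yₙ}`.  As `m` has two inputs, at most one of the `y`s
can be left outside `x`, which then is the last or the first one. -/
theorem brace_singleton_brace (x : Homog V) {ys zs us : List (Homog V)} {y z : Homog V}
    (h₁ : ys = y :: zs) (h₂ : ys = us ++ [z]) :
    brace (brace m.val [x.val]) (vals ys) =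
      brace m.val [brace x.val (vals us), z.val] + brace m.val [brace x.val (vals ys)] +
        (x.sdeg * y.sdeg).negOnePow • brace m.val [y.val, brace x.val (vals zs)] := by
  have h0 (zs : List (Homog V)) (h : 2 < zs.length) := hm.brace_eq_zero hV zs h
  refine (hV.brace_brace_eq m [x] ys).trans ?_
  have h3 : nestFront hV.homog x (nestSum hV.homog []) 0 ys (fun zs => brace m.val (vals zs)) =
      brace m.val [brace x.val (vals us), z.val] + brace m.val [brace x.val (vals ys)] := by
    rw [nestFront_apply, h₂]
    simp only [nestSum_nil, mul_zero, Int.negOnePow_zero, one_smul]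
    rw [cutSum_append_singleton us z fun u v => brace m.val (vals (hV.homog x u :: v))]
    · rfl
    · exact fun u v hv => h0 _ (Nat.succ_lt_succ hv)
  rw [← h3, h₁, nestSum_cons_cons]
  congr 1
  rw [nestSum_singleton hV.homog x _ zs (fun zs => brace m.val (vals (y :: zs)))
    fun zs h => h0 (y :: zs) (Nat.succ_lt_succ h), zero_add]
  rfl

theorem d_brace (x : Homog V) {ys zs us : List (Homog V)} {y z : Homog V}
    (h₁ : ys = y :: zs) (h₂ : ys = us ++ [z]) :
    d (brace x.val (vals ys)) - brace (d x.val) (vals ys) -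
        x.sdeg.negOnePow • derSum d 0 ys (brace x.val) =
      ((x.sdeg + 1) * y.sdeg).negOnePow • mul y.val (brace x.val (vals zs)) -
        x.sdeg.negOnePow • mulSum mul 0 ys (brace x.val) +
        (x.sdeg + sdegs us).negOnePow • mul (brace x.val (vals us)) z.val := by
  have e1 := hm.d_eq (hV.homog x ys)
  have e2 : brace (brace x.val (vals ys)) [m.val] = _ := hV.brace_brace_eq x ys [m]
  have e3 : brace (brace x.val [m.val]) (vals ys) = _ := hV.brace_brace_eq x [m] ys
  have e4 := hm.nestSum_mul hV 0 ys (hV.isMultiadditive x)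
  have e5 := hm.mul_eq y (hV.homog x zs)
  have e6 := hm.mul_eq (hV.homog x us) z
  rw [hV.homog_val, hV.homog_sdeg, e2] at e1
  rw [hV.homog_val] at e5
  rw [hV.homog_val, HomotopyG.deg_eq, hV.homog_sdeg] at e6
  rw [e1, hm.d_eq, hV.brace_sub_smul_left (hm.brace_singleton_mem hV x)
    (hm.singleton_brace_mem hV x), hm.brace_singleton_brace hV x h₁ h₂, e3, e4, e5, e6, zero_add,
    smul_smul, smul_smul, HomotopyG.deg_eq y]
  have s1 : ((x.sdeg + 1) * y.sdeg).negOnePow * (y.sdeg + 1).negOnePow =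
      - (x.sdeg * y.sdeg).negOnePow := by
    rw [← Int.negOnePow_succ, ← Int.negOnePow_add, Int.negOnePow_eq_iff]
    exact ⟨y.sdeg, by ring⟩
  have s2 : (x.sdeg + sdegs us).negOnePow * (x.sdeg + sdegs us + 1).negOnePow = -1 := by
    rw [Int.negOnePow_succ, mul_neg, ← sq, Int.units_sq]
  rw [s1, s2]
  simp only [Int.negOnePow_add]
  rcases Int.units_eq_one_or x.sdeg.negOnePow with h | h <;>
  rcases Int.units_eq_one_or (sdegs ys).negOnePow with h' | h' <;>
  simp only [h, h', one_smul, Units.neg_smul, mul_one, mul_neg, neg_neg, smul_add, smul_sub,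
    smul_neg] <;>
  abel

omit hV hm in
theorem derSum_ofFn {n : ℕ} (s : ℤ) (y : Fin n → Homog V) (ψ : List A → E) :
    derSum d s (List.ofFn y) ψ = ∑ i : Fin n, (s + sdegs ((List.ofFn y).take i)).negOnePow •
      ψ (vals ((List.ofFn y).take i) ++ d (y i).val :: vals ((List.ofFn y).drop (i + 1))) := by
  induction n generalizing s ψ with
  | zero => simp [derSum]
  | succ n ih =>
    rw [Fin.sum_univ_succ, List.ofFn_succ, derSum, ih]
    congr 1
    · simp [sdegs_nil, vals]
    · refine Finset.sum_congr rfl fun i _ => ?_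
      simp only [Fin.val_succ, List.take_succ_cons, sdegs_cons, add_assoc]
      rfl

omit hV hm in
theorem mulSum_ofFn {n : ℕ} (s : ℤ) (y : Fin (n + 1) → Homog V) (ψ : List A → E) :
    mulSum mul s (List.ofFn y) ψ = ∑ i : Fin n,
      (s + sdegs ((List.ofFn y).take (i + 1))).negOnePow •
        ψ (vals ((List.ofFn y).take i) ++
          mul (y i.castSucc).val (y i.succ).val :: vals ((List.ofFn y).drop (i + 2))) := by
  induction n generalizing s ψ with
  | zero => simp [mulSum]
  | succ n ih =>
    have h := ih (s + (y 0).sdeg) (fun i => y i.succ) fun as => ψ ((y 0).val :: as)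
    rw [List.ofFn_succ] at h
    rw [Fin.sum_univ_succ, List.ofFn_succ, List.ofFn_succ, mulSum, h]
    congr 1
    · simp [sdegs, vals]
    · refine Finset.sum_congr rfl fun i _ => ?_
      simp only [Fin.val_succ, List.take_succ_cons, List.drop_succ_cons, sdegs_cons, add_assoc,
        Fin.castSucc_succ]
      rfl

/-- A brace algebra with a multiplication is a homotopy G-algebra. -/
theorem isHomotopyGAlgebra (hind : iSupIndep V) : IsHomotopyGAlgebra V d mul brace where
  indep := hind
  d_mem := hm.d_mem hV
  d_add n x y := by
    have h1 := hm.d_eq ⟨n, x⟩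
    have h2 := hm.d_eq ⟨n, y⟩
    have h3 := hm.d_eq ⟨n, x + y⟩
    have h4 := hV.isMultiadditive m [] n x y []
    have h5 := hV.brace_add_left n x y [m]
    change d (x : A) = brace m.val [(x : A)] - (n - 1).negOnePow • brace (x : A) [m.val] at h1
    change d (y : A) = brace m.val [(y : A)] - (n - 1).negOnePow • brace (y : A) [m.val] at h2
    change d (x + y : A) = brace m.val [(x + y : A)] -
      (n - 1).negOnePow • brace (x + y : A) [m.val] at h3
    change brace m.val [(x + y : A)] = brace m.val [(x : A)] + brace m.val [(y : A)] at h4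
    change brace (x + y : A) [m.val] = brace (x : A) [m.val] + brace (y : A) [m.val] at h5
    rw [h1, h2, h3, h4, h5, smul_add]
    abel
  d_d := hm.d_d hV
  mul_mem := hm.mul_mem hV
  add_mul n x y z := by
    have h1 := hm.mul_eq ⟨n, x⟩ z
    have h2 := hm.mul_eq ⟨n, y⟩ z
    have h3 := hm.mul_eq ⟨n, x + y⟩ z
    have h4 := hV.isMultiadditive m [] n x y [z]
    refine h3.trans ((congrArg _ h4).trans ?_)
    rw [smul_add]
    exact (congrArg₂ (· + ·) h1 h2).symm
  mul_add x n y z := by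
    have h1 := hm.mul_eq x ⟨n, y⟩
    have h2 := hm.mul_eq x ⟨n, z⟩
    have h3 := hm.mul_eq x ⟨n, y + z⟩
    have h4 := hV.isMultiadditive m [x] n y z []
    refine h3.trans ((congrArg _ h4).trans ?_)
    rw [smul_add]
    exact (congrArg₂ (· + ·) h1 h2).symm
  mul_assoc := hm.mul_assoc hV
  d_mul := hm.d_mul hV
  brace_mem := hV.brace_mem
  brace_add_left := hV.brace_add_left
  brace_add_right := hV.brace_add_right
  brace_nil := hV.brace_nil
  brace_brace := hV.brace_brace
  mul_brace x₁ x₂ ys := by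
    rw [hm.mul_brace hV, ← sum_take_drop_eq_cutSum ys fun u v =>
      ((x₂.sdeg + 1) * sdegs u).negOnePow • mul (brace x₁.val (vals u)) (brace x₂.val (vals v))]
    rfl
  d_brace x n y := by
    have h := hm.d_brace hV x (ys := List.ofFn y) (y := y 0) (zs := (List.ofFn y).drop 1)
      (us := (List.ofFn y).take n) (z := y (Fin.last n)) (by simp [List.ofFn_succ]) (by
        conv_lhs => rw [List.ofFn_succ', List.concat_eq_append]
        congr 1
        refine (List.ext_getElem ?_ fun i h₁ h₂ => ?_).symm <;> simp [-List.ofFn_succ])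
    rw [derSum_ofFn, mulSum_ofFn] at h
    simpa only [zero_add] using h

end IsMultiplication
end HomotopyG

namespace MonoidalHochschild

universe w

open HomotopyG

/-! ### The brace algebra of cochains -/

section Brace

variable {C : Type u₁} [Category.{v₁} C] [MonoidalCategory C]
  {D : Type u₂} [Category.{v₂} D] [MonoidalCategory D] {F : C ⥤ D}
  {E : Type w} [AddCommGroup E] [Preadditive D]

theorem iSupIndep_cochains (F : C ⥤ D) : iSupIndep (cochains F) := by
  intro n
  rw [AddSubgroup.disjoint_def]
  intro c hc hc'
  let W : AddSubgroup (Family F) :=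
    { carrier := {c | ∀ l : List C, (l.length : ℤ) = n → c l = 0}
      add_mem' := fun {a b} ha hb l hl => by simp [ha l hl, hb l hl]
      zero_mem' := fun l _ => rfl
      neg_mem' := fun {a} ha l hl => by simp [ha l hl] }
  have hW : ⨆ (j : ℤ) (_ : j ≠ n), cochains F j ≤ W :=
    iSup₂_le fun j hj c hc l hl => hc.2 l fun h => hj (h.symm.trans hl)
  funext l
  by_cases hl : (l.length : ℤ) = n
  · exact hW hc' l hl
  · exact hc.2 l hl

/-- Each inserted cochain becomes one of the new inputs. -/
theorem insSum_eq_zero_of_length_le (ys : List (Homog (cochains F))) (a : ℤ) (l : List C)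
    (h : Functional F l E) (H : ∀ o f c, ys.length ≤ o.length → h o f c = 0) :
    insSum ys a l h = 0 := by
  induction ys generalizing a l with
  | nil => exact H _ _ _ (Nat.zero_le _)
  | cons y ys ih =>
    have key (a : ℤ) (l : List C) (h : Functional F l E)
        (H : ∀ o f c, (y :: ys).length ≤ o.length → h o f c = 0) :
        plugSum y.sdeg y.val (insSum ys) a l h = 0 := by
      rw [plugSum_apply]
      refine (cutSum_congr l fun u v q => ?_).trans (map_zero _)
      rw [ih _ v (h.plug (y.val u) q) fun o f c ho => H (_ :: o) _ _ (Nat.succ_le_succ ho),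
        smul_zero]
      rfl
    induction l generalizing a with
    | nil => exact key _ _ _ H
    | cons x l ih' =>
      rw [insSum_cons_cons, key _ _ _ H, zero_add]
      exact ih' _ _ fun o f c ho => H _ _ _ (ho.trans (Nat.le_succ _))

theorem insSum_cons_eq_plugSum (y : Homog (cochains F)) (ys : List (Homog (cochains F))) (a : ℤ)
    (l : List C) (h : Functional F l E)
    (H : ∀ o f c, ys.length + 1 < o.length → h o f c = 0) :
    insSum (y :: ys) a l h = plugSum y.sdeg y.val (insSum ys) a l h := by
  cases l with
  | nil => rfl
  | cons x l =>
    rw [insSum_cons_cons, insSum_eq_zero_of_length_le (y :: ys) _ l h.keep fun o f c ho =>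
      H (_ :: o) _ _ (Nat.succ_lt_succ ho), add_zero]

theorem insSum_singleton (y : Homog (cochains F)) (a : ℤ)
    (l : List C) (h : Functional F l E) (H : ∀ o f c, 1 < o.length → h o f c = 0) :
    insSum [y] a l h =
      (y.sdeg * a).negOnePow • h.plug (y.val l) (Cut.full l) [] (𝟙 _) (𝟙 _) := by
  rw [insSum_cons_eq_plugSum y [] a l h H, plugSum_apply, cutSum_eq_full]
  · rfl
  · intro u v q hv
    rw [insSum_nil, Functional.plug, H (_ :: v) _ _ (Nat.succ_lt_succ (List.length_pos_iff.mpr hv)),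
      smul_zero]

variable [MonoidalPreadditive D]

theorem insSum_append_add (as : List (Homog (cochains F))) (n : ℤ) (y z : cochains F n)
    (bs : List (Homog (cochains F))) (a : ℤ) (l : List C) (h : Functional F l E) (hh : h.IsGood) :
    insSum (as ++ ⟨n, y + z⟩ :: bs) a l h =
      insSum (as ++ ⟨n, y⟩ :: bs) a l h + insSum (as ++ ⟨n, z⟩ :: bs) a l h := by
  induction as generalizing a l with
  | nil =>
    have key (a : ℤ) (l : List C) (h : Functional F l E) (hh : h.IsGood) :
        plugSum (n - 1) ((y : Family F) + (z : Family F)) (insSum bs) a l h =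
          plugSum (n - 1) (y : Family F) (insSum bs) a l h +
            plugSum (n - 1) (z : Family F) (insSum bs) a l h := by
      rw [plugSum_apply, plugSum_apply, plugSum_apply, ← cutSum_add]
      refine cutSum_congr l fun u v q => ?_
      rw [← smul_add, ← map_add, ← hh.plug_add]
      rfl
    induction l generalizing a with
    | nil => exact key a [] h hh
    | cons x l ih =>
      refine (congrArg₂ (· + ·) (key a (x :: l) h hh) (ih (a + 1) h.keep hh.keep)).trans ?_
      exact add_add_add_comm _ _ _ _
  | cons b as ih =>
    have key (a : ℤ) (l : List C) (h : Functional F l E) (hh : h.IsGood) :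
        plugSum b.sdeg b.val (insSum (as ++ ⟨n, y + z⟩ :: bs)) a l h =
          plugSum b.sdeg b.val (insSum (as ++ ⟨n, y⟩ :: bs)) a l h +
            plugSum b.sdeg b.val (insSum (as ++ ⟨n, z⟩ :: bs)) a l h := by
      rw [plugSum_apply, plugSum_apply, plugSum_apply, ← cutSum_add]
      refine cutSum_congr l fun u v q => ?_
      rw [← smul_add, ← ih _ _ _ (hh.plug _ q)]
    induction l generalizing a with
    | nil => exact key a [] h hh
    | cons x l ih' =>
      refine (congrArg₂ (· + ·) (key a (x :: l) h hh) (ih' (a + 1) h.keep hh.keep)).trans ?_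
      exact add_add_add_comm _ _ _ _

theorem isBraceAlgebra_cochains (F : C ⥤ D) : IsBraceAlgebra (cochains F) (substitution F) where
  brace_mem := substitution_mem
  brace_add_left n x y zs := by
    funext l
    refine (substitution_vals _ zs l).trans (Eq.trans ?_ (congrArg₂ (· + ·)
      (substitution_vals _ zs l) (substitution_vals _ zs l)).symm)
    rw [← map_add]
    congr 1
    funext o f c
    simp [evalFunctional]
  brace_add_right x as n y z bs := by
    have h (w : cochains F n) : vals as ++ (w : Family F) :: vals bs =
        vals (as ++ (⟨n, w⟩ : Homog (cochains F)) :: bs) := by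
      simp [vals, Homog.val]
    funext l
    rw [← AddSubgroup.coe_add, h, h, h, Pi.add_apply, substitution_vals, substitution_vals,
      substitution_vals]
    exact insSum_append_add as n y z bs 0 l _ (isGood_evalFunctional (isNatural_val x) l)
  brace_nil x := by
    funext l
    refine (substitution_vals x.val [] l).trans ?_
    simp [insSum_nil, evalFunctional]
  brace_brace := substitution_substitution
  brace_eq_zero x xs hx := by
    funext l
    rw [substitution_vals]
    refine insSum_eq_zero_of_length_le xs 0 l _ fun o f c ho => ?_
    rw [evalFunctional, val_apply_eq_zero x o (by omega), Limits.zero_comp, Limits.comp_zero]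

end Brace

/-! ### The multiplication given by the lax monoidal structure -/

section Multiplication

variable {C : Type u₁} [Category.{v₁} C] [MonoidalCategory C]
  {D : Type u₂} [Category.{v₂} D] [MonoidalCategory D] {F : C ⥤ D}
  {E : Type w} [AddCommGroup E]

omit [MonoidalCategory C] in
theorem split_full (G : C ⥤ D) (l : List C) :
    (Cut.full l).split G = (ρ_ (tensorList G l)).symm := by
  induction l with
  | nil =>
    ext
    exact unitors_inv_equal
  | cons x l ih =>
    ext
    simp [Cut.full, Cut.split, ih, tensorList]

/-- `μ (s ⊗ t)` for two morphisms `s` and `t` on the parts of a cut. -/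
def mulHom [F.LaxMonoidal] {l u v : List C} (q : Cut l u v)
    (s : tensorList F u ⟶ F.obj (tensorList (𝟭 C) u))
    (t : tensorList F v ⟶ F.obj (tensorList (𝟭 C) v)) :
    tensorList F l ⟶ F.obj (tensorList (𝟭 C) l) :=
  (q.split F).hom ≫ (s ⊗ₘ t) ≫ Functor.LaxMonoidal.μ F _ _ ≫ F.map (q.split (𝟭 C)).inv

theorem juxtapose_eq [F.LaxMonoidal] (c c' : Family F) (k : ℕ) (l : List C) :
    juxtapose F c c' k l = mulHom (Cut.at k l) (c _) (c' _) := by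
  simp only [juxtapose, mulHom, splitIso_eq]

variable [Preadditive D]

theorem identityCochain_of_length_ne {l : List C} (hl : l.length ≠ 1) :
    identityCochain F l = 0 := by
  match l, hl with
  | [], _ => rfl
  | [x], hl => exact absurd rfl hl
  | _ :: _ :: _, _ => rfl

/-- Up to the canonical isomorphism `x ⊗ 𝟙 ≅ x`, keeping an input amounts to replacing it by its
image under the identity cochain. -/
theorem Functional.IsGood.keep_eq_plug {x : C} {l : List C} {h : Functional F (x :: l) E}
    (hh : h.IsGood) : h.keep = h.plug (identityCochain F [x]) (.cons x (.nil l)) := by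
  funext o f c
  let φ : ListHom (x :: o) (tensorList (𝟭 C) [x] :: o) := .cons (ρ_ x).inv (ListHom.id o)
  have h1 : keepHom F x f ≫ tensorListMap F φ =
      plugHom (.cons x (.nil l)) (identityCochain F [x]) f := by
    simp [φ, keepHom, plugHom, tensorListMap, tensorListMap_id, identityCochain, Cut.split,
      tensorList]
    rw [MonoidalCategory.tensorHom_def]
    simp [whisker_exchange]
  have h2 : tensorListMap (𝟭 C) φ ≫ plugCoh (.cons x (.nil l)) c = keepHom (𝟭 C) x c := by
    simp [φ, keepHom, plugCoh, tensorListMap, tensorListMap_id, Cut.split,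
      tensorList]
  have := hh.map_comp φ (keepHom F x f) (plugCoh (.cons x (.nil l)) c)
  rw [h1, h2] at this
  exact this.symm

variable [F.LaxMonoidal]

variable (F) in
/-- The transformation `μ : F x ⊗ F y ⟶ F (x ⊗ y)`, as a `2`-cochain. -/
def muCochain : Family F
  | [x, y] => F.obj x ◁ (ρ_ (F.obj y)).hom ≫ Functor.LaxMonoidal.μ F x y ≫ F.map (x ◁ (ρ_ y).inv)
  | _ => 0

theorem muCochain_of_length_ne {l : List C} (hl : l.length ≠ 2) : muCochain F l = 0 := by
  match l, hl with
  | [], _ => rfl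
  | [x], _ => rfl
  | [_, _], hl => exact absurd rfl hl
  | _ :: _ :: _ :: _, _ => rfl

theorem isNatural_muCochain : IsNatural F (muCochain F) := by
  intro l m φ
  cases φ with
  | nil => simp [muCochain]
  | cons f φ =>
    cases φ with
    | nil => simp [muCochain]
    | cons g φ =>
      cases φ with
      | nil =>
        rename_i x x' y y'
        have h1 : F.obj x ◁ (ρ_ (F.obj y)).hom ≫ (F.map f ⊗ₘ F.map g) =
            (F.map f ⊗ₘ (F.map g ⊗ₘ 𝟙 (𝟙_ D))) ≫ F.obj x' ◁ (ρ_ (F.obj y')).hom :=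
          whiskerLeft_comp_tensorHom_of_comp_eq _ (by simp)
        have h2 : x ◁ (ρ_ y).inv ≫ (f ⊗ₘ (g ⊗ₘ 𝟙 (𝟙_ C))) = (f ⊗ₘ g) ≫ x' ◁ (ρ_ y').inv :=
          whiskerLeft_comp_tensorHom_of_comp_eq _ (by simp)
        change (F.map f ⊗ₘ (F.map g ⊗ₘ 𝟙 (𝟙_ D))) ≫ F.obj x' ◁ (ρ_ (F.obj y')).hom ≫
            Functor.LaxMonoidal.μ F x' y' ≫ F.map (x' ◁ (ρ_ y').inv) =
          (F.obj x ◁ (ρ_ (F.obj y)).hom ≫ Functor.LaxMonoidal.μ F x y ≫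
            F.map (x ◁ (ρ_ y).inv)) ≫ F.map (f ⊗ₘ (g ⊗ₘ 𝟙 (𝟙_ C)))
        simp only [Category.assoc, ← F.map_comp]
        rw [← reassoc_of% h1, h2, Functor.LaxMonoidal.μ_natural_assoc, F.map_comp]
      | cons k φ => simp [muCochain]

variable (F) in
/-- `μ` as a homogeneous cochain. -/
def muHomog : Homog (cochains F) :=
  ⟨2, muCochain F, isNatural_muCochain, fun _ hl =>
    muCochain_of_length_ne fun h => hl (by exact_mod_cast h)⟩

theorem mulHom_zero_left [MonoidalPreadditive D] {l u v : List C} (q : Cut l u v)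
    (t : tensorList F v ⟶ F.obj (tensorList (𝟭 C) v)) : mulHom q 0 t = 0 := by
  simp [mulHom]

theorem mulHom_zero_right [MonoidalPreadditive D] {l u v : List C} (q : Cut l u v)
    (s : tensorList F u ⟶ F.obj (tensorList (𝟭 C) u)) : mulHom q s 0 = 0 := by
  simp [mulHom]

theorem evalFunctional_muCochain_of_length_ne (l : List C) (o : List C)
    (f : tensorList F l ⟶ tensorList F o) (c : tensorList (𝟭 C) o ⟶ tensorList (𝟭 C) l)
    (ho : o.length ≠ 2) : evalFunctional F (muCochain F) l o f c = 0 := by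
  rw [evalFunctional, muCochain_of_length_ne ho, Limits.zero_comp, Limits.comp_zero]

/-- The two inputs of `μ` may be replaced by values of cochains. -/
theorem evalFunctional_muCochain_plug_plug {l u v : List C} (q : Cut l u v)
    (s : tensorList F u ⟶ F.obj (tensorList (𝟭 C) u))
    (t : tensorList F v ⟶ F.obj (tensorList (𝟭 C) v)) :
    (((evalFunctional F (muCochain F) l).plug s q).plug t (Cut.full v)) [] (𝟙 _) (𝟙 _) =
      mulHom q s t := by
  have h1 : (s ⊗ₘ ((ρ_ (tensorList F v)).inv ≫ (t ⊗ₘ 𝟙 (𝟙_ D)))) ≫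
      F.obj (tensorList (𝟭 C) u) ◁ (ρ_ (F.obj (tensorList (𝟭 C) v))).hom = s ⊗ₘ t := by
    rw [← id_tensorHom, MonoidalCategory.tensorHom_comp_tensorHom]
    simp
  have h2 : tensorList (𝟭 C) u ◁ (ρ_ (tensorList (𝟭 C) v)).inv ≫
      (tensorList (𝟭 C) u ◁ (tensorList (𝟭 C) v ◁ 𝟙 (𝟙_ C) ≫ (ρ_ (tensorList (𝟭 C) v)).hom) ≫
        (q.split (𝟭 C)).inv) = (q.split (𝟭 C)).inv := by
    simp
  simp only [Functional.plug, evalFunctional, plugHom, plugCoh, mulHom, split_full, muCochain]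
  change ((q.split F).hom ≫ (s ⊗ₘ ((ρ_ (tensorList F v)).inv ≫ (t ⊗ₘ 𝟙 (𝟙_ D))))) ≫
    (F.obj (tensorList (𝟭 C) u) ◁ (ρ_ (F.obj (tensorList (𝟭 C) v))).hom ≫
      Functor.LaxMonoidal.μ F _ _ ≫ F.map (tensorList (𝟭 C) u ◁ (ρ_ (tensorList (𝟭 C) v)).inv)) ≫
      F.map (tensorList (𝟭 C) u ◁ (tensorList (𝟭 C) v ◁ 𝟙 (𝟙_ C) ≫
        (ρ_ (tensorList (𝟭 C) v)).hom) ≫ (q.split (𝟭 C)).inv) = _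
  simp only [Category.assoc, ← F.map_comp]
  rw [reassoc_of% h1, h2]

end Multiplication

/-! ### The differential and the product in terms of braces -/

section Coherence

variable {D : Type u₂} [Category.{v₂} D] [MonoidalCategory D]

theorem inv_associator_whiskerRight {X Y L Z : D} (g : X ⊗ Y ⟶ Z) :
    (α_ X Y L).inv ≫ g ▷ L =
      (whiskerLeftIso X (whiskerLeftIso Y (λ_ L).symm ≪≫ (α_ Y (𝟙_ D) L).symm) ≪≫
        (α_ X (Y ⊗ 𝟙_ D) L).symm).hom ≫ (X ◁ (ρ_ Y).hom ≫ g) ▷ L := by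
  simp only [Iso.trans_hom, whiskerLeftIso_hom, Iso.symm_hom]
  monoidal

theorem whiskerRight_inv_associator (X Y L : D) :
    (X ◁ (ρ_ Y).inv) ▷ L ≫
      (whiskerLeftIso X (whiskerLeftIso Y (λ_ L).symm ≪≫ (α_ Y (𝟙_ D) L).symm) ≪≫
        (α_ X (Y ⊗ 𝟙_ D) L).symm).inv = (α_ X Y L).hom := by
  simp only [Iso.trans_inv, whiskerLeftIso_inv, Iso.symm_inv]
  monoidal

end Coherence

section Operations

variable {C : Type u₁} [Category.{v₁} C] [MonoidalCategory C]
  {D : Type u₂} [Category.{v₂} D] [MonoidalCategory D] {F : C ⥤ D} [F.LaxMonoidal]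
  {E : Type w} [AddCommGroup E] [Preadditive D]

theorem muHomog_sdeg : (muHomog F).sdeg = 1 := rfl

theorem insSum_pair_muCochain (x y : Homog (cochains F)) (l : List C) :
    insSum [x, y] 0 l (evalFunctional F (muCochain F) l) =
      cutSum l fun u v q => (y.sdeg * u.length).negOnePow • mulHom q (x.val u) (y.val v) := by
  rw [insSum_cons_eq_plugSum x [y] 0 l _ fun o f c ho =>
    evalFunctional_muCochain_of_length_ne l o f c (Nat.ne_of_gt ho), plugSum_apply]
  refine cutSum_congr l fun u v q => ?_
  rw [insSum_singleton y _ v ((evalFunctional F (muCochain F) l).plug (x.val u) q) fun o f c ho =>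
    evalFunctional_muCochain_of_length_ne l (_ :: o) _ _ (Nat.ne_of_gt (Nat.succ_lt_succ ho)),
    evalFunctional_muCochain_plug_plug, mul_zero, Int.negOnePow_zero, one_smul, zero_add]

omit [Preadditive D] in
theorem merge_outer_length (i : ℕ) (x : C) (xs : List C) (hi : i < xs.length) :
    (Regrouping.merge F i (x :: xs)).outer.length = xs.length := by
  induction i generalizing x xs with
  | zero =>
    cases xs with
    | nil => exact absurd hi (Nat.not_lt_zero _)
    | cons y xs => rfl
  | succ i ih =>
    cases xs with
    | nil => exact absurd hi (Nat.not_lt_zero _)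
    | cons y xs => exact congrArg Nat.succ (ih y xs (Nat.lt_of_succ_lt_succ hi))

/-- `plug` gives an input in `F (x ⊗ (y ⊗ 𝟙))` and `merge` one in `F (x ⊗ y)`; the values agree as
`h` does not see the canonical isomorphism between these. -/
theorem plug_muCochain_eq_merge {x y : C} {l : List C}
    {h : Functional F (x :: y :: l) E} (hh : h.IsGood) :
    h.plug (muCochain F [x, y]) (.cons x (.cons y (.nil l))) l (𝟙 _) (𝟙 _) =
      h _ (Regrouping.merge F 0 (x :: y :: l)).hom (Regrouping.merge F 0 (x :: y :: l)).coh := by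
  let φ : ListHom ((x ⊗ y) :: l) (tensorList (𝟭 C) [x, y] :: l) :=
    .cons (x ◁ (ρ_ y).inv) (ListHom.id l)
  let f : tensorList F (x :: y :: l) ⟶ tensorList F ((x ⊗ y) :: l) :=
    (Regrouping.merge F 0 (x :: y :: l)).hom
  have h1 : f ≫ tensorListMap F φ =
      plugHom (.cons x (.cons y (.nil l))) (muCochain F [x, y]) (𝟙 _) := by
    have := inv_associator_whiskerRight (L := tensorList F l)
      (Functor.LaxMonoidal.μ F x y ≫ F.map (x ◁ (ρ_ y).inv))
    rw [comp_whiskerRight, ← Category.assoc] at this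
    refine Eq.trans ?_ (this.trans ?_)
    · exact congrArg (f ≫ ·) ((congrArg (F.map (x ◁ (ρ_ y).inv) ⊗ₘ ·)
        (tensorListMap_id F l)).trans (tensorHom_id _ _))
    · exact congrArg _ (tensorHom_id _ _).symm
  have h2 : tensorListMap (𝟭 C) φ ≫ plugCoh (.cons x (.cons y (.nil l))) (𝟙 _) =
      (Regrouping.merge F 0 (x :: y :: l)).coh := by
    refine Eq.trans ?_ (whiskerRight_inv_associator x y (tensorList (𝟭 C) l))
    refine congrArg₂ (· ≫ ·) ((congrArg ((x ◁ (ρ_ y).inv) ⊗ₘ ·)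
        (tensorListMap_id (𝟭 C) l)).trans (tensorHom_id _ _)) ?_
    exact (congrArg (· ≫ _) (MonoidalCategory.whiskerLeft_id _ _)).trans (Category.id_comp _)
  rw [Functional.plug, ← h1, hh.map_comp φ, h2]
  rfl

variable [MonoidalPreadditive D]

theorem product_eq (x y : Homog (cochains F)) :
    product F x.val y.val =
      x.deg.negOnePow • substitution F (muHomog F).val (vals [x, y]) := by
  funext l
  have h := substitution_vals (muHomog F).val [x, y] l
  refine Eq.trans ?_ (congrArg (x.deg.negOnePow • ·)
    (h.trans (insSum_pair_muCochain x y l))).symm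
  rw [smul_cutSum, ← sum_at_eq_cutSum]
  change (((List.range (l.length + 1)).map fun k => _).sum) = _
  congr 1
  refine List.map_congr_left fun k hk => ?_
  have hk' : k ≤ l.length := Nat.lt_succ_iff.mp (List.mem_range.mp hk)
  rw [juxtapose_eq]
  by_cases hx : (k : ℤ) = x.deg
  · by_cases hy : ((l.length - k : ℕ) : ℤ) = y.deg
    · rw [Nat.cast_sub hk'] at hy
      rw [hy, ← hx, smul_smul, ← Int.negOnePow_add, List.length_take, min_eq_left hk',
        HomotopyG.deg_eq y]
      congr 2
      ring
    · rw [val_apply_eq_zero y _ (by rwa [List.length_drop]), mulHom_zero_right, smul_zero,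
        smul_zero, smul_zero]
  · rw [val_apply_eq_zero x _ (by rwa [List.length_take, min_eq_left hk']), mulHom_zero_left,
      smul_zero, smul_zero, smul_zero]

theorem plug_muCochain_of_length_ne {l u v : List C} (q : Cut l u v) {h : Functional F l E}
    (hh : h.IsGood) (hu : u.length ≠ 2) : h.plug (muCochain F u) q = 0 := by
  rw [muCochain_of_length_ne hu, Functional.plug_zero hh.map_zero]

theorem insSum_muHomog_nil (a : ℤ) {h : Functional F [] E} (hh : h.IsGood) :
    insSum [muHomog F] a [] h = 0 := by
  rw [insSum_cons_nil, plugSum_apply, cutSum_nil]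
  change _ • (insSum [] _ _) (h.plug (muCochain F []) _) = _
  rw [plug_muCochain_of_length_ne _ hh (by simp), map_zero, smul_zero]

/-- Inserting `μ` in all possible ways amounts to multiplying neighbouring inputs. -/
theorem insSum_muHomog (a : ℤ) (x : C) (xs : List C) {h : Functional F (x :: xs) E}
    (hh : h.IsGood) :
    insSum [muHomog F] a (x :: xs) h = ∑ i ∈ Finset.range xs.length,
      (a + i).negOnePow • h _ (Regrouping.merge F i (x :: xs)).hom
        (Regrouping.merge F i (x :: xs)).coh := by
  have h0 {l u v : List C} (q : Cut l u v) (h : Functional F l E) (hh : h.IsGood) :=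
    plug_muCochain_of_length_ne q hh
  induction xs generalizing a x with
  | nil =>
    rw [insSum_cons_cons, insSum_cons_nil, plugSum_apply, plugSum_apply]
    simp only [cutSum_cons, cutSum_nil]
    change _ • (insSum [] _ _) (h.plug (muCochain F _) _) +
      _ • (insSum [] _ _) (h.plug (muCochain F _) _) +
      _ • (insSum [] _ _) (h.keep.plug (muCochain F _) _) = _
    rw [h0 _ h hh (by simp), h0 _ h hh (by simp), h0 _ h.keep hh.keep (by simp)]
    simp
  | cons y xs ih =>
    rw [insSum_cons_cons, ih _ _ hh.keep, List.length_cons, Finset.sum_range_succ']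
    rw [add_comm]
    refine congrArg₂ (· + ·) (Finset.sum_congr rfl fun i _ => ?_) ?_
    · rw [Nat.cast_succ, add_right_comm, add_assoc]
      rfl
    · rw [plugSum_apply, cutSum_cons, cutSum_cons, cutSum_eq_nil]
      · change _ • (insSum [] _ _) (h.plug (muCochain F _) _) +
          (_ • (insSum [] _ _) (h.plug (muCochain F _) _) +
          _ • (insSum [] _ _) (h.plug (muCochain F _) _)) = _
        rw [h0 _ h hh (by simp), h0 _ h hh (by simp), map_zero, map_zero, smul_zero,
          zero_add, muHomog_sdeg, one_mul, Nat.cast_zero, add_zero, insSum_nil,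
          plug_muCochain_eq_merge hh]
        exact zero_add _
      · intro u v q hu
        refine (congrArg _ ((congrArg _ (h0 _ h hh ?_)).trans (map_zero _))).trans (smul_zero _)
        simpa using hu

/-- The part of `μ{c}` in which the first input is not kept.  Keeping the last input is the same as
inserting the identity cochain, which vanishes unless there is just one input left. -/
theorem plugSum_muCochain (c : Homog (cochains F)) (l : List C) :
    plugSum c.sdeg c.val (insSum []) 0 l (evalFunctional F (muCochain F) l) =
      cutSum l fun u v q => mulHom q (c.val u) (identityCochain F v) := by
  rw [plugSum_apply]
  refine cutSum_congr l fun u v q => ?_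
  rw [mul_zero, Int.negOnePow_zero, one_smul, insSum_nil]
  have hh := ((isGood_evalFunctional (isNatural_muCochain (F := F)) l).plug (c.val u) q)
  have h0 (hv : v.length ≠ 1) :
      (evalFunctional F (muCochain F) l).plug (c.val u) q v (𝟙 _) (𝟙 _) =
        mulHom q (c.val u) (identityCochain F v) := by
    rw [identityCochain_of_length_ne hv, mulHom_zero_right, Functional.plug,
      evalFunctional_muCochain_of_length_ne]
    exact fun h => hv (Nat.succ_injective h)
  match v, q, hh, h0 with
  | [], _, _, h0 => exact h0 (by simp)
  | [z], q, hh, _ =>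
    rw [← evalFunctional_muCochain_plug_plug]
    change _ = Functional.plug _ (identityCochain F [z]) (.cons z (.nil [])) _ _ _
    rw [← hh.keep_eq_plug, Functional.keep, keepHom_id, keepHom_id]
  | _ :: _ :: _, _, _, h0 => exact h0 (by simp)

/-- `μ{c}` consists of `μ (c (n₁, …, nₖ), nₖ₊₁)` and `± μ (n₁, c (n₂, …, nₖ₊₁))`. -/
theorem substitution_muHomog_singleton (c : Homog (cochains F)) (x : C) (xs : List C) :
    substitution F (muHomog F).val (vals [c]) (x :: xs) =
      juxtapose F c.val (identityCochain F) xs.length (x :: xs) +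
        c.sdeg.negOnePow • juxtapose F (identityCochain F) c.val 1 (x :: xs) := by
  rw [substitution_vals, insSum_cons_cons]
  refine congrArg₂ (· + ·) ((plugSum_muCochain c (x :: xs)).trans ?_) ?_
  · rw [juxtapose_eq, ← sum_at_eq_cutSum]
    change ∑ k ∈ Finset.range _, _ = _
    refine Finset.sum_eq_single xs.length (fun k hk hk' => ?_) fun h => ?_
    · rw [identityCochain_of_length_ne, mulHom_zero_right]
      have := Finset.mem_range.mp hk
      simp only [List.length_drop, List.length_cons] at this ⊢
      omega
    · exact absurd (Finset.mem_range.mpr (by simp)) h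
  · have hh := isGood_evalFunctional (isNatural_muCochain (F := F)) (x :: xs)
    have h1 := insSum_singleton c (0 + 1) xs (evalFunctional F (muCochain F) (x :: xs)).keep
      fun o f p ho => evalFunctional_muCochain_of_length_ne _ (x :: o) _ _
        (Nat.ne_of_gt (Nat.succ_lt_succ ho))
    rw [zero_add, mul_one, hh.keep_eq_plug, evalFunctional_muCochain_plug_plug] at h1
    rw [juxtapose_eq, zero_add]
    exact (congrArg (insSum [c] 1 xs) hh.keep_eq_plug).trans h1

theorem differential_eq (c : Homog (cochains F)) :
    differential F c.val = substitution F (muHomog F).val (vals [c]) -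
      c.sdeg.negOnePow • substitution F c.val (vals [muHomog F]) := by
  funext l
  refine Eq.trans ?_ (congrArg₂ (· - ·) rfl (congrArg (c.sdeg.negOnePow • ·)
    (substitution_vals c.val [muHomog F] l))).symm
  cases l with
  | nil =>
    rw [substitution_vals, insSum_muHomog_nil 0 (isGood_evalFunctional (isNatural_val c) _),
      smul_zero, sub_zero]
    exact ((plugSum_muCochain c []).trans (mulHom_zero_right _ _)).symm
  | cons x xs =>
    rw [substitution_muHomog_singleton, insSum_muHomog 0 x xs
      (isGood_evalFunctional (isNatural_val c) _), differential, add_right_comm, Finset.smul_sum]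
    refine Eq.trans ?_ (sub_eq_add_neg _ _).symm
    rw [← Finset.sum_neg_distrib]
    refine congrArg₂ (· + ·) ((add_comm _ _).trans (congrArg _ ?_)) (Finset.sum_congr rfl ?_)
    · by_cases hc : (xs.length : ℤ) = c.deg
      · rw [hc]
        rfl
      · rw [juxtapose_eq, show c.val (List.drop 1 (x :: xs)) = 0 from
          val_apply_eq_zero c xs hc, mulHom_zero_right, smul_zero, smul_zero]
    · intro i hi
      change _ • evalFunctional F c.val (x :: xs) _ _ _ = _
      by_cases hc : (xs.length : ℤ) = c.deg
      · rw [hc, zero_add, smul_smul, HomotopyG.deg_eq, ← add_assoc, Int.negOnePow_succ,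
          ← Int.negOnePow_add, add_comm (i : ℤ), Units.neg_smul]
      · have : evalFunctional F c.val (x :: xs) (Regrouping.merge F i (x :: xs)).outer
            (Regrouping.merge F i (x :: xs)).hom (Regrouping.merge F i (x :: xs)).coh = 0 := by
          rw [evalFunctional, val_apply_eq_zero c _ (by
            rwa [merge_outer_length i x xs (Finset.mem_range.mp hi)]), Limits.zero_comp,
            Limits.comp_zero]
        rw [this, smul_zero, smul_zero, smul_zero, neg_zero]

omit [MonoidalPreadditive D] in
/-- This is the associativity of `μ`. -/
theorem eval_merge_zero_eq_eval_merge_one (x y z : C) :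
    (Regrouping.merge F 0 [x, y, z]).eval (muCochain F) =
      (Regrouping.merge F 1 [x, y, z]).eval (muCochain F) := by
  have h1 : (α_ (F.obj x) (F.obj y) (F.obj z ⊗ 𝟙_ D)).inv ≫
      Functor.LaxMonoidal.μ F x y ▷ (F.obj z ⊗ 𝟙_ D) ≫ F.obj (x ⊗ y) ◁ (ρ_ (F.obj z)).hom =
      F.obj x ◁ F.obj y ◁ (ρ_ (F.obj z)).hom ≫ (α_ _ _ _).inv ≫
        Functor.LaxMonoidal.μ F x y ▷ F.obj z := by
    rw [← whisker_exchange, associator_inv_naturality_right_assoc]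
  have h2 : (x ⊗ y) ◁ (ρ_ z).inv ≫ (α_ x y (z ⊗ 𝟙_ C)).hom =
      (α_ x y z).hom ≫ x ◁ y ◁ (ρ_ z).inv :=
    associator_naturality_right _ _ _
  have h3 : F.obj x ◁ ((α_ (F.obj y) (F.obj z) (𝟙_ D)).inv ≫
        Functor.LaxMonoidal.μ F y z ▷ 𝟙_ D) ≫ F.obj x ◁ (ρ_ (F.obj (y ⊗ z))).hom =
      F.obj x ◁ F.obj y ◁ (ρ_ (F.obj z)).hom ≫ F.obj x ◁ Functor.LaxMonoidal.μ F y z := by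
    rw [← MonoidalCategory.whiskerLeft_comp, Category.assoc, rightUnitor_naturality]
    simp [-Functor.LaxMonoidal.right_unitality]
  have h4 : x ◁ (ρ_ (y ⊗ z)).inv ≫ x ◁ (α_ y z (𝟙_ C)).hom = x ◁ y ◁ (ρ_ z).inv := by
    simp
  change ((α_ (F.obj x) (F.obj y) (F.obj z ⊗ 𝟙_ D)).inv ≫
      Functor.LaxMonoidal.μ F x y ▷ (F.obj z ⊗ 𝟙_ D)) ≫ (F.obj (x ⊗ y) ◁ (ρ_ (F.obj z)).hom ≫
        Functor.LaxMonoidal.μ F (x ⊗ y) z ≫ F.map ((x ⊗ y) ◁ (ρ_ z).inv)) ≫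
          F.map (α_ x y (z ⊗ 𝟙_ C)).hom =
    F.obj x ◁ ((α_ (F.obj y) (F.obj z) (𝟙_ D)).inv ≫ Functor.LaxMonoidal.μ F y z ▷ 𝟙_ D) ≫
      (F.obj x ◁ (ρ_ (F.obj (y ⊗ z))).hom ≫ Functor.LaxMonoidal.μ F x (y ⊗ z) ≫
        F.map (x ◁ (ρ_ (y ⊗ z)).inv)) ≫ F.map (x ◁ (α_ y z (𝟙_ C)).hom)
  simp only [Category.assoc, ← F.map_comp]
  rw [reassoc_of% h1, reassoc_of% h3, h2, h4, F.map_comp, Functor.LaxMonoidal.associativity_assoc,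
    Iso.inv_hom_id_assoc]

/-- `μ{μ} (n₁, n₂, n₃) = μ (μ (n₁, n₂), n₃) - μ (n₁, μ (n₂, n₃)) = 0` -/
theorem substitution_muHomog_self :
    substitution F (muHomog F).val (vals [muHomog F]) = 0 := by
  funext l
  rw [substitution_vals]
  have hh := isGood_evalFunctional (isNatural_muCochain (F := F)) l
  cases l with
  | nil => exact insSum_muHomog_nil 0 hh
  | cons x xs =>
    refine (insSum_muHomog 0 x xs hh).trans ?_
    by_cases hxs : xs.length = 2
    · obtain ⟨y, z, rfl⟩ := List.length_eq_two.mp hxs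
      have h : (0 + (0 : ℤ)).negOnePow • (Regrouping.merge F 0 [x, y, z]).eval (muCochain F) +
          (0 + (1 : ℤ)).negOnePow • (Regrouping.merge F 1 [x, y, z]).eval (muCochain F) = 0 := by
        rw [eval_merge_zero_eq_eval_merge_one]
        simp
      refine (Finset.sum_range_succ _ 1).trans ?_
      rw [Finset.sum_range_one]
      exact h
    · refine Finset.sum_eq_zero fun i hi => ?_
      rw [evalFunctional_muCochain_of_length_ne, smul_zero]
      rwa [merge_outer_length i x xs (Finset.mem_range.mp hi)]

theorem isMultiplication_muHomog (F : C ⥤ D) [F.LaxMonoidal] :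
    IsMultiplication (substitution F) (muHomog F) (differential F) (product F) where
  deg_eq := rfl
  brace_self := substitution_muHomog_self
  d_eq := differential_eq
  mul_eq := product_eq

end Operations

end MonoidalHochschild

theorem mainTheorem1
    {C : Type u₁} [Category.{v₁} C] [Abelian C] [MonoidalCategory C] [MonoidalPreadditive C]
    {D : Type u₂} [Category.{v₂} D] [Abelian D] [MonoidalCategory D] [MonoidalPreadditive D]
    (F : C ⥤ D) [F.LaxMonoidal] :
    HomotopyG.IsHomotopyGAlgebra
      (MonoidalHochschild.cochains F)
      (MonoidalHochschild.differential F)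
      (MonoidalHochschild.product F)
      (MonoidalHochschild.substitution F) := by
  exact (MonoidalHochschild.isMultiplication_muHomog F).isHomotopyGAlgebra
    (MonoidalHochschild.isBraceAlgebra_cochains F) (MonoidalHochschild.iSupIndep_cochains F)
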